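/- Let $(M,g)$ be an $n$-dimensional oriented Riemannian manifold with a fixed spin structure, $\nabla^L$ its Levi-Civita connection, and $S(TM)$ its spinor bundle with the spin connection $\nabla^{S(TM)}$ induced by $\nabla^L$ and Clifford multiplication $c$, normalised by $c(X)c(Y)+c(Y)c(X)=-2g(X,Y)$. Let $F\to M$ be a smooth vector bundle of finite rank (real or complex) with a smooth fibre metric (Euclidean or Hermitian), let $\widetilde\nabla^F$ be any smooth connection on $F$, not necessarily compatible with the metric, and let $\widetilde\nabla^{F,*}$ be its dual connection, defined by $X\langle\sigma,\tau\rangle=\langle\widetilde\nabla^F_X\sigma,\tau\rangle+\langle\sigma,\widetilde\nabla^{F,*}_X\tau\rangle$. Put $$\nabla^F=\tfrac12\big(\widetilde\nabla^F+\widetilde\nabla^{F,*}\big),\qquad \Phi=\tfrac12\big(\widetilde\nabla^F-\widetilde\nabla^{F,*}\big)\in\Omega^1(M,\mathrm{End}\,F),$$ and let $\Phi^*(X)$ be the fibrewise adjoint of $\Phi(X)$. On $S(TM)\otimes F$ write $c(X)$ for $c(X)\otimes\mathrm{id}_F$ and let $$\nabla^{S(TM)\otimes F}=\nabla^{S(TM)}\otimes\mathrm{id}_F+\mathrm{id}_{S(TM)}\otimes\nabla^F,\qquad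 \widetilde\nabla^{S(TM)\otimes F}=\nabla^{S(TM)}\otimes\mathrm{id}_F+\mathrm{id}_{S(TM)}\otimes\widetilde\nabla^F .$$ For a smooth local orthonormal frame $(e_i)$ of $TM$ put $$c(\Phi)=\sum_i c(e_i)\otimes\Phi(e_i),\qquad c(\Phi^*)=\sum_i c(e_i)\otimes\Phi^*(e_i),$$ $$D_F=\sum_i c(e_i)\nabla^{S(TM)\otimes F}_{e_i},\qquad \widetilde D_F=\sum_i c(e_i)\widetilde\nabla^{S(TM)\otimes F}_{e_i},\qquad \widetilde D_F^*=D_F-c(\Phi^*),$$ and for a vector field $X$ $$\overline\nabla_X=\nabla^{S(TM)\otimes F}_X+\tfrac12\big[c(\Phi^*)c(X)-c(X)c(\Phi)\big].$$ Then, for every smooth local orthonormal frame $(e_i)$ and every smooth local frame $(\partial_i)$ of $TM$ on a common open set (in particular for coordinate frames $(\partial_i)$), with $(g^{ij})$ the inverse of the matrix $g_{ij}=g(\partial_i,\partial_j)$, the following identity of operators on smooth sections of $S(TM)\otimes F$ holds there: $$\begin{aligned}\widetilde D_F^*\widetilde D_F={}&-\sum_{i,j}g^{ij}\big(\overline\nabla_{\partial_i}\overline\nabla_{\partial_j}-\overline\nabla_{\nabla^L_{\partial_i}\partial_j}\big)+\tfrac14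 s+\tfrac12\sum_{i\neq j}R^F(e_i,e_j)c(e_i)c(e_j)-c(\Phi^*)c(\Phi)\\&+\tfrac12\sum_j\big(\nabla^F_{e_j}c(\Phi^*)\big)c(e_j)+\tfrac12\sum_jc(e_j)\,\nabla^F_{e_j}c(\Phi)+\tfrac14\sum_i\big[c(\Phi^*)c(e_i)-c(e_i)c(\Phi)\big]^2 .\end{aligned}$$ Here $s$ is the scalar curvature of $(M,g)$, $R^F(X,Y)=\nabla^F_X\nabla^F_Y-\nabla^F_Y\nabla^F_X-\nabla^F_{[X,Y]}$ is the curvature of $\nabla^F$ (acting on $S(TM)\otimes F$ through $F$), and $\nabla^F_Xc(\Phi)$, $\nabla^F_Xc(\Phi^*)$ denote the covariant derivatives of the endomorphisms $c(\Phi)$, $c(\Phi^*)$ of $S(TM)\otimes F$, that is, $(\nabla^F_XT)\psi=\nabla^{S(TM)\otimes F}_X(T\psi)-T\big(\nabla^{S(TM)\otimes F}_X\psi\big)$. -/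

import Mathlib

open scoped Manifold ContDiff Bundle Topology
open Bundle

noncomputable section

/-! ### Clifford algebra and spin structures -/

/-- The quadratic form `v ↦ -‖v‖²` on `ℝⁿ`; its Clifford algebra satisfies `v * v = -‖v‖²`. -/
def cliffordForm (n : ℕ) : QuadraticForm ℝ (EuclideanSpace ℝ (Fin n)) :=
  -LinearMap.BilinMap.toQuadraticMap (innerₗ (EuclideanSpace ℝ (Fin n)))

theorem cliffordForm_apply (n : ℕ) (v : EuclideanSpace ℝ (Fin n)) :
    cliffordForm n v = -‖v‖ ^ 2 := by
  simp [cliffordForm]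

/-- The real Clifford algebra of Euclidean `ℝⁿ`, with the relation `v * v = -‖v‖²`. -/
abbrev Cl (n : ℕ) : Type := CliffordAlgebra (cliffordForm n)

/-- The inclusion of vectors `ℝⁿ → Cl n`. -/
abbrev clVec (n : ℕ) : EuclideanSpace ℝ (Fin n) →ₗ[ℝ] Cl n := CliffordAlgebra.ι (cliffordForm n)

/-- The compact group `Spin(n)`, inside the Clifford algebra. -/
abbrev SpinGrp (n : ℕ) : Type := spinGroup (cliffordForm n)

section Frames

variable {n : ℕ} {M : Type*} [TopologicalSpace M] [ChartedSpace (EuclideanSpace ℝ (Fin n)) M]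
  [IsManifold (𝓡 n) ∞ M]

/-- A smooth local orthonormal frame of `TM` over `U`. -/
structure IsOrthonormalFrameOn [RiemannianBundle (fun x : M ↦ TangentSpace (𝓡 n) x)]
    (e : Fin n → (x : M) → TangentSpace (𝓡 n) x) (U : Set M) : Prop where
  smooth : ∀ i, ContMDiffOn (𝓡 n) ((𝓡 n).prod 𝓘(ℝ, EuclideanSpace ℝ (Fin n))) ∞ (T% (e i)) U
  orthonormal : ∀ x ∈ U, Orthonormal ℝ (fun i ↦ e i x)

variable (n M) in
/-- A spin structure on a Riemannian `n`-manifold, given by an atlas of spin gauges: a cover by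
open sets `U a`, an orthonormal frame `e^a` over each `U a`, and a smooth `Spin(n)`-valued cocycle
`g_{ab}` over `U a ∩ U b` which lifts the transition functions of the frames through the double
cover `λ : Spin(n) → SO(n)`, `λ(g) v = g v g⁻¹`, that is, `e^b_k = ∑ j, λ(g_{ab})_{jk} e^a_j`.
The frames `e^a` are positively oriented for one orientation of `M`, since their transition
functions take values in `SO(n)`; so this datum contains the orientation. -/
structure SpinStructure [RiemannianBundle (fun x : M ↦ TangentSpace (𝓡 n) x)] (ι : Type*) where
  /-- The domain of a gauge. -/
  U : ι → Set M
  isOpen_U : ∀ a, IsOpen (U a)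
  cover : ∀ x, ∃ a, x ∈ U a
  /-- The orthonormal frame of a gauge. -/
  frame : ι → Fin n → (x : M) → TangentSpace (𝓡 n) x
  isFrame : ∀ a, IsOrthonormalFrameOn (frame a) (U a)
  /-- The transition functions `g_{ab}`. -/
  trans : ι → ι → M → SpinGrp n
  smooth_trans : ∀ a b (l : Cl n →ₗ[ℝ] ℝ),
    ContMDiffOn (𝓡 n) 𝓘(ℝ, ℝ) ∞ (fun x ↦ l (trans a b x : Cl n)) (U a ∩ U b)
  cocycle : ∀ a b c x, x ∈ U a → x ∈ U b → x ∈ U c → trans a b x * trans b c x = trans a c x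
  lift : ∀ a b x, x ∈ U a → x ∈ U b → ∀ k,
    (trans a b x : Cl n) * clVec n (EuclideanSpace.single k 1) * ((trans a b x)⁻¹ : SpinGrp n) =
      ∑ j, (inner ℝ (frame a j x) (frame b k x) : ℝ) • clVec n (EuclideanSpace.single j 1)

set_option synthInstance.maxHeartbeats 400000 in
/-- The Levi-Civita connection: the smooth, metric, torsion-free connection on `TM`. -/
structure IsLeviCivita [RiemannianBundle (fun x : M ↦ TangentSpace (𝓡 n) x)]
    [IsContMDiffRiemannianBundle (𝓡 n) ∞ (EuclideanSpace ℝ (Fin n))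
      (fun x : M ↦ TangentSpace (𝓡 n) x)]
    (D : CovariantDerivative (𝓡 n) (EuclideanSpace ℝ (Fin n))
      (fun x : M ↦ TangentSpace (𝓡 n) x)) : Prop where
  smooth : D.ContMDiffCovariantDerivative ∞
  metric : D.IsMetricCompatible
  torsionFree : D.torsion = 0

end Frames

/-! ### Curvature of a connection -/

section Curvature

variable {n : ℕ} {M : Type*} [TopologicalSpace M] [ChartedSpace (EuclideanSpace ℝ (Fin n)) M]
  {V : M → Type*} [∀ x, AddCommGroup (V x)] [∀ x, Module ℝ (V x)] [∀ x, TopologicalSpace (V x)]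

/-- `R(X, Y) σ = ∇_X ∇_Y σ - ∇_Y ∇_X σ - ∇_{[X, Y]} σ`. -/
def curvatureOp (D : ((x : M) → V x) → (x : M) → TangentSpace (𝓡 n) x →L[ℝ] V x)
    (X Y : (x : M) → TangentSpace (𝓡 n) x) (σ : (x : M) → V x) (x : M) : V x :=
  D (fun y ↦ D σ y (Y y)) x (X x) - D (fun y ↦ D σ y (X y)) x (Y x)
    - D σ x (VectorField.mlieBracket (𝓡 n) X Y x)

/-- The scalar curvature `s = ∑ i j, ⟨R(e_i, e_j) e_j, e_i⟩`, with respect to an orthonormal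
frame. -/
def scalarCurvature [IsManifold (𝓡 n) ∞ M]
    [RiemannianBundle (fun x : M ↦ TangentSpace (𝓡 n) x)]
    (L : CovariantDerivative (𝓡 n) (EuclideanSpace ℝ (Fin n)) (fun x : M ↦ TangentSpace (𝓡 n) x))
    (e : Fin n → (x : M) → TangentSpace (𝓡 n) x) (x : M) : ℝ :=
  ∑ i, ∑ j, inner ℝ (curvatureOp L (e i) (e j) (e j) x) (e i x)

end Curvature

/-! ### Connections on the auxiliary bundle -/

section Aux

set_option linter.unusedSectionVars false

variable {n : ℕ} {M : Type*} [TopologicalSpace M] [ChartedSpace (EuclideanSpace ℝ (Fin n)) M]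
  [IsManifold (𝓡 n) ∞ M]
  {𝕜 : Type*} [RCLike 𝕜]
  {Fm : Type*} [NormedAddCommGroup Fm] [NormedSpace 𝕜 Fm] [NormedSpace ℝ Fm]
  [IsScalarTower ℝ 𝕜 Fm] [FiniteDimensional ℝ Fm]
  {V : M → Type*} [∀ x, NormedAddCommGroup (V x)] [∀ x, InnerProductSpace 𝕜 (V x)]
  [∀ x, NormedSpace ℝ (V x)] [∀ x, IsScalarTower ℝ 𝕜 (V x)]
  [TopologicalSpace (TotalSpace Fm V)] [FiberBundle Fm V]
  [VectorBundle 𝕜 Fm V] [VectorBundle ℝ Fm V] [ContMDiffVectorBundle ∞ Fm V (𝓡 n)]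

variable (n 𝕜 Fm V) in
/-- The (`𝕜`-valued) fibre metric of `V` is smooth. -/
def IsSmoothFibreMetric : Prop :=
  ∀ (σ τ : (x : M) → V x) (x : M), ContMDiffAt (𝓡 n) ((𝓡 n).prod 𝓘(ℝ, Fm)) ∞ (T% σ) x → ContMDiffAt (𝓡 n) ((𝓡 n).prod 𝓘(ℝ, Fm)) ∞ (T% τ) x →
    ContMDiffAt (𝓡 n) 𝓘(ℝ, 𝕜) ∞ (fun y ↦ inner 𝕜 (σ y) (τ y)) x

variable (n 𝕜 Fm V) in
/-- A smooth `𝕜`-linear connection on the `𝕜`-vector bundle `V`. -/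
structure LinConnection extends CovariantDerivative (𝓡 n) Fm V where
  smooth : toCovariantDerivative.ContMDiffCovariantDerivative ∞
  smul : ∀ (c : 𝕜) (σ : (x : M) → V x) (x : M), MDifferentiableAt (𝓡 n) ((𝓡 n).prod 𝓘(ℝ, Fm)) (T% σ) x →
    ∀ v : TangentSpace (𝓡 n) x, toFun (fun y ↦ c • σ y) x v = c • toFun σ x v

/-- `D'` is the dual of `D` with respect to the fibre metric:
`X⟨σ, τ⟩ = ⟨D_X σ, τ⟩ + ⟨σ, D'_X τ⟩`. -/
def IsDualConnection (D D' : LinConnection n 𝕜 Fm V) : Prop :=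
  ∀ (σ τ : (x : M) → V x) (x : M), MDifferentiableAt (𝓡 n) ((𝓡 n).prod 𝓘(ℝ, Fm)) (T% σ) x → MDifferentiableAt (𝓡 n) ((𝓡 n).prod 𝓘(ℝ, Fm)) (T% τ) x →
    ∀ v : TangentSpace (𝓡 n) x,
      mvfderiv (𝓡 n) (fun y ↦ inner 𝕜 (σ y) (τ y)) x v =
        inner 𝕜 (D.toFun σ x v) (τ x) + inner 𝕜 (σ x) (D'.toFun τ x v)

/-- Multiplication of a section by a scalar of `𝕜` preserves differentiability. -/
theorem mdifferentiableAt_smul_scalar (c : 𝕜) {σ : (x : M) → V x} {x : M}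
    (h : MDifferentiableAt (𝓡 n) ((𝓡 n).prod 𝓘(ℝ, Fm)) (T% σ) x) :
    MDifferentiableAt (𝓡 n) ((𝓡 n).prod 𝓘(ℝ, Fm)) (T% (fun y ↦ c • σ y)) x := by
  rw [mdifferentiableAt_section] at h ⊢
  have hL : MDifferentiableAt (𝓡 n) 𝓘(ℝ, Fm)
      (fun y ↦ (c • ContinuousLinearMap.id 𝕜 Fm).restrictScalars ℝ
        ((trivializationAt Fm V x) ⟨y, σ y⟩).2) x :=
    ((c • ContinuousLinearMap.id 𝕜 Fm).restrictScalars ℝ).differentiableAt.mdifferentiableAt.comp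
      x h
  refine hL.congr_of_eventuallyEq ?_
  filter_upwards [(trivializationAt Fm V x).open_baseSet.mem_nhds
    (FiberBundle.mem_baseSet_trivializationAt' x)] with y hy
  simpa using ((trivializationAt Fm V x).linear 𝕜 hy).map_smul c (σ y)

theorem midConnection_eq (D D' : CovariantDerivative (𝓡 n) Fm V) :
    (fun (σ : (x : M) → V x) (x : M) ↦ (1 / 2 : ℝ) • (D σ x + D' σ x)) =
      (D.affineCombination D' (fun _ ↦ (1 / 2 : ℝ))).toFun := by
  funext σ x
  ext v
  simp only [CovariantDerivative.affineCombination, Pi.add_apply, Pi.smul_apply', Pi.sub_apply,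
    Pi.one_apply, smul_add]
  norm_num

/-- The metric connection `(D + D') / 2`. -/
def midConnection (D D' : LinConnection n 𝕜 Fm V) : LinConnection n 𝕜 Fm V where
  toFun σ x := (1 / 2 : ℝ) • (D.toFun σ x + D'.toFun σ x)
  isCovariantDerivativeOnUniv := by
    have h := midConnection_eq D.toCovariantDerivative D'.toCovariantDerivative
    rw [h]
    exact (D.affineCombination D'.toCovariantDerivative _).isCovariantDerivativeOnUniv
  smooth := by
    constructor
    have h := midConnection_eq D.toCovariantDerivative D'.toCovariantDerivative
    dsimp only
    rw [h]
    exact (CovariantDerivative.ContMDiffCovariantDerivative.affineCombination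
      D.toCovariantDerivative D'.toCovariantDerivative contMDiff_const D.smooth D'.smooth).contMDiff
  smul c σ x h v := by
    have h1 := D.smul c σ x h v
    have h2 := D'.smul c σ x h v
    change (1 / 2 : ℝ) • (D.toFun (fun y ↦ c • σ y) x v + D'.toFun (fun y ↦ c • σ y) x v) =
      c • (1 / 2 : ℝ) • (D.toFun σ x v + D'.toFun σ x v)
    rw [h1, h2, ← smul_add, smul_comm]

set_option synthInstance.maxHeartbeats 400000 in
/-- The endomorphism valued one-form `(D - D') / 2`. -/
def halfDifference (D D' : LinConnection n 𝕜 Fm V) (x : M) (v : TangentSpace (𝓡 n) x) :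
    V x →ₗ[𝕜] V x where
  toFun u := (1 / 2 : ℝ) • D.difference D'.toCovariantDerivative x u v
  map_add' u w := by simp
  map_smul' c u := by
    have hu := FiberBundle.mdifferentiableAt_extend (𝓡 n) Fm u
    have hcu := mdifferentiableAt_smul_scalar c hu
    have e1 := IsCovariantDerivativeOn.difference_apply D.isCovariantDerivativeOnUniv
      D'.isCovariantDerivativeOnUniv (x := x) trivial hu
    have e2 := IsCovariantDerivativeOn.difference_apply D.isCovariantDerivativeOnUniv
      D'.isCovariantDerivativeOnUniv (x := x) trivial hcu
    have h1 := D.smul c _ x hu v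
    have h2 := D'.smul c _ x hu v
    simp only [FiberBundle.extend_apply_self] at e1 e2
    change (1 / 2 : ℝ) • (D.isCovariantDerivativeOnUniv.difference
        D'.isCovariantDerivativeOnUniv x (c • u) v) =
      c • (1 / 2 : ℝ) • (D.isCovariantDerivativeOnUniv.difference
        D'.isCovariantDerivativeOnUniv x u v)
    rw [e1, e2]
    simp only [sub_apply]
    rw [h1, h2, ← smul_sub, smul_comm]

variable (𝕜 Fm) in
/-- The fibrewise adjoint of an endomorphism of `V`. -/
def fibreAdjoint {x : M} (T : V x →ₗ[𝕜] V x) : V x →ₗ[𝕜] V x :=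
  haveI : FiniteDimensional 𝕜 Fm := FiniteDimensional.right ℝ 𝕜 Fm
  haveI : FiniteDimensional 𝕜 (V x) := VectorBundle.finiteDimensional 𝕜 Fm V x
  LinearMap.adjoint T

end Aux

/-! ### Sections of `S(TM) ⊗ V` and the operators acting on them

Let `ρ : Cl n → Mat_N(𝕜)` be a representation, `Δ = 𝕜^N`, and `S(TM)` the bundle associated with
the spin structure through `ρ`. Over the gauge `U a` the bundle `S(TM) ⊗ V` is
`Δ ⊗ V = V × ⋯ × V`, so a section is there an `N`-tuple of sections of `V`, and `V`-valued tuples in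
two gauges are related by `ψ_a = ρ(g_{ab}) ψ_b`. All operators below are written in one gauge, whose
orthonormal frame is `e`; the matrices of `ρ` act on the `Δ` factor. -/

section Spinors

variable {n N : ℕ} {M : Type*} [TopologicalSpace M]
  [ChartedSpace (EuclideanSpace ℝ (Fin n)) M] [IsManifold (𝓡 n) ∞ M]
  [RiemannianBundle (fun x : M ↦ TangentSpace (𝓡 n) x)]
  {𝕜 : Type*} [RCLike 𝕜]
  {Fm : Type*} [NormedAddCommGroup Fm] [NormedSpace 𝕜 Fm] [NormedSpace ℝ Fm]
  [IsScalarTower ℝ 𝕜 Fm] [FiniteDimensional ℝ Fm]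
  {V : M → Type*} [∀ x, NormedAddCommGroup (V x)] [∀ x, InnerProductSpace 𝕜 (V x)]
  [∀ x, NormedSpace ℝ (V x)] [∀ x, IsScalarTower ℝ 𝕜 (V x)]
  [TopologicalSpace (TotalSpace Fm V)] [FiberBundle Fm V]
  [VectorBundle 𝕜 Fm V] [VectorBundle ℝ Fm V] [ContMDiffVectorBundle ∞ Fm V (𝓡 n)]

/-- The action of an `N × N` matrix on `𝕜^N ⊗ W = W^N`. -/
def matAct {W : Type*} [AddCommGroup W] [Module 𝕜 W] (m : Matrix (Fin N) (Fin N) 𝕜)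
    (u : Fin N → W) : Fin N → W :=
  fun A ↦ ∑ B, m A B • u B

variable (Fm V) in
/-- A smooth section of `S(TM) ⊗ V`, through its representatives in the spin gauges. The values of
a representative off the domain of its gauge are irrelevant. -/
structure SpinorField {ι : Type*} (P : SpinStructure n M ι)
    (ρ : Cl n →ₐ[ℝ] Matrix (Fin N) (Fin N) 𝕜) where
  /-- The representative in a gauge. -/
  rep : ι → (x : M) → Fin N → V x
  smooth : ∀ a A, ContMDiffOn (𝓡 n) ((𝓡 n).prod 𝓘(ℝ, Fm)) ∞ (T% (fun x ↦ rep a x A)) (P.U a)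
  transition : ∀ a b x, x ∈ P.U a → x ∈ P.U b →
    rep a x = matAct (ρ (P.trans a b x : Cl n)) (rep b x)

/-- The vector of `ℝⁿ` formed by the components of `v ∈ T_x M` in the orthonormal frame `e`. -/
def frameCoords (e : Fin n → (x : M) → TangentSpace (𝓡 n) x) (x : M) (v : TangentSpace (𝓡 n) x) :
    EuclideanSpace ℝ (Fin n) :=
  ∑ k, (inner ℝ (e k x) v : ℝ) • EuclideanSpace.single k 1

/-- Clifford multiplication `c(X) ⊗ id_V`, in the gauge with frame `e`. -/
def cliffMul (ρ : Cl n →ₐ[ℝ] Matrix (Fin N) (Fin N) 𝕜)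
    (e : Fin n → (x : M) → TangentSpace (𝓡 n) x) (X : (x : M) → TangentSpace (𝓡 n) x)
    (ψ : (x : M) → Fin N → V x) (x : M) : Fin N → V x :=
  matAct (ρ (clVec n (frameCoords e x (X x)))) (ψ x)

/-- `id_{S(TM)} ⊗ T` for a field `T` of endomorphisms of `V`. -/
def endAct (T : (x : M) → V x →ₗ[𝕜] V x) (ψ : (x : M) → Fin N → V x) (x : M) : Fin N → V x :=
  fun A ↦ T x (ψ x A)

/-- The zeroth order part `¼ ∑ j k, ⟨∇^L_X e_j, e_k⟩ c(e_j) c(e_k)` of the spin connection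
`∇^{S(TM)}_X` in the gauge with frame `e`. -/
def spinConnTerm (ρ : Cl n →ₐ[ℝ] Matrix (Fin N) (Fin N) 𝕜)
    (L : CovariantDerivative (𝓡 n) (EuclideanSpace ℝ (Fin n)) (fun x : M ↦ TangentSpace (𝓡 n) x))
    (e : Fin n → (x : M) → TangentSpace (𝓡 n) x) (X : (x : M) → TangentSpace (𝓡 n) x)
    (ψ : (x : M) → Fin N → V x) (x : M) : Fin N → V x :=
  (1 / 4 : ℝ) • ∑ j, ∑ k,
    (inner ℝ (L (e j) x (X x)) (e k x) : ℝ) • cliffMul ρ e (e j) (cliffMul ρ e (e k) ψ) x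

/-- The connection `∇^{S(TM)} ⊗ id_V + id_{S(TM)} ⊗ D` on `S(TM) ⊗ V`, in the gauge with
frame `e`. -/
def tensorConn (ρ : Cl n →ₐ[ℝ] Matrix (Fin N) (Fin N) 𝕜)
    (L : CovariantDerivative (𝓡 n) (EuclideanSpace ℝ (Fin n)) (fun x : M ↦ TangentSpace (𝓡 n) x))
    (D : LinConnection n 𝕜 Fm V)
    (e : Fin n → (x : M) → TangentSpace (𝓡 n) x) (X : (x : M) → TangentSpace (𝓡 n) x)
    (ψ : (x : M) → Fin N → V x) (x : M) : Fin N → V x :=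
  spinConnTerm ρ L e X ψ x + fun A ↦ D.toFun (fun y ↦ ψ y A) x (X x)

/-- The Dirac operator `∑ i, c(ε_i) ∇_{ε_i}` of the connection
`∇ = ∇^{S(TM)} ⊗ id_V + id_{S(TM)} ⊗ D`, computed with the local orthonormal frame `ε`. -/
def diracOp (ρ : Cl n →ₐ[ℝ] Matrix (Fin N) (Fin N) 𝕜)
    (L : CovariantDerivative (𝓡 n) (EuclideanSpace ℝ (Fin n)) (fun x : M ↦ TangentSpace (𝓡 n) x))
    (D : LinConnection n 𝕜 Fm V)
    (e ε : Fin n → (x : M) → TangentSpace (𝓡 n) x)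
    (ψ : (x : M) → Fin N → V x) (x : M) : Fin N → V x :=
  ∑ i, cliffMul ρ e (ε i) (tensorConn ρ L D e (ε i) ψ) x

/-- `c(Φ) = ∑ i, c(ε_i) ⊗ Φ(ε_i)` for an `End(V)`-valued one-form `Φ`. -/
def cliffForm (ρ : Cl n →ₐ[ℝ] Matrix (Fin N) (Fin N) 𝕜)
    (e ε : Fin n → (x : M) → TangentSpace (𝓡 n) x)
    (Φ : (x : M) → TangentSpace (𝓡 n) x → V x →ₗ[𝕜] V x)
    (ψ : (x : M) → Fin N → V x) (x : M) : Fin N → V x :=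
  ∑ i, cliffMul ρ e (ε i) (endAct (fun y ↦ Φ y (ε i y)) ψ) x

/-- `c(Φ)` for the non-metric part `Φ = (D - D') / 2` of the connection `D` with dual `D'`. -/
def cPhi (ρ : Cl n →ₐ[ℝ] Matrix (Fin N) (Fin N) 𝕜) (D D' : LinConnection n 𝕜 Fm V)
    (e ε : Fin n → (x : M) → TangentSpace (𝓡 n) x)
    (ψ : (x : M) → Fin N → V x) (x : M) : Fin N → V x :=
  cliffForm ρ e ε (halfDifference D D') ψ x

/-- `c(Φ*) = ∑ i, c(ε_i) ⊗ Φ(ε_i)*` for the non-metric part `Φ = (D - D') / 2`. -/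
def cPhiStar (ρ : Cl n →ₐ[ℝ] Matrix (Fin N) (Fin N) 𝕜) (D D' : LinConnection n 𝕜 Fm V)
    (e ε : Fin n → (x : M) → TangentSpace (𝓡 n) x)
    (ψ : (x : M) → Fin N → V x) (x : M) : Fin N → V x :=
  cliffForm ρ e ε (fun y v ↦ fibreAdjoint 𝕜 Fm (halfDifference D D' y v)) ψ x

/-- The operator `D_F - c(Φ*)`, where `D_F` is the Dirac operator of the metric
connection `(D + D') / 2`. -/
def diracAdjOp (ρ : Cl n →ₐ[ℝ] Matrix (Fin N) (Fin N) 𝕜)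
    (L : CovariantDerivative (𝓡 n) (EuclideanSpace ℝ (Fin n)) (fun x : M ↦ TangentSpace (𝓡 n) x))
    (D D' : LinConnection n 𝕜 Fm V)
    (e ε : Fin n → (x : M) → TangentSpace (𝓡 n) x)
    (ψ : (x : M) → Fin N → V x) (x : M) : Fin N → V x :=
  diracOp ρ L (midConnection D D') e ε ψ x - cPhiStar ρ D D' e ε ψ x

/-- `c(Φ*) c(X) - c(X) c(Φ)`. -/
def twistTerm (ρ : Cl n →ₐ[ℝ] Matrix (Fin N) (Fin N) 𝕜) (D D' : LinConnection n 𝕜 Fm V)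
    (e ε : Fin n → (x : M) → TangentSpace (𝓡 n) x) (X : (x : M) → TangentSpace (𝓡 n) x)
    (ψ : (x : M) → Fin N → V x) (x : M) : Fin N → V x :=
  cPhiStar ρ D D' e ε (cliffMul ρ e X ψ) x - cliffMul ρ e X (cPhi ρ D D' e ε ψ) x

/-- The modified connection `∇_X + ½ [c(Φ*) c(X) - c(X) c(Φ)]`, where `∇` is the connection on
`S(TM) ⊗ V` induced by the metric connection `(D + D') / 2`. -/
def barConn (ρ : Cl n →ₐ[ℝ] Matrix (Fin N) (Fin N) 𝕜)
    (L : CovariantDerivative (𝓡 n) (EuclideanSpace ℝ (Fin n)) (fun x : M ↦ TangentSpace (𝓡 n) x))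
    (D D' : LinConnection n 𝕜 Fm V)
    (e ε : Fin n → (x : M) → TangentSpace (𝓡 n) x) (X : (x : M) → TangentSpace (𝓡 n) x)
    (ψ : (x : M) → Fin N → V x) (x : M) : Fin N → V x :=
  tensorConn ρ L (midConnection D D') e X ψ x + (1 / 2 : ℝ) • twistTerm ρ D D' e ε X ψ x

/-- The operator `g^{ij} (∇̄_{b_i} ∇̄_{b_j} - ∇̄_{∇^L_{b_i} b_j})` in a local frame `b` of `TM`, with
`(g^{ij})` the inverse of the matrix `g_{ij} = ⟨b_i, b_j⟩`. -/
def barLaplacian (ρ : Cl n →ₐ[ℝ] Matrix (Fin N) (Fin N) 𝕜)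
    (L : CovariantDerivative (𝓡 n) (EuclideanSpace ℝ (Fin n)) (fun x : M ↦ TangentSpace (𝓡 n) x))
    (D D' : LinConnection n 𝕜 Fm V)
    (e ε b : Fin n → (x : M) → TangentSpace (𝓡 n) x)
    (ψ : (x : M) → Fin N → V x) (x : M) : Fin N → V x :=
  ∑ i, ∑ j, (Matrix.of fun k l ↦ (inner ℝ (b k x) (b l x) : ℝ))⁻¹ i j •
    (barConn ρ L D D' e ε (b i) (barConn ρ L D D' e ε (b j) ψ) x
      - barConn ρ L D D' e ε (fun y ↦ L (b j) y (b i y)) ψ x)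

/-- The covariant derivative `(∇_X T) ψ = ∇_X (T ψ) - T (∇_X ψ)` of an endomorphism `T` of
`S(TM) ⊗ V`, where `∇` is the connection on `S(TM) ⊗ V` induced by `D`. -/
def covDerivEnd (ρ : Cl n →ₐ[ℝ] Matrix (Fin N) (Fin N) 𝕜)
    (L : CovariantDerivative (𝓡 n) (EuclideanSpace ℝ (Fin n)) (fun x : M ↦ TangentSpace (𝓡 n) x))
    (D : LinConnection n 𝕜 Fm V)
    (e : Fin n → (x : M) → TangentSpace (𝓡 n) x) (X : (x : M) → TangentSpace (𝓡 n) x)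
    (T : ((x : M) → Fin N → V x) → (x : M) → Fin N → V x)
    (ψ : (x : M) → Fin N → V x) (x : M) : Fin N → V x :=
  tensorConn ρ L D e X (T ψ) x - T (tensorConn ρ L D e X ψ) x

/-- `id_{S(TM)} ⊗ R(X, Y)`, with `R` the curvature of the connection `D` on `V`. -/
def curvatureAct (D : LinConnection n 𝕜 Fm V) (X Y : (x : M) → TangentSpace (𝓡 n) x)
    (ψ : (x : M) → Fin N → V x) (x : M) : Fin N → V x :=
  fun A ↦ curvatureOp D.toFun X Y (fun y ↦ ψ y A) x

end Spinors

/-! Write C for c(Φ), ∇ for the connection on S(TM) ⊗ F induced by ∇^F, and T(v) = C c(v) − c(v) C.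
Comparing the duality identity with its conjugate shows that each Φ(v) is self-adjoint
(`inner_halfDifference`), so c(Φ*) = C. The given connection is ∇^F + Φ, so the left side is (D_F −
C)(D_F + C) = D_F² + D_F C − C D_F − C².

The term D_F² is the classical Lichnerowicz computation. Clifford multiplication is parallel
(`tensorDeriv_cliffEnd`), so D_F² is the sum of c(e_i) c(e_k) ∇²_{ik}, with ∇² the second covariant
derivative. No frame parallel at a point is needed: the terms containing ∇e_k cancel by antisymmetry
of the connection coefficients (`dirac_dirac`). The Clifford relation splits the double sum into
minus the trace of ∇² and half a Clifford contraction of the curvature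
(`IsCliffordFamily.sum_mul_apply`). This curvature is the spin curvature plus R^F
(`tensorDeriv_curvature`), and the spin part contracts to s/4 by the Bianchi identity
(`IsCliffordFamily.curvature_contraction`).

The remaining first order terms are the sums of c(e_i) ∇_i(Cψ) and of −C c(e_i) ∇_i ψ. They are
absorbed by completing the square with ∇ + T/2, one frame vector at a time
(`neg_barHess_self_add_covDeriv`). The covariant derivative of C is never evaluated: the unexpanded
derivatives of Cψ and C c(X)ψ match on both sides. Finally the trace of the second derivative of the
modified connection does not depend on the frame, which allows an arbitrary frame b
(`barLaplacian_eq_sum_barHess`).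

Two orthonormal frames are in play. In the gauge frame `e` the Clifford generators are constant
matrices, so parallelism and curvature are computed there; the Dirac operators are written in `ε`,
and the passage between them rests on tensoriality. -/

set_option linter.unusedSectionVars false

/-! ### Locality, Leibniz rule and smoothness for connections. -/

section Connections

variable {n : ℕ} {M : Type*} [TopologicalSpace M] [ChartedSpace (EuclideanSpace ℝ (Fin n)) M]
  [IsManifold (𝓡 n) ∞ M]
  {F : Type*} [NormedAddCommGroup F] [NormedSpace ℝ F]
  {V : M → Type*} [TopologicalSpace (TotalSpace F V)]
  [∀ x, AddCommGroup (V x)] [∀ x, Module ℝ (V x)] [∀ x : M, TopologicalSpace (V x)]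
  [∀ x, IsTopologicalAddGroup (V x)] [∀ x, ContinuousSMul ℝ (V x)]
  [FiberBundle F V] [VectorBundle ℝ F V]

theorem ContMDiffOn.mdifferentiableAt_section {U : Set M} (hU : IsOpen U) {σ : (x : M) → V x}
    (hσ : ContMDiffOn (𝓡 n) ((𝓡 n).prod 𝓘(ℝ, F)) ∞ (T% σ) U) {x : M} (hx : x ∈ U) :
    MDifferentiableAt (𝓡 n) ((𝓡 n).prod 𝓘(ℝ, F)) (T% σ) x :=
  ((hσ x hx).contMDiffAt (hU.mem_nhds hx)).mdifferentiableAt (by simp)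

theorem CovariantDerivative.congr_of_isOpen (D : CovariantDerivative (𝓡 n) F V) {U : Set M}
    (hU : IsOpen U) {σ τ : (x : M) → V x}
    (hσ : ContMDiffOn (𝓡 n) ((𝓡 n).prod 𝓘(ℝ, F)) ∞ (T% σ) U) (h : ∀ y ∈ U, σ y = τ y)
    {x : M} (hx : x ∈ U) : D σ x = D τ x := by
  have hσx := hσ.mdifferentiableAt_section hU hx
  have hev : ∀ᶠ y in 𝓝 x, σ y = τ y := Filter.eventually_of_mem (hU.mem_nhds hx) h
  refine D.isCovariantDerivativeOnUniv.congr_of_eventuallyEq hσx ?_ Filter.univ_mem hev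
  refine hσx.congr_of_eventuallyEq ?_
  filter_upwards [hev] with y hy
  simp [hy]

theorem CovariantDerivative.sum_smul_apply (D : CovariantDerivative (𝓡 n) F V) {ι : Type*}
    (s : Finset ι) {f : ι → M → ℝ} {σ : ι → (x : M) → V x} {x : M}
    (hf : ∀ i, MDifferentiableAt (𝓡 n) 𝓘(ℝ, ℝ) (f i) x)
    (hσ : ∀ i, MDifferentiableAt (𝓡 n) ((𝓡 n).prod 𝓘(ℝ, F)) (T% (σ i)) x)
    (v : TangentSpace (𝓡 n) x) :
    D (fun y ↦ ∑ i ∈ s, f i y • σ i y) x v =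
      ∑ i ∈ s, (mvfderiv (𝓡 n) (f i) x v • σ i x + f i x • D (σ i) x v) := by
  classical
  have hfσ : ∀ i, MDifferentiableAt (𝓡 n) ((𝓡 n).prod 𝓘(ℝ, F)) (T% (f i • σ i)) x :=
    fun i ↦ (hf i).smul_section (hσ i)
  induction s using Finset.induction_on with
  | empty =>
    have := D.isCovariantDerivativeOnUniv.zero (x := x)
    simp only [Finset.sum_empty]
    change D.toFun 0 x v = 0
    rw [this]; rfl
  | insert a s ha ih =>
    simp only [Finset.sum_insert ha]
    have hs : MDifferentiableAt (𝓡 n) ((𝓡 n).prod 𝓘(ℝ, F))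
        (T% (fun y ↦ ∑ i ∈ s, f i y • σ i y)) x :=
      MDifferentiableAt.sum_section fun i _ ↦ hfσ i
    have h := D.isCovariantDerivativeOnUniv.add (hfσ a) hs
    have h' := D.isCovariantDerivativeOnUniv.leibniz (hσ a) (hf a)
    rw [← ih]
    change D.toFun (f a • σ a + fun y ↦ ∑ i ∈ s, f i y • σ i y) x v = _
    rw [h, h', add_comm (mvfderiv (𝓡 n) (f a) x v • σ a x)]
    rfl

theorem CovariantDerivative.sub_apply (D : CovariantDerivative (𝓡 n) F V)
    {σ τ : (x : M) → V x} {x : M}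
    (hσ : MDifferentiableAt (𝓡 n) ((𝓡 n).prod 𝓘(ℝ, F)) (T% σ) x)
    (hτ : MDifferentiableAt (𝓡 n) ((𝓡 n).prod 𝓘(ℝ, F)) (T% τ) x) :
    D (σ - τ) x = D σ x - D τ x := by
  -- Additivity is applied to `(σ - τ) + τ`.
  have h := D.isCovariantDerivativeOnUniv.add (mdifferentiableAt_sub_section hσ hτ) hτ
  rw [sub_add_cancel] at h
  exact eq_sub_of_add_eq h.symm

/-- Smoothness of the connection is a statement about global sections. A bump function supported in
`U` makes `σ` global without changing it near the given point, and locality of the connection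
transfers the conclusion back. -/
theorem CovariantDerivative.contMDiffOn_apply [T2Space M] (D : CovariantDerivative (𝓡 n) F V)
    (hD : D.ContMDiffCovariantDerivative ∞) {U : Set M} (hU : IsOpen U)
    {σ : (x : M) → V x} {X : (x : M) → TangentSpace (𝓡 n) x}
    (hσ : ContMDiffOn (𝓡 n) ((𝓡 n).prod 𝓘(ℝ, F)) ∞ (T% σ) U)
    (hX : ContMDiffOn (𝓡 n) ((𝓡 n).prod 𝓘(ℝ, EuclideanSpace ℝ (Fin n))) ∞ (T% X) U) :
    ContMDiffOn (𝓡 n) ((𝓡 n).prod 𝓘(ℝ, F)) ∞ (T% (fun y ↦ D σ y (X y))) U := by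
  intro x hx
  obtain ⟨f, hfU⟩ := (SmoothBumpFunction.nhds_basis_tsupport (I := 𝓡 n) x).mem_iff.1
    (hU.mem_nhds hx)
  have hτ : ContMDiff (𝓡 n) ((𝓡 n).prod 𝓘(ℝ, F)) ∞ (T% ((f : M → ℝ) • σ)) :=
    ContMDiffOn.smul_section_of_tsupport f.contMDiff.contMDiffOn hU hfU.2 hσ
  have hDτ := hD.contMDiff.contMDiff (σ := (f : M → ℝ) • σ)
    (by simpa using hτ.contMDiffOn)
  have h := ContMDiffAt.clm_bundle_apply (hDτ.contMDiffAt Filter.univ_mem)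
    ((hX x hx).contMDiffAt (hU.mem_nhds hx))
  refine (h.congr_of_eventuallyEq ?_).contMDiffWithinAt
  filter_upwards [f.eventuallyEq_one.eventually_nhds, hU.mem_nhds hx] with y hy hyU
  congr 2
  refine D.isCovariantDerivativeOnUniv.congr_of_eventuallyEq
    (hσ.mdifferentiableAt_section hU hyU) (hτ.mdifferentiable (by simp) y) Filter.univ_mem ?_
  filter_upwards [hy] with z hz
  simp [hz]

end Connections

/-! ### The Lie bracket as a commutator of derivations. -/

section VectorFields

variable {n : ℕ} {M : Type*} [TopologicalSpace M] [ChartedSpace (EuclideanSpace ℝ (Fin n)) M]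
  [IsManifold (𝓡 n) ∞ M]

theorem ContMDiffOn.mvfderiv_apply {E : Type*} [NormedAddCommGroup E] [NormedSpace ℝ E]
    {U : Set M} (hU : IsOpen U) {f : M → E}
    {X : (x : M) → TangentSpace (𝓡 n) x} (hf : ContMDiffOn (𝓡 n) 𝓘(ℝ, E) ∞ f U)
    (hX : ContMDiffOn (𝓡 n) ((𝓡 n).prod 𝓘(ℝ, EuclideanSpace ℝ (Fin n))) ∞ (T% X) U) :
    ContMDiffOn (𝓡 n) 𝓘(ℝ, E) ∞ (fun y ↦ mvfderiv (𝓡 n) f y (X y)) U := by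
  have h := hf.contMDiffOn_tangentMapWithin (m := ∞) (by simp) hU.uniqueMDiffOn
  have h2 := h.comp hX (fun y hy ↦ hy)
  have h3 := (contMDiff_snd_tangentBundle_modelSpace E 𝓘(ℝ, E) (n := ∞)).comp_contMDiffOn h2
  refine h3.congr fun y hy ↦ ?_
  change _ = mfderivWithin (𝓡 n) 𝓘(ℝ, E) f U y (X y)
  rw [mfderivWithin_of_isOpen hU hy]
  rfl

/-- The identity is read off from the Jacobi identity for X, Y, fZ, where Z is a field with Z(x) = v
≠ 0. Expanding by the Leibniz rule, the terms with one derivative of f and one bracket with Z are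
symmetric in X and Y and cancel, and f times the Jacobi identity for X, Y, Z removes the rest. What
remains is the desired scalar identity multiplied by v. -/
theorem mvfderiv_mlieBracket_apply [T2Space M] {U : Set M} (hU : IsOpen U) {f : M → ℝ}
    {X Y : (x : M) → TangentSpace (𝓡 n) x} (hf : ContMDiffOn (𝓡 n) 𝓘(ℝ, ℝ) ∞ f U)
    (hX : ContMDiffOn (𝓡 n) ((𝓡 n).prod 𝓘(ℝ, EuclideanSpace ℝ (Fin n))) ∞ (T% X) U)
    (hY : ContMDiffOn (𝓡 n) ((𝓡 n).prod 𝓘(ℝ, EuclideanSpace ℝ (Fin n))) ∞ (T% Y) U)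
    {x : M} (hx : x ∈ U) :
    mvfderiv (𝓡 n) f x (VectorField.mlieBracket (𝓡 n) X Y x) =
      mvfderiv (𝓡 n) (fun y ↦ mvfderiv (𝓡 n) f y (Y y)) x (X x)
        - mvfderiv (𝓡 n) (fun y ↦ mvfderiv (𝓡 n) f y (X y)) x (Y x) := by
  -- In dimension zero there is no nonzero vector to test against, but then every term vanishes.
  by_cases hv : ∃ v : TangentSpace (𝓡 n) x, v ≠ 0
  swap
  · push Not at hv
    simp [hv (X x), hv (Y x), hv (VectorField.mlieBracket (𝓡 n) X Y x)]
  obtain ⟨v, hv⟩ := hv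
  have hxU := hU.mem_nhds hx
  have : IsManifold (𝓡 n) (minSmoothness ℝ 3) M := by
    rw [minSmoothness_of_isRCLikeNormedField]
    exact IsManifold.of_le (n := ∞) ENat.LEInfty.out
  have hn : minSmoothness ℝ 2 ≤ ∞ := by
    rw [minSmoothness_of_isRCLikeNormedField]
    exact ENat.LEInfty.out
  set Z : (y : M) → TangentSpace (𝓡 n) y :=
    FiberBundle.extend (EuclideanSpace ℝ (Fin n)) v with hZdef
  have hZx : Z x = v := FiberBundle.extend_apply_self _ _
  have hZ : ContMDiffAt (𝓡 n) ((𝓡 n).prod 𝓘(ℝ, EuclideanSpace ℝ (Fin n))) ∞ (T% Z) x :=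
    FiberBundle.contMDiffAt_extend (𝓡 n) (EuclideanSpace ℝ (Fin n)) v
  have hfx : ContMDiffAt (𝓡 n) 𝓘(ℝ, ℝ) ∞ f x := (hf x hx).contMDiffAt hxU
  have hXx := (hX x hx).contMDiffAt hxU
  have hYx := (hY x hx).contMDiffAt hxU
  have hfZ : ContMDiffAt (𝓡 n) ((𝓡 n).prod 𝓘(ℝ, EuclideanSpace ℝ (Fin n))) ∞ (T% (f • Z)) x :=
    hfx.smul_section hZ
  have key : ∀ {A B : (x : M) → TangentSpace (𝓡 n) x},
      ContMDiffOn (𝓡 n) ((𝓡 n).prod 𝓘(ℝ, EuclideanSpace ℝ (Fin n))) ∞ (T% A) U →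
      ContMDiffOn (𝓡 n) ((𝓡 n).prod 𝓘(ℝ, EuclideanSpace ℝ (Fin n))) ∞ (T% B) U →
      VectorField.mlieBracket (𝓡 n) A (VectorField.mlieBracket (𝓡 n) B (f • Z)) x =
        mvfderiv (𝓡 n) (fun y ↦ mvfderiv (𝓡 n) f y (B y)) x (A x) • v
        + mvfderiv (𝓡 n) f x (B x) • VectorField.mlieBracket (𝓡 n) A Z x
        + mvfderiv (𝓡 n) f x (A x) • VectorField.mlieBracket (𝓡 n) B Z x
        + f x • VectorField.mlieBracket (𝓡 n) A (VectorField.mlieBracket (𝓡 n) B Z) x := by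
    intro A B hA hB
    obtain ⟨s, hs, hZs⟩ := FiberBundle.exists_contMDiffOn_extend (k := ∞) (𝓡 n)
      (EuclideanSpace ℝ (Fin n)) v
    have hAx := (hA x hx).contMDiffAt hxU
    have hBx := (hB x hx).contMDiffAt hxU
    have hBf := ContMDiffOn.mvfderiv_apply hU hf hB
    have hBfx := (hBf x hx).contMDiffAt hxU
    have h1 : ∀ᶠ y in 𝓝 x, VectorField.mlieBracket (𝓡 n) B (f • Z) y =
        ((fun y ↦ mvfderiv (𝓡 n) f y (B y)) • Z + f • VectorField.mlieBracket (𝓡 n) B Z) y := by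
      filter_upwards [hxU, eventually_mem_nhds_iff.2 hs] with y hy hys
      exact VectorField.mlieBracket_smul_right
        (((hf y hy).contMDiffAt (hU.mem_nhds hy)).mdifferentiableAt (by simp))
        (((hZs y (mem_of_mem_nhds hys)).contMDiffAt hys).mdifferentiableAt (by simp))
    have hBZ : ContMDiffAt (𝓡 n) ((𝓡 n).prod 𝓘(ℝ, EuclideanSpace ℝ (Fin n))) ∞
        (T% (VectorField.mlieBracket (𝓡 n) B Z)) x := by
      have : IsManifold (𝓡 n) (((⊤ : ℕ∞) : WithTop ℕ∞) + 1) M := by simpa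
      exact ContMDiffAt.mlieBracket_vectorField (m := ⊤) (n := ⊤) hBx hZ
        (by rw [minSmoothness_of_isRCLikeNormedField]; simp)
    rw [Filter.EventuallyEq.mlieBracket_vectorField_eq (Filter.EventuallyEq.refl _ A) h1,
      VectorField.mlieBracket_add_right, VectorField.mlieBracket_smul_right,
      VectorField.mlieBracket_smul_right, hZx]
    · abel
    · exact hfx.mdifferentiableAt (by simp)
    · exact hBZ.mdifferentiableAt (by simp)
    · exact hBfx.mdifferentiableAt (by simp)
    · exact hZ.mdifferentiableAt (by simp)
    · exact (hBfx.smul_section hZ).mdifferentiableAt (by simp)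
    · exact (hfx.smul_section hBZ).mdifferentiableAt (by simp)
  have hJ := VectorField.leibniz_identity_mlieBracket_apply (I := 𝓡 n) (x := x)
    (U := X) (V := Y) (W := f • Z) (hXx.of_le hn) (hYx.of_le hn)
    (hfZ.of_le hn)
  have hJ' := VectorField.leibniz_identity_mlieBracket_apply (I := 𝓡 n) (x := x)
    (U := X) (V := Y) (W := Z) (hXx.of_le hn) (hYx.of_le hn)
    (hZ.of_le hn)
  rw [key hX hY, key hY hX, hJ', VectorField.mlieBracket_smul_right
    (hfx.mdifferentiableAt (by simp)) (hZ.mdifferentiableAt (by simp)), hZx] at hJ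
  rw [← sub_eq_zero]
  refine (smul_eq_zero.1 (?_ : _ • v = 0)).resolve_right hv
  simp only [sub_smul]
  simp only [smul_add] at hJ
  rw [← sub_eq_zero] at hJ
  rw [← neg_eq_zero, ← hJ]
  module

end VectorFields

/-! ### Tensoriality of the curvature. -/

section CurvatureTensor

variable {n : ℕ} {M : Type*} [TopologicalSpace M] [ChartedSpace (EuclideanSpace ℝ (Fin n)) M]
  [IsManifold (𝓡 n) ∞ M] [T2Space M]
  {F : Type*} [NormedAddCommGroup F] [NormedSpace ℝ F]
  {V : M → Type*} [TopologicalSpace (TotalSpace F V)]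
  [∀ x, AddCommGroup (V x)] [∀ x, Module ℝ (V x)] [∀ x : M, TopologicalSpace (V x)]
  [∀ x, IsTopologicalAddGroup (V x)] [∀ x, ContinuousSMul ℝ (V x)]
  [FiberBundle F V] [VectorBundle ℝ F V]
  {U : Set M} {X Y : (x : M) → TangentSpace (𝓡 n) x}

theorem mvfderiv_congr_of_isOpen {E : Type*} [NormedAddCommGroup E] [NormedSpace ℝ E]
    (hU : IsOpen U) {f g : M → E} (h : ∀ y ∈ U, f y = g y) {x : M} (hx : x ∈ U) :
    mvfderiv (𝓡 n) f x = mvfderiv (𝓡 n) g x := by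
  have hev : f =ᶠ[𝓝 x] g := Filter.eventually_of_mem (hU.mem_nhds hx) h
  ext v
  simp only [mvfderiv]
  rw [hev.mfderiv_eq]
  rfl

theorem curvatureOp_swap (D : ((x : M) → V x) → (x : M) → TangentSpace (𝓡 n) x →L[ℝ] V x)
    (X Y : (x : M) → TangentSpace (𝓡 n) x) (σ : (x : M) → V x) (x : M) :
    curvatureOp D X Y σ x = -curvatureOp D Y X σ x := by
  simp only [curvatureOp]
  rw [VectorField.mlieBracket_swap_apply, map_neg]
  abel

/-- In the second derivative of fσ the mixed terms are symmetric in X and Y, and XYf − YXf is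
cancelled by [X, Y]f. Finite sums are treated at once because both Clifford multiplication and frame
expansions have this shape. -/
theorem curvatureOp_sum_smul (D : CovariantDerivative (𝓡 n) F V)
    (hD : D.ContMDiffCovariantDerivative ∞) (hU : IsOpen U)
    (hX : ContMDiffOn (𝓡 n) ((𝓡 n).prod 𝓘(ℝ, EuclideanSpace ℝ (Fin n))) ∞ (T% X) U)
    (hY : ContMDiffOn (𝓡 n) ((𝓡 n).prod 𝓘(ℝ, EuclideanSpace ℝ (Fin n))) ∞ (T% Y) U)
    {ι : Type*} (s : Finset ι) {f : ι → M → ℝ} {σ : ι → (x : M) → V x}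
    (hf : ∀ i, ContMDiffOn (𝓡 n) 𝓘(ℝ, ℝ) ∞ (f i) U)
    (hσ : ∀ i, ContMDiffOn (𝓡 n) ((𝓡 n).prod 𝓘(ℝ, F)) ∞ (T% (σ i)) U) {x : M} (hx : x ∈ U) :
    curvatureOp D X Y (fun y ↦ ∑ i ∈ s, f i y • σ i y) x =
      ∑ i ∈ s, f i x • curvatureOp D X Y (σ i) x := by
  have hfd : ∀ i, ∀ y ∈ U, MDifferentiableAt (𝓡 n) 𝓘(ℝ, ℝ) (f i) y := fun i y hy ↦
    ((hf i y hy).contMDiffAt (hU.mem_nhds hy)).mdifferentiableAt (by simp)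
  have hσd : ∀ i, ∀ y ∈ U, MDifferentiableAt (𝓡 n) ((𝓡 n).prod 𝓘(ℝ, F)) (T% (σ i)) y :=
    fun i y hy ↦ (hσ i).mdifferentiableAt_section hU hy
  have key : ∀ {A B : (x : M) → TangentSpace (𝓡 n) x},
      ContMDiffOn (𝓡 n) ((𝓡 n).prod 𝓘(ℝ, EuclideanSpace ℝ (Fin n))) ∞ (T% A) U →
      ContMDiffOn (𝓡 n) ((𝓡 n).prod 𝓘(ℝ, EuclideanSpace ℝ (Fin n))) ∞ (T% B) U →
      D (fun y ↦ D (fun z ↦ ∑ i ∈ s, f i z • σ i z) y (B y)) x (A x) =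
        ∑ i ∈ s, (mvfderiv (𝓡 n) (fun y ↦ mvfderiv (𝓡 n) (f i) y (B y)) x (A x) • σ i x
          + mvfderiv (𝓡 n) (f i) x (B x) • D (σ i) x (A x)
          + mvfderiv (𝓡 n) (f i) x (A x) • D (σ i) x (B x)
          + f i x • D (fun y ↦ D (σ i) y (B y)) x (A x)) := by
    intro A B hA hB
    have hBf := fun i ↦ ContMDiffOn.mvfderiv_apply hU (hf i) hB
    have hBfd : ∀ i, MDifferentiableAt (𝓡 n) 𝓘(ℝ, ℝ) (fun y ↦ mvfderiv (𝓡 n) (f i) y (B y)) x :=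
      fun i ↦ ((hBf i x hx).contMDiffAt (hU.mem_nhds hx)).mdifferentiableAt (by simp)
    have hBσ := fun i ↦ D.contMDiffOn_apply hD hU (hσ i) hB
    have hBσd := fun i ↦ (hBσ i).mdifferentiableAt_section hU hx
    have h1 : ∀ y ∈ U, D (fun z ↦ ∑ i ∈ s, f i z • σ i z) y (B y) =
        ((fun y ↦ ∑ i ∈ s, mvfderiv (𝓡 n) (f i) y (B y) • σ i y)
          + fun y ↦ ∑ i ∈ s, f i y • D (σ i) y (B y)) y := by
      intro y hy
      rw [D.sum_smul_apply s (fun i ↦ hfd i y hy) (fun i ↦ hσd i y hy), Finset.sum_add_distrib]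
      rfl
    have hL : ContMDiffOn (𝓡 n) ((𝓡 n).prod 𝓘(ℝ, F)) ∞
        (T% (fun y ↦ ∑ i ∈ s, mvfderiv (𝓡 n) (f i) y (B y) • σ i y)) U :=
      ContMDiffOn.sum_section fun i _ ↦ (hBf i).smul_section (hσ i)
    have hR : ContMDiffOn (𝓡 n) ((𝓡 n).prod 𝓘(ℝ, F)) ∞
        (T% (fun y ↦ ∑ i ∈ s, f i y • D (σ i) y (B y))) U :=
      ContMDiffOn.sum_section fun i _ ↦ (hf i).smul_section (hBσ i)
    have hS := hL.add_section hR
    rw [← D.congr_of_isOpen hU hS (fun y hy ↦ (h1 y hy).symm) hx,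
      D.isCovariantDerivativeOnUniv.add (hL.mdifferentiableAt_section hU hx)
        (hR.mdifferentiableAt_section hU hx), add_apply,
      D.sum_smul_apply s hBfd (fun i ↦ hσd i x hx),
      D.sum_smul_apply s (fun i ↦ hfd i x hx) hBσd, ← Finset.sum_add_distrib]
    exact Finset.sum_congr rfl fun i _ ↦ by abel
  simp only [curvatureOp]
  rw [key hX hY, key hY hX, D.sum_smul_apply s (fun i ↦ hfd i x hx) (fun i ↦ hσd i x hx),
    ← Finset.sum_sub_distrib, ← Finset.sum_sub_distrib]
  refine Finset.sum_congr rfl fun i _ ↦ ?_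
  rw [mvfderiv_mlieBracket_apply hU (hf i) hX hY hx]
  module

end CurvatureTensor

/-! ### Symmetries of the Riemann tensor. -/

section LeviCivita

variable {n : ℕ} {M : Type*} [TopologicalSpace M] [ChartedSpace (EuclideanSpace ℝ (Fin n)) M]
  [IsManifold (𝓡 n) ∞ M] [T2Space M]
  [RiemannianBundle (fun x : M ↦ TangentSpace (𝓡 n) x)]
  [IsContMDiffRiemannianBundle (𝓡 n) ∞ (EuclideanSpace ℝ (Fin n))
    (fun x : M ↦ TangentSpace (𝓡 n) x)]
  {L : CovariantDerivative (𝓡 n) (EuclideanSpace ℝ (Fin n)) (fun x : M ↦ TangentSpace (𝓡 n) x)}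
  {U : Set M} {X Y Z W : (x : M) → TangentSpace (𝓡 n) x}

theorem contMDiffOn_inner
    (hX : ContMDiffOn (𝓡 n) ((𝓡 n).prod 𝓘(ℝ, EuclideanSpace ℝ (Fin n))) ∞ (T% X) U)
    (hY : ContMDiffOn (𝓡 n) ((𝓡 n).prod 𝓘(ℝ, EuclideanSpace ℝ (Fin n))) ∞ (T% Y) U) :
    ContMDiffOn (𝓡 n) 𝓘(ℝ, ℝ) ∞ (fun y ↦ (inner ℝ (X y) (Y y) : ℝ)) U :=
  hX.inner_bundle hY

set_option synthInstance.maxHeartbeats 400000 in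
theorem mdifferentiableAt_inner (hU : IsOpen U)
    (hX : ContMDiffOn (𝓡 n) ((𝓡 n).prod 𝓘(ℝ, EuclideanSpace ℝ (Fin n))) ∞ (T% X) U)
    (hY : ContMDiffOn (𝓡 n) ((𝓡 n).prod 𝓘(ℝ, EuclideanSpace ℝ (Fin n))) ∞ (T% Y) U)
    {x : M} (hx : x ∈ U) :
    MDifferentiableAt (𝓡 n) 𝓘(ℝ, ℝ) (fun y ↦ (inner ℝ (X y) (Y y) : ℝ)) x :=
  ((contMDiffOn_inner hX hY x hx).contMDiffAt (hU.mem_nhds hx)).mdifferentiableAt (by simp)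

set_option synthInstance.maxHeartbeats 400000 in
theorem IsLeviCivita.mvfderiv_inner (hL : IsLeviCivita L) (hU : IsOpen U)
    (hX : ContMDiffOn (𝓡 n) ((𝓡 n).prod 𝓘(ℝ, EuclideanSpace ℝ (Fin n))) ∞ (T% X) U)
    (hY : ContMDiffOn (𝓡 n) ((𝓡 n).prod 𝓘(ℝ, EuclideanSpace ℝ (Fin n))) ∞ (T% Y) U)
    (A : (x : M) → TangentSpace (𝓡 n) x) {x : M} (hx : x ∈ U) :
    mvfderiv (𝓡 n) (fun y ↦ (inner ℝ (X y) (Y y) : ℝ)) x (A x) =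
      inner ℝ (L X x (A x)) (Y x) + inner ℝ (X x) (L Y x (A x)) :=
  hL.metric.mvfderiv_inner_eq A (hX.mdifferentiableAt_section hU hx)
    (hY.mdifferentiableAt_section hU hx)

theorem IsLeviCivita.mlieBracket_eq (hL : IsLeviCivita L) (hU : IsOpen U)
    (hX : ContMDiffOn (𝓡 n) ((𝓡 n).prod 𝓘(ℝ, EuclideanSpace ℝ (Fin n))) ∞ (T% X) U)
    (hY : ContMDiffOn (𝓡 n) ((𝓡 n).prod 𝓘(ℝ, EuclideanSpace ℝ (Fin n))) ∞ (T% Y) U)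
    {x : M} (hx : x ∈ U) :
    VectorField.mlieBracket (𝓡 n) X Y x = L Y x (X x) - L X x (Y x) :=
  (L.torsion_eq_zero_iff.1 hL.torsionFree (hX.mdifferentiableAt_section hU hx)
    (hY.mdifferentiableAt_section hU hx)).symm

theorem IsLeviCivita.contMDiffOn_apply (hL : IsLeviCivita L) (hU : IsOpen U)
    (hX : ContMDiffOn (𝓡 n) ((𝓡 n).prod 𝓘(ℝ, EuclideanSpace ℝ (Fin n))) ∞ (T% X) U)
    (hY : ContMDiffOn (𝓡 n) ((𝓡 n).prod 𝓘(ℝ, EuclideanSpace ℝ (Fin n))) ∞ (T% Y) U) :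
    ContMDiffOn (𝓡 n) ((𝓡 n).prod 𝓘(ℝ, EuclideanSpace ℝ (Fin n))) ∞
      (T% (fun y ↦ L Y y (X y))) U :=
  L.contMDiffOn_apply hL.smooth hU hY hX

/-- The second derivative of an inner product. -/
theorem IsLeviCivita.mvfderiv_mvfderiv_inner (hL : IsLeviCivita L) (hU : IsOpen U)
    (hY : ContMDiffOn (𝓡 n) ((𝓡 n).prod 𝓘(ℝ, EuclideanSpace ℝ (Fin n))) ∞ (T% Y) U)
    (hZ : ContMDiffOn (𝓡 n) ((𝓡 n).prod 𝓘(ℝ, EuclideanSpace ℝ (Fin n))) ∞ (T% Z) U)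
    (hW : ContMDiffOn (𝓡 n) ((𝓡 n).prod 𝓘(ℝ, EuclideanSpace ℝ (Fin n))) ∞ (T% W) U)
    {x : M} (hx : x ∈ U) :
    mvfderiv (𝓡 n) (fun y ↦ mvfderiv (𝓡 n) (fun z ↦ (inner ℝ (Z z) (W z) : ℝ)) y (Y y)) x (X x) =
      inner ℝ (L (fun y ↦ L Z y (Y y)) x (X x)) (W x) + inner ℝ (L Z x (Y x)) (L W x (X x))
      + (inner ℝ (L Z x (X x)) (L W x (Y x)) + inner ℝ (Z x) (L (fun y ↦ L W y (Y y)) x (X x))) := by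
  have hYZ := hL.contMDiffOn_apply hU hY hZ
  have hYW := hL.contMDiffOn_apply hU hY hW
  rw [mvfderiv_congr_of_isOpen hU (fun y hy ↦ hL.mvfderiv_inner hU hZ hW Y hy) hx]
  have h := mvfderiv_add (I := 𝓡 n) (mdifferentiableAt_inner hU hYZ hW hx)
    (mdifferentiableAt_inner hU hZ hYW hx)
  have h' := congrArg (fun T ↦ T (X x)) h
  rw [add_apply, hL.mvfderiv_inner hU hYZ hW X hx,
    hL.mvfderiv_inner hU hZ hYW X hx] at h'
  exact h'

/-- Metric compatibility: XY − YX − [X, Y] annihilates the function ⟨Z, W⟩, and after expansion the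
products of two first derivatives cancel. -/
theorem IsLeviCivita.inner_curvatureOp (hL : IsLeviCivita L) (hU : IsOpen U)
    (hX : ContMDiffOn (𝓡 n) ((𝓡 n).prod 𝓘(ℝ, EuclideanSpace ℝ (Fin n))) ∞ (T% X) U)
    (hY : ContMDiffOn (𝓡 n) ((𝓡 n).prod 𝓘(ℝ, EuclideanSpace ℝ (Fin n))) ∞ (T% Y) U)
    (hZ : ContMDiffOn (𝓡 n) ((𝓡 n).prod 𝓘(ℝ, EuclideanSpace ℝ (Fin n))) ∞ (T% Z) U)
    (hW : ContMDiffOn (𝓡 n) ((𝓡 n).prod 𝓘(ℝ, EuclideanSpace ℝ (Fin n))) ∞ (T% W) U)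
    {x : M} (hx : x ∈ U) :
    (inner ℝ (curvatureOp L X Y Z x) (W x) : ℝ) = -inner ℝ (curvatureOp L X Y W x) (Z x) := by
  have h1 := mvfderiv_mlieBracket_apply hU (contMDiffOn_inner hZ hW) hX hY hx
  rw [hL.mvfderiv_mvfderiv_inner hU hY hZ hW hx, hL.mvfderiv_mvfderiv_inner hU hX hZ hW hx,
    hL.mvfderiv_inner hU hZ hW _ hx] at h1
  simp only [curvatureOp, inner_sub_left, inner_sub_right, real_inner_comm (Z x)]
  linarith

/-- The first Bianchi identity is the Jacobi identity with every bracket rewritten through vanishing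
torsion. In `key` only the outer bracket and its differentiated argument are rewritten; the inner
bracket stays as a direction, in the form in which it occurs in the curvature. -/
theorem IsLeviCivita.curvatureOp_cyclic (hL : IsLeviCivita L) (hU : IsOpen U)
    (hX : ContMDiffOn (𝓡 n) ((𝓡 n).prod 𝓘(ℝ, EuclideanSpace ℝ (Fin n))) ∞ (T% X) U)
    (hY : ContMDiffOn (𝓡 n) ((𝓡 n).prod 𝓘(ℝ, EuclideanSpace ℝ (Fin n))) ∞ (T% Y) U)
    (hZ : ContMDiffOn (𝓡 n) ((𝓡 n).prod 𝓘(ℝ, EuclideanSpace ℝ (Fin n))) ∞ (T% Z) U)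
    {x : M} (hx : x ∈ U) :
    curvatureOp L X Y Z x + curvatureOp L Y Z X x + curvatureOp L Z X Y x = 0 := by
  have key : ∀ {A B C : (x : M) → TangentSpace (𝓡 n) x},
      ContMDiffOn (𝓡 n) ((𝓡 n).prod 𝓘(ℝ, EuclideanSpace ℝ (Fin n))) ∞ (T% A) U →
      ContMDiffOn (𝓡 n) ((𝓡 n).prod 𝓘(ℝ, EuclideanSpace ℝ (Fin n))) ∞ (T% B) U →
      ContMDiffOn (𝓡 n) ((𝓡 n).prod 𝓘(ℝ, EuclideanSpace ℝ (Fin n))) ∞ (T% C) U →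
      VectorField.mlieBracket (𝓡 n) A (VectorField.mlieBracket (𝓡 n) B C) x =
        L (fun y ↦ L C y (B y)) x (A x) - L (fun y ↦ L B y (C y)) x (A x)
          - L A x (VectorField.mlieBracket (𝓡 n) B C x) := by
    intro A B C hA hB hC
    have hBC := hL.contMDiffOn_apply hU hB hC
    have hCB := hL.contMDiffOn_apply hU hC hB
    have hbr : ∀ y ∈ U, ((fun y ↦ L C y (B y)) - fun y ↦ L B y (C y)) y =
        VectorField.mlieBracket (𝓡 n) B C y := fun y hy ↦ (hL.mlieBracket_eq hU hB hC hy).symm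
    have hsm := hBC.sub_section hCB
    have hbrs : ContMDiffOn (𝓡 n) ((𝓡 n).prod 𝓘(ℝ, EuclideanSpace ℝ (Fin n))) ∞
        (T% (VectorField.mlieBracket (𝓡 n) B C)) U :=
      hsm.congr fun y hy ↦ by rw [hbr y hy]
    rw [hL.mlieBracket_eq hU hA hbrs hx, ← L.congr_of_isOpen hU hsm hbr hx]
    rw [L.sub_apply (hBC.mdifferentiableAt_section hU hx) (hCB.mdifferentiableAt_section hU hx)]
    rfl
  have hn : minSmoothness ℝ 2 ≤ ∞ := by
    rw [minSmoothness_of_isRCLikeNormedField]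
    exact ENat.LEInfty.out
  have : IsManifold (𝓡 n) (minSmoothness ℝ 3) M := by
    rw [minSmoothness_of_isRCLikeNormedField]
    exact IsManifold.of_le (n := ∞) ENat.LEInfty.out
  have hat : ∀ {A : (x : M) → TangentSpace (𝓡 n) x},
      ContMDiffOn (𝓡 n) ((𝓡 n).prod 𝓘(ℝ, EuclideanSpace ℝ (Fin n))) ∞ (T% A) U →
      ContMDiffAt (𝓡 n) ((𝓡 n).prod 𝓘(ℝ, EuclideanSpace ℝ (Fin n))) (minSmoothness ℝ 2)
        (T% A) x := fun h ↦ ((h x hx).contMDiffAt (hU.mem_nhds hx)).of_le hn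
  have hJ := VectorField.leibniz_identity_mlieBracket_apply (I := 𝓡 n) (x := x)
    (U := X) (V := Y) (W := Z) (hat hX) (hat hY) (hat hZ)
  rw [VectorField.mlieBracket_swap_apply (V := VectorField.mlieBracket (𝓡 n) X Y),
    key hX hY hZ, key hZ hX hY, key hY hX hZ] at hJ
  simp only [curvatureOp]
  rw [VectorField.mlieBracket_swap_apply (V := Z) (W := X), map_neg]
  rw [← sub_eq_zero] at hJ
  rw [← hJ]
  abel

end LeviCivita

/-! ### Algebra of Clifford generators and the curvature contraction. -/

section CliffordRelations

variable {A ι : Type*} [Ring A] [Algebra ℝ A] [Fintype ι] [DecidableEq ι]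

/-- The family `γ` satisfies `γ i * γ j + γ j * γ i = -2 δ_ij`. -/
def IsCliffordFamily (γ : ι → A) : Prop :=
  ∀ i j, γ i * γ j + γ j * γ i = (if i = j then (-2 : ℝ) else 0) • (1 : A)

variable {γ : ι → A}

theorem IsCliffordFamily.mul_mul_sub (hγ : IsCliffordFamily γ) (j k l : ι) :
    γ j * γ k * γ l - γ l * (γ j * γ k) =
      (if j = l then (2 : ℝ) else 0) • γ k - (if k = l then (2 : ℝ) else 0) • γ j := by
  have h1 := hγ j l
  have h2 := hγ k l
  -- A commutator with a product of two odd elements is expressed by anticommutators, which are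
  -- scalars.
  have e : γ j * γ k * γ l - γ l * (γ j * γ k) =
      γ j * (γ k * γ l + γ l * γ k) - (γ j * γ l + γ l * γ j) * γ k := by noncomm_ring
  rw [e, h1, h2]
  split_ifs <;> simp
  abel

/-- The factor 1/4 normalises the isomorphism so(n) ≅ spin(n): when α holds the connection
coefficients, the commutator of the spin term with c(e_l) is c(∇e_l). -/
theorem IsCliffordFamily.spin_commutator (hγ : IsCliffordFamily γ) {α : ι → ι → ℝ}
    (hα : ∀ i j, α i j = -α j i) (l : ι) :
    ((1 / 4 : ℝ) • ∑ j, ∑ k, α j k • (γ j * γ k)) * γ l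
      - γ l * ((1 / 4 : ℝ) • ∑ j, ∑ k, α j k • (γ j * γ k)) = ∑ k, α l k • γ k := by
  have e : ((1 / 4 : ℝ) • ∑ j, ∑ k, α j k • (γ j * γ k)) * γ l
      - γ l * ((1 / 4 : ℝ) • ∑ j, ∑ k, α j k • (γ j * γ k)) =
      (1 / 4 : ℝ) • ∑ j, ∑ k, α j k • (γ j * γ k * γ l - γ l * (γ j * γ k)) := by
    simp only [smul_mul_assoc, mul_smul_comm, Finset.sum_mul, Finset.mul_sum, smul_sub,
      Finset.sum_sub_distrib]
  rw [e]
  have e1 : ∑ j, ∑ k, α j k • (if j = l then (2 : ℝ) else 0) • γ k = ∑ k, (2 * α l k) • γ k := by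
    rw [Finset.sum_comm]
    simp [smul_smul, mul_comm]
  have e2 : ∑ j, ∑ k, α j k • (if k = l then (2 : ℝ) else 0) • γ j = ∑ j, (2 * α j l) • γ j := by
    simp [smul_smul, mul_comm]
  simp only [hγ.mul_mul_sub, smul_sub, Finset.sum_sub_distrib]
  rw [e1, e2, ← smul_sub, ← Finset.sum_sub_distrib, Finset.smul_sum]
  refine Finset.sum_congr rfl fun k _ ↦ ?_
  rw [hα k l]
  module

theorem commutator_sum_smul {S : A} {α : ι → ι → ℝ}
    (h : ∀ l, S * γ l - γ l * S = ∑ k, α l k • γ k) (a : ι → ℝ) :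
    S * (∑ l, a l • γ l) - (∑ l, a l • γ l) * S = ∑ k, (∑ l, a l * α l k) • γ k := by
  simp only [Finset.mul_sum, Finset.sum_mul, mul_smul_comm, smul_mul_assoc,
    ← Finset.sum_sub_distrib, ← smul_sub, h]
  simp only [Finset.smul_sum, smul_smul, Finset.sum_smul]
  exact Finset.sum_comm

/-- The commutator with a fixed element is a derivation, so `spin_commutator` applies to each factor
of γ_j γ_k. The result is the matrix commutator that enters the quadratic part of the curvature. -/
theorem IsCliffordFamily.spin_commutator_spin (hγ : IsCliffordFamily γ) {α β : ι → ι → ℝ}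
    (hα : ∀ i j, α i j = -α j i) (hβ : ∀ i j, β i j = -β j i) :
    ((1 / 4 : ℝ) • ∑ j, ∑ k, α j k • (γ j * γ k)) * ((1 / 4 : ℝ) • ∑ j, ∑ k, β j k • (γ j * γ k))
      - ((1 / 4 : ℝ) • ∑ j, ∑ k, β j k • (γ j * γ k))
        * ((1 / 4 : ℝ) • ∑ j, ∑ k, α j k • (γ j * γ k)) =
      (1 / 4 : ℝ) • ∑ j, ∑ k, (∑ l, (α j l * β k l - β j l * α k l)) • (γ j * γ k) := by
  have hc := hγ.spin_commutator hα
  set S := (1 / 4 : ℝ) • ∑ j, ∑ k, α j k • (γ j * γ k)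
  have e : S * ((1 / 4 : ℝ) • ∑ j, ∑ k, β j k • (γ j * γ k))
      - ((1 / 4 : ℝ) • ∑ j, ∑ k, β j k • (γ j * γ k)) * S =
      (1 / 4 : ℝ) • ∑ j, ∑ k, β j k •
        ((S * γ j - γ j * S) * γ k + γ j * (S * γ k - γ k * S)) := by
    simp only [smul_mul_assoc, mul_smul_comm, Finset.sum_mul, Finset.mul_sum,
      ← smul_sub, ← Finset.sum_sub_distrib]
    congr 1
    refine Finset.sum_congr rfl fun j _ ↦ Finset.sum_congr rfl fun k _ ↦ ?_
    congr 1
    noncomm_ring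
  rw [e]
  congr 1
  simp only [hc, Finset.sum_mul, Finset.mul_sum, smul_add, Finset.sum_add_distrib, Finset.smul_sum,
    smul_mul_assoc, mul_smul_comm, smul_smul, Finset.sum_sub_distrib, Finset.sum_smul, sub_smul]
  rw [sub_eq_add_neg]
  congr 1
  · have : ∀ j : ι, ∑ k, ∑ l, (β j k * α j l) • (γ l * γ k) =
        ∑ l, ∑ k, (β j k * α j l) • (γ l * γ k) := fun j ↦ Finset.sum_comm
    simp only [this]
    rw [Finset.sum_comm]
    refine Finset.sum_congr rfl fun j _ ↦ ?_
    rw [Finset.sum_comm]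
    refine Finset.sum_congr rfl fun k _ ↦ Finset.sum_congr rfl fun l _ ↦ ?_
    rw [hβ l k, hα l j]
    congr 1
    ring
  · rw [← Finset.sum_neg_distrib]
    refine Finset.sum_congr rfl fun j _ ↦ ?_
    rw [Finset.sum_comm, ← Finset.sum_neg_distrib]
    refine Finset.sum_congr rfl fun k _ ↦ ?_
    rw [← Finset.sum_neg_distrib]
    refine Finset.sum_congr rfl fun l _ ↦ ?_
    rw [hα l k, ← neg_smul]
    congr 1
    ring

/-- The Clifford contraction of an algebraic curvature tensor is twice its scalar curvature. -/
theorem IsCliffordFamily.curvature_contraction (hγ : IsCliffordFamily γ) {R : ι → ι → ι → ι → ℝ}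
    (h12 : ∀ i j k l, R i j k l = -R j i k l) (h34 : ∀ i j k l, R i j k l = -R i j l k)
    (hB : ∀ i j k l, R i j k l + R j k i l + R k i j l = 0) :
    ∑ i, ∑ j, ∑ k, ∑ l, R i j k l • (γ i * γ j * (γ k * γ l)) =
      (2 * ∑ i, ∑ j, R i j j i) • (1 : A) := by
  -- Pair symmetry comes from a linear combination of the four Bianchi identities obtained by
  -- rotating i, j, k, l.
  have hpair : ∀ i j k l, R i j k l = R k l i j := by
    intro i j k l
    have b1 := hB i j k l
    have b2 := hB j k l i
    have b3 := hB k l i j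
    have b4 := hB l i j k
    have := h12 l i k j
    have := h12 k i l j
    have := h34 i j k l
    have := h34 j k i l
    have := h34 k i j l
    have := h34 k l i j
    have := h34 l j k i
    have := h34 j k l i
    have := h34 l i j k
    have := h34 i k l j
    have := h12 i k l j
    have := h12 i k j l
    have := h12 j l k i
    have := h12 j l i k
    have := h34 j l k i
    have := h34 l i k j
    have := h34 i j l k
    have := h12 i j l k
    linarith
  have cyc : ∀ f : ι → ι → ι → A, ∑ i, ∑ j, ∑ k, f i j k = ∑ i, ∑ j, ∑ k, f j k i := by
    intro f
    have h1 : ∑ i, ∑ j, ∑ k, f j k i = ∑ j, ∑ i, ∑ k, f j k i := Finset.sum_comm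
    rw [h1]
    exact Finset.sum_congr rfl fun j _ ↦ Finset.sum_comm
  have rot1 : ∀ i j k, γ j * γ k * γ i = γ i * γ j * γ k
      + (if i = j then (2 : ℝ) else 0) • γ k - (if i = k then (2 : ℝ) else 0) • γ j := by
    intro i j k
    have := hγ.mul_mul_sub j k i
    simp only [@eq_comm _ i]
    rw [sub_eq_iff_eq_add] at this
    rw [this, mul_assoc]
    abel
  have key : ∀ l, ∑ i, ∑ j, ∑ k, R i j k l • (γ i * γ j * γ k) =
      (2 : ℝ) • ∑ k, (∑ i, R i k i l) • γ k := by
    intro l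
    -- Averaging over cyclic permutations of (i, j, k): renaming summation indices gives three
    -- copies of the same sum.
    have hS : ∑ i, ∑ j, ∑ k, (R i j k l • (γ i * γ j * γ k) + R j k i l • (γ j * γ k * γ i)
        + R k i j l • (γ k * γ i * γ j)) =
        (3 : ℝ) • ∑ i, ∑ j, ∑ k, R i j k l • (γ i * γ j * γ k) := by
      have c1 := cyc fun i j k ↦ R i j k l • (γ i * γ j * γ k)
      have c2 := cyc fun i j k ↦ R j k i l • (γ j * γ k * γ i)
      simp only [Finset.sum_add_distrib]
      rw [← c2, ← c1]
      module
    -- Once all three cubic products are brought to the order i, j, k, the Bianchi identity kills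
    -- the cubic term and only the Kronecker corrections, linear in γ, survive. They sum to three
    -- times the Ricci term.
    have hT : ∀ i j k, R i j k l • (γ i * γ j * γ k) + R j k i l • (γ j * γ k * γ i)
        + R k i j l • (γ k * γ i * γ j) =
        ((R j k i l * if i = j then 2 else 0) • γ k - (R j k i l * if i = k then 2 else 0) • γ j)
        + ((R k i j l * if k = j then 2 else 0) • γ i
          - (R k i j l * if k = i then 2 else 0) • γ j) := by
      intro i j k
      have r2 := rot1 k i j
      have r3 : γ k * γ i * γ j = γ i * γ j * γ k - (if k = i then (2 : ℝ) else 0) • γ j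
          + (if k = j then (2 : ℝ) else 0) • γ i := by rw [r2]; abel
      rw [r3, rot1 i j k, show R i j k l = - R j k i l - R k i j l by linarith [hB i j k l]]
      generalize γ i * γ j * γ k = P
      module
    simp only [hT, Finset.sum_add_distrib, Finset.sum_sub_distrib] at hS
    have e1 : ∑ i, ∑ j, ∑ k, (R j k i l * if i = j then 2 else 0) • γ k =
        (2 : ℝ) • ∑ k, (∑ i, R i k i l) • γ k := by
      simp only [mul_ite, mul_zero, ite_smul, zero_smul, Finset.sum_smul, Finset.smul_sum,
        smul_smul]
      rw [Finset.sum_comm (s := Finset.univ (α := ι)) (t := Finset.univ)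
        (f := fun k i ↦ (2 * R i k i l) • γ k)]
      refine Finset.sum_congr rfl fun i _ ↦ ?_
      rw [Finset.sum_comm]
      refine Finset.sum_congr rfl fun k _ ↦ ?_
      simp [mul_comm]
    have e2 : ∑ i, ∑ j, ∑ k, (R j k i l * if i = k then 2 else 0) • γ j =
        -((2 : ℝ) • ∑ k, (∑ i, R i k i l) • γ k) := by
      simp only [mul_ite, mul_zero, ite_smul, zero_smul, Finset.sum_smul, Finset.smul_sum,
        smul_smul, ← Finset.sum_neg_distrib]
      rw [Finset.sum_comm (s := Finset.univ (α := ι)) (t := Finset.univ)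
        (f := fun k i ↦ -((2 * R i k i l) • γ k))]
      refine Finset.sum_congr rfl fun i _ ↦ Finset.sum_congr rfl fun j _ ↦ ?_
      rw [h12 i j i l]
      simp [mul_comm]
    have e3 : ∑ i, ∑ j, ∑ k, (R k i j l * if k = j then 2 else 0) • γ i =
        (2 : ℝ) • ∑ k, (∑ i, R i k i l) • γ k := by
      simp only [mul_ite, mul_zero, ite_smul, zero_smul, Finset.sum_smul, Finset.smul_sum,
        smul_smul]
      refine Finset.sum_congr rfl fun i _ ↦ Finset.sum_congr rfl fun j _ ↦ ?_
      simp [mul_comm]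
    have e4 : ∑ i, ∑ j, ∑ k, (R k i j l * if k = i then 2 else 0) • γ j = 0 := by
      refine Finset.sum_eq_zero fun i _ ↦ Finset.sum_eq_zero fun j _ ↦ ?_
      have : R i i j l = 0 := by linarith [h12 i i j l]
      simp [this]
    rw [e1, e2, e3, e4] at hS
    have h3 : (3 : ℝ) • ∑ i, ∑ j, ∑ k, R i j k l • (γ i * γ j * γ k) =
        (3 : ℝ) • (2 : ℝ) • ∑ k, (∑ i, R i k i l) • γ k := by
      rw [← hS]; module
    exact smul_right_injective A (three_ne_zero (α := ℝ)) h3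
  have hfold : ∑ i, ∑ j, ∑ k, ∑ l, R i j k l • (γ i * γ j * (γ k * γ l)) =
      ∑ l, (∑ i, ∑ j, ∑ k, R i j k l • (γ i * γ j * γ k)) * γ l := by
    simp only [Finset.sum_mul, smul_mul_assoc, mul_assoc]
    refine (Finset.sum_congr rfl fun i _ ↦ ?_).trans Finset.sum_comm
    refine (Finset.sum_congr rfl fun j _ ↦ ?_).trans Finset.sum_comm
    exact Finset.sum_comm
  have hRic : ∀ k l, ∑ i, R i k i l = ∑ i, R i l i k := fun k l ↦
    Finset.sum_congr rfl fun i _ ↦ hpair i k i l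
  -- The Ricci contraction is symmetric by pair symmetry, so only the anticommutator of γ_k and γ_l
  -- contributes, leaving a trace.
  have hsymm : ∑ l, ∑ k, (∑ i, R i k i l) • (γ k * γ l) =
      ∑ l, ∑ k, (∑ i, R i k i l) • (γ l * γ k) := by
    rw [Finset.sum_comm]
    exact Finset.sum_congr rfl fun k _ ↦ Finset.sum_congr rfl fun l _ ↦ by rw [hRic k l]
  have hdiag : ∑ l, ∑ k, (∑ i, R i k i l) • (γ k * γ l) + ∑ l, ∑ k, (∑ i, R i k i l) • (γ k * γ l) =
      (2 * ∑ i, ∑ j, R i j j i) • (1 : A) := by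
    nth_rewrite 2 [hsymm]
    simp only [← Finset.sum_add_distrib, ← smul_add, hγ _ _, ite_smul, zero_smul, smul_ite,
      smul_zero, Finset.sum_ite_eq', Finset.mem_univ, if_true, smul_smul, ← Finset.sum_smul]
    rw [Finset.sum_comm]
    congr 1
    rw [Finset.mul_sum]
    refine Finset.sum_congr rfl fun i _ ↦ ?_
    rw [Finset.mul_sum, Finset.sum_mul]
    refine Finset.sum_congr rfl fun j _ ↦ ?_
    rw [h34 j i j i]
    ring
  rw [hfold, ← hdiag]
  simp only [key, Finset.smul_sum, Finset.sum_mul, smul_mul_assoc,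
    ← two_smul ℝ]

end CliffordRelations

/-! ### Matrices and fibre endomorphisms acting on tuples. -/

section MatrixAction

variable {N : ℕ} {𝕜 : Type*} [RCLike 𝕜] {W : Type*} [AddCommGroup W] [Module 𝕜 W] [Module ℝ W]
  [IsScalarTower ℝ 𝕜 W]

variable (W) in
/-- The action of matrices on `𝕜^N ⊗ W = W^N`, as a homomorphism of real algebras. -/
def matEnd : Matrix (Fin N) (Fin N) 𝕜 →ₐ[ℝ] Module.End ℝ (Fin N → W) where
  toFun m :=
    { toFun := matAct m
      map_add' := fun u v ↦ by
        funext A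
        simp [matAct, Finset.sum_add_distrib]
      map_smul' := fun r u ↦ by
        funext A
        have : SMulCommClass ℝ 𝕜 W := IsScalarTower.to_smulCommClass
        simp only [matAct, Pi.smul_apply, Finset.smul_sum, RingHom.id_apply]
        exact Finset.sum_congr rfl fun B _ ↦ smul_comm _ _ _ }
  map_one' := by
    ext u A
    simp [matAct, Matrix.one_apply]
  map_mul' m m' := by
    refine LinearMap.ext fun u ↦ funext fun A ↦ ?_
    simp only [matAct, LinearMap.coe_mk, AddHom.coe_mk, Module.End.mul_apply, Matrix.mul_apply,
      Finset.sum_smul, Finset.smul_sum, smul_smul]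
    exact Finset.sum_comm
  map_zero' := by
    refine LinearMap.ext fun u ↦ funext fun A ↦ ?_
    simp [matAct]
  map_add' m m' := by
    refine LinearMap.ext fun u ↦ funext fun A ↦ ?_
    simp [matAct, add_smul, Finset.sum_add_distrib]
  commutes' r := by
    refine LinearMap.ext fun u ↦ funext fun A ↦ ?_
    simp only [matAct, LinearMap.coe_mk, AddHom.coe_mk, Matrix.algebraMap_matrix_apply, ite_smul,
      zero_smul, Finset.sum_ite_eq, Finset.mem_univ, if_true, algebraMap_smul]
    rfl

/-- The componentwise action of an endomorphism of `W` on `W^N`. -/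
def tupleEnd (T : W →ₗ[𝕜] W) : Module.End ℝ (Fin N → W) where
  toFun u A := T (u A)
  map_add' u v := by
    funext A
    simp
  map_smul' r u := by
    funext A
    simp only [Pi.smul_apply, RingHom.id_apply]
    rw [← algebraMap_smul 𝕜 r (u A), map_smul, algebraMap_smul]

end MatrixAction

/-! ### Clifford multiplication in a spin gauge. -/

section Gauge

variable {n N : ℕ} {M : Type*} [TopologicalSpace M]
  [ChartedSpace (EuclideanSpace ℝ (Fin n)) M] [IsManifold (𝓡 n) ∞ M]
  [RiemannianBundle (fun x : M ↦ TangentSpace (𝓡 n) x)]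
  {𝕜 : Type*} [RCLike 𝕜]
  {V : M → Type*} [∀ x, NormedAddCommGroup (V x)] [∀ x, InnerProductSpace 𝕜 (V x)]
  [∀ x, NormedSpace ℝ (V x)] [∀ x, IsScalarTower ℝ 𝕜 (V x)]

theorem finrank_tangentSpace (x : M) : Module.finrank ℝ (TangentSpace (𝓡 n) x) = n := by
  change Module.finrank ℝ (EuclideanSpace ℝ (Fin n)) = n
  simp

/-- The orthonormal basis of `T_x M` formed by the values of an orthonormal frame. -/
def Orthonormal.tangentBasis {x : M} {v : Fin n → TangentSpace (𝓡 n) x} (hv : Orthonormal ℝ v) :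
    OrthonormalBasis (Fin n) ℝ (TangentSpace (𝓡 n) x) :=
  OrthonormalBasis.mk hv (by
    have : FiniteDimensional ℝ (TangentSpace (𝓡 n) x) :=
      inferInstanceAs (FiniteDimensional ℝ (EuclideanSpace ℝ (Fin n)))
    rw [hv.linearIndependent.span_eq_top_of_card_eq_finrank' (by simp [finrank_tangentSpace])])

theorem Orthonormal.sum_inner_smul {x : M} {v : Fin n → TangentSpace (𝓡 n) x}
    (hv : Orthonormal ℝ v) (w : TangentSpace (𝓡 n) x) : ∑ i, (inner ℝ (v i) w : ℝ) • v i = w := by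
  simpa [Orthonormal.tangentBasis] using hv.tangentBasis.sum_repr' w

theorem Orthonormal.sum_inner_mul_inner_tangent {x : M} {v : Fin n → TangentSpace (𝓡 n) x}
    (hv : Orthonormal ℝ v) (w w' : TangentSpace (𝓡 n) x) :
    ∑ i, (inner ℝ (v i) w : ℝ) * inner ℝ (v i) w' = inner ℝ w w' := by
  have := hv.tangentBasis.sum_inner_mul_inner w w'
  simpa [Orthonormal.tangentBasis, real_inner_comm] using this

variable (e : Fin n → (x : M) → TangentSpace (𝓡 n) x)

/-- The components of a tangent vector in an orthonormal frame, as a linear map. -/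
def frameCoordsₗ (x : M) : TangentSpace (𝓡 n) x →ₗ[ℝ] EuclideanSpace ℝ (Fin n) where
  toFun := frameCoords e x
  map_add' v w := by simp [frameCoords, inner_add_right, add_smul, Finset.sum_add_distrib]
  map_smul' r v := by simp [frameCoords, inner_smul_right, Finset.smul_sum, smul_smul]

variable (V) in
/-- Clifford multiplication by a tangent vector on the fibre of `S(TM) ⊗ V`, in the gauge with
frame `e`. -/
def cliffEnd (ρ : Cl n →ₐ[ℝ] Matrix (Fin N) (Fin N) 𝕜) (x : M) :
    TangentSpace (𝓡 n) x →ₗ[ℝ] Module.End ℝ (Fin N → V x) :=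
  (matEnd (V x)).toLinearMap ∘ₗ ρ.toLinearMap ∘ₗ clVec n ∘ₗ frameCoordsₗ e x

theorem cliffMul_apply (ρ : Cl n →ₐ[ℝ] Matrix (Fin N) (Fin N) 𝕜)
    (X : (x : M) → TangentSpace (𝓡 n) x) (ψ : (x : M) → Fin N → V x) (x : M) :
    cliffMul ρ e X ψ x = cliffEnd V e ρ x (X x) (ψ x) := rfl

/-- The Clifford generators in the representation `ρ`. -/
def gammaMat (ρ : Cl n →ₐ[ℝ] Matrix (Fin N) (Fin N) 𝕜) (k : Fin n) :
    Matrix (Fin N) (Fin N) 𝕜 :=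
  ρ (clVec n (EuclideanSpace.single k 1))

theorem cliffEnd_eq_sum (ρ : Cl n →ₐ[ℝ] Matrix (Fin N) (Fin N) 𝕜) (x : M)
    (v : TangentSpace (𝓡 n) x) :
    cliffEnd V e ρ x v = ∑ k, (inner ℝ (e k x) v : ℝ) • matEnd (V x) (gammaMat ρ k) := by
  change matEnd (V x) (ρ (clVec n (frameCoords e x v))) = _
  simp [frameCoords, gammaMat]

theorem cliffEnd_frame {x : M} (he : Orthonormal ℝ fun i ↦ e i x)
    (ρ : Cl n →ₐ[ℝ] Matrix (Fin N) (Fin N) 𝕜) (k : Fin n) :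
    cliffEnd V e ρ x (e k x) = matEnd (V x) (gammaMat ρ k) := by
  rw [cliffEnd_eq_sum]
  simp only [orthonormal_iff_ite.1 he, ite_smul, one_smul, zero_smul, Finset.sum_ite_eq',
    Finset.mem_univ, if_true]

/-- Taking components in an orthonormal frame is an isometry, and the polar form of −‖v‖² is −2⟨v,
w⟩. -/
theorem cliffEnd_mul_add {x : M} (he : Orthonormal ℝ fun i ↦ e i x)
    (ρ : Cl n →ₐ[ℝ] Matrix (Fin N) (Fin N) 𝕜) (v w : TangentSpace (𝓡 n) x) :
    cliffEnd V e ρ x v * cliffEnd V e ρ x w + cliffEnd V e ρ x w * cliffEnd V e ρ x v =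
      (-2 * inner ℝ v w : ℝ) • 1 := by
  have h1 : (inner ℝ (frameCoords e x v) (frameCoords e x w) : ℝ) = inner ℝ v w := by
    rw [← he.sum_inner_mul_inner_tangent v w]
    simp [frameCoords, PiLp.inner_apply, Pi.single_apply, mul_comm]
  have h2 : clVec n (frameCoords e x v) * clVec n (frameCoords e x w)
      + clVec n (frameCoords e x w) * clVec n (frameCoords e x v) =
      (-2 * inner ℝ v w : ℝ) • 1 := by
    rw [CliffordAlgebra.ι_mul_ι_add_swap, ← h1, Algebra.algebraMap_eq_smul_one]
    congr 1
    simp only [QuadraticMap.polar, cliffordForm_apply, norm_add_sq_real]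
    ring
  have h3 := congrArg (fun a ↦ matEnd (V x) (ρ a)) h2
  simp only [map_add, map_mul, map_smul, map_one] at h3
  exact h3

/-- The orthonormal family `v` need not be the gauge frame; this lets the Dirac operator be squared
in `ε` while Clifford multiplication is defined through `e`. -/
theorem isCliffordFamily_cliffEnd {x : M} (he : Orthonormal ℝ fun i ↦ e i x)
    (ρ : Cl n →ₐ[ℝ] Matrix (Fin N) (Fin N) 𝕜) {v : Fin n → TangentSpace (𝓡 n) x}
    (hv : Orthonormal ℝ v) : IsCliffordFamily fun k ↦ cliffEnd V e ρ x (v k) := by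
  intro i j
  rw [cliffEnd_mul_add e he, orthonormal_iff_ite.1 hv]
  split_ifs <;> simp only [mul_one, mul_zero]

theorem isCliffordFamily_matEnd {x : M} (he : Orthonormal ℝ fun i ↦ e i x)
    (ρ : Cl n →ₐ[ℝ] Matrix (Fin N) (Fin N) 𝕜) :
    IsCliffordFamily fun k ↦ matEnd (V x) (gammaMat ρ k) := by
  simpa only [cliffEnd_frame e he] using isCliffordFamily_cliffEnd (V := V) e he ρ he

end Gauge

/-! ### Componentwise derivatives of tuples of sections. -/

section Tuples

variable {n N : ℕ} {M : Type*} [TopologicalSpace M]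
  [ChartedSpace (EuclideanSpace ℝ (Fin n)) M] [IsManifold (𝓡 n) ∞ M]
  {𝕜 : Type*} [RCLike 𝕜]
  {Fm : Type*} [NormedAddCommGroup Fm] [NormedSpace 𝕜 Fm] [NormedSpace ℝ Fm]
  [IsScalarTower ℝ 𝕜 Fm] [FiniteDimensional ℝ Fm]
  {V : M → Type*} [∀ x, NormedAddCommGroup (V x)] [∀ x, InnerProductSpace 𝕜 (V x)]
  [∀ x, NormedSpace ℝ (V x)] [∀ x, IsScalarTower ℝ 𝕜 (V x)]
  [TopologicalSpace (TotalSpace Fm V)] [FiberBundle Fm V]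
  [VectorBundle 𝕜 Fm V] [VectorBundle ℝ Fm V] [ContMDiffVectorBundle ∞ Fm V (𝓡 n)]

/-- Smoothness of a vector field on `U`. -/
abbrev IsSmoothField (U : Set M) (X : (x : M) → TangentSpace (𝓡 n) x) : Prop :=
  ContMDiffOn (𝓡 n) ((𝓡 n).prod 𝓘(ℝ, EuclideanSpace ℝ (Fin n))) ∞ (T% X) U

variable (n Fm) in
/-- Smoothness on `U` of a tuple of sections of `V`. -/
def IsSmoothTuple (U : Set M) (ψ : (x : M) → Fin N → V x) : Prop :=
  ∀ A, ContMDiffOn (𝓡 n) ((𝓡 n).prod 𝓘(ℝ, Fm)) ∞ (T% (fun y ↦ ψ y A)) U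

theorem ContMDiffOn.const_smul_scalar_section (c : 𝕜) {U : Set M} {σ : (x : M) → V x}
    (h : ContMDiffOn (𝓡 n) ((𝓡 n).prod 𝓘(ℝ, Fm)) ∞ (T% σ) U) :
    ContMDiffOn (𝓡 n) ((𝓡 n).prod 𝓘(ℝ, Fm)) ∞ (T% (fun y ↦ c • σ y)) U := by
  intro x hx
  have hx' := h x hx
  rw [contMDiffWithinAt_section] at hx' ⊢
  have hL := ((c • ContinuousLinearMap.id 𝕜 Fm).restrictScalars ℝ).contDiff.contMDiff.contMDiffAt
    |>.comp_contMDiffWithinAt (n := ∞) x hx'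
  have hev : ∀ y ∈ (trivializationAt Fm V x).baseSet,
      ((trivializationAt Fm V x) ⟨y, c • σ y⟩).2 = c • ((trivializationAt Fm V x) ⟨y, σ y⟩).2 :=
    fun y hy ↦ ((trivializationAt Fm V x).linear 𝕜 hy).map_smul c (σ y)
  refine hL.congr_of_eventuallyEq ?_ (hev x (FiberBundle.mem_baseSet_trivializationAt' x))
  filter_upwards [nhdsWithin_le_nhds ((trivializationAt Fm V x).open_baseSet.mem_nhds
    (FiberBundle.mem_baseSet_trivializationAt' x))] with y hy
  exact hev y hy

namespace IsSmoothTuple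

variable {U : Set M} {ψ φ : (x : M) → Fin N → V x}

theorem congr (hψ : IsSmoothTuple n Fm U ψ) (h : ∀ y ∈ U, φ y = ψ y) :
    IsSmoothTuple n Fm U φ :=
  fun A ↦ (hψ A).congr fun y hy ↦ by rw [h y hy]

theorem add (hψ : IsSmoothTuple n Fm U ψ) (hφ : IsSmoothTuple n Fm U φ) :
    IsSmoothTuple n Fm U (fun y ↦ ψ y + φ y) :=
  fun A ↦ (hψ A).add_section (hφ A)

theorem sum_smul {ι : Type*} (s : Finset ι) {f : ι → M → ℝ} {χ : ι → (x : M) → Fin N → V x}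
    (hf : ∀ i, ContMDiffOn (𝓡 n) 𝓘(ℝ, ℝ) ∞ (f i) U) (hχ : ∀ i, IsSmoothTuple n Fm U (χ i)) :
    IsSmoothTuple n Fm U (fun y ↦ ∑ i ∈ s, f i y • χ i y) := by
  intro A
  have := ContMDiffOn.sum_section (s := s) fun i _ ↦ (hf i).smul_section (hχ i A)
  refine this.congr fun y _ ↦ ?_
  simp

theorem sum {ι : Type*} (s : Finset ι) {χ : ι → (x : M) → Fin N → V x}
    (hχ : ∀ i, IsSmoothTuple n Fm U (χ i)) : IsSmoothTuple n Fm U (fun y ↦ ∑ i ∈ s, χ i y) := by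
  simpa using sum_smul s (f := fun _ _ ↦ 1) (fun _ ↦ contMDiffOn_const) hχ

theorem const_smul (r : ℝ) (hψ : IsSmoothTuple n Fm U ψ) :
    IsSmoothTuple n Fm U (fun y ↦ r • ψ y) :=
  fun A ↦ (hψ A).const_smul_section

theorem matEnd (hψ : IsSmoothTuple n Fm U ψ) (m : Matrix (Fin N) (Fin N) 𝕜) :
    IsSmoothTuple n Fm U (fun y ↦ matEnd (V y) m (ψ y)) :=
  fun A ↦ ContMDiffOn.sum_section (s := Finset.univ) (t := fun B y ↦ m A B • ψ y B) fun B _ ↦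
    (hψ B).const_smul_scalar_section (m A B)

end IsSmoothTuple

/-- The Leibniz rule concerns real functions, whereas Clifford matrices have entries in 𝕜;
𝕜-linearity of the connection is what makes constant matrices commute with it. -/
theorem LinConnection.sum_smul_scalar (D : LinConnection n 𝕜 Fm V) {ι : Type*} (s : Finset ι)
    (c : ι → 𝕜) {σ : ι → (x : M) → V x} {x : M}
    (hσ : ∀ i, MDifferentiableAt (𝓡 n) ((𝓡 n).prod 𝓘(ℝ, Fm)) (T% (σ i)) x)
    (v : TangentSpace (𝓡 n) x) :
    D.toFun (fun y ↦ ∑ i ∈ s, c i • σ i y) x v = ∑ i ∈ s, c i • D.toFun (σ i) x v := by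
  classical
  have hcσ := fun i ↦ mdifferentiableAt_smul_scalar (c i) (hσ i)
  induction s using Finset.induction_on with
  | empty =>
    have := D.isCovariantDerivativeOnUniv.zero (x := x)
    simp only [Finset.sum_empty]
    change D.toFun 0 x v = 0
    rw [this]; rfl
  | insert a s ha ih =>
    simp only [Finset.sum_insert ha]
    have hs : MDifferentiableAt (𝓡 n) ((𝓡 n).prod 𝓘(ℝ, Fm))
        (T% (fun y ↦ ∑ i ∈ s, c i • σ i y)) x :=
      MDifferentiableAt.sum_section fun i _ ↦ hcσ i
    have h := D.isCovariantDerivativeOnUniv.add (hcσ a) hs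
    rw [← ih, ← D.smul (c a) (σ a) x (hσ a) v]
    exact congrArg (fun T ↦ T v) h

/-- The componentwise covariant derivative of a tuple of sections. -/
def LinConnection.tupleDeriv (D : LinConnection n 𝕜 Fm V) (ψ : (x : M) → Fin N → V x) (x : M) :
    TangentSpace (𝓡 n) x →ₗ[ℝ] (Fin N → V x) :=
  LinearMap.pi fun A ↦ (D.toFun (fun y ↦ ψ y A) x).toLinearMap

section

variable (D : LinConnection n 𝕜 Fm V) {U : Set M} {ψ φ : (x : M) → Fin N → V x}

theorem LinConnection.tupleDeriv_congr (hU : IsOpen U) (hψ : IsSmoothTuple n Fm U ψ)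
    (h : ∀ y ∈ U, ψ y = φ y) {x : M} (hx : x ∈ U) : D.tupleDeriv ψ x = D.tupleDeriv φ x := by
  refine LinearMap.ext fun v ↦ funext fun A ↦ ?_
  exact congrArg (fun T ↦ T v)
    (D.toCovariantDerivative.congr_of_isOpen hU (hψ A) (fun y hy ↦ by rw [h y hy]) hx)

theorem LinConnection.tupleDeriv_sum_smul (hU : IsOpen U) {ι : Type*} (s : Finset ι) {f : ι → M → ℝ}
    {χ : ι → (x : M) → Fin N → V x} (hf : ∀ i, ContMDiffOn (𝓡 n) 𝓘(ℝ, ℝ) ∞ (f i) U)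
    (hχ : ∀ i, IsSmoothTuple n Fm U (χ i)) {x : M} (hx : x ∈ U) (v : TangentSpace (𝓡 n) x) :
    D.tupleDeriv (fun y ↦ ∑ i ∈ s, f i y • χ i y) x v =
      ∑ i ∈ s, (mvfderiv (𝓡 n) (f i) x v • χ i x + f i x • D.tupleDeriv (χ i) x v) := by
  funext A
  have h := D.toCovariantDerivative.sum_smul_apply s (x := x)
    (fun i ↦ ((hf i x hx).contMDiffAt (hU.mem_nhds hx)).mdifferentiableAt (by simp))
    (fun i ↦ (hχ i A).mdifferentiableAt_section hU hx) v
  simp only [Finset.sum_apply, Pi.add_apply, Pi.smul_apply]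
  refine Eq.trans ?_ h
  change D.toFun _ x v = D.toFun _ x v
  simp only [Finset.sum_apply, Pi.smul_apply]

theorem LinConnection.tupleDeriv_add (hU : IsOpen U) (hψ : IsSmoothTuple n Fm U ψ)
    (hφ : IsSmoothTuple n Fm U φ) {x : M} (hx : x ∈ U) :
    D.tupleDeriv (fun y ↦ ψ y + φ y) x = D.tupleDeriv ψ x + D.tupleDeriv φ x := by
  refine LinearMap.ext fun v ↦ funext fun A ↦ ?_
  exact congrArg (fun T ↦ T v) (D.isCovariantDerivativeOnUniv.add
    ((hψ A).mdifferentiableAt_section hU hx) ((hφ A).mdifferentiableAt_section hU hx))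

theorem LinConnection.tupleDeriv_matEnd (hU : IsOpen U) (hψ : IsSmoothTuple n Fm U ψ)
    (m : Matrix (Fin N) (Fin N) 𝕜) {x : M} (hx : x ∈ U) (v : TangentSpace (𝓡 n) x) :
    D.tupleDeriv (fun y ↦ matEnd (V y) m (ψ y)) x v = matEnd (V x) m (D.tupleDeriv ψ x v) :=
  funext fun A ↦ D.sum_smul_scalar Finset.univ (m A)
    (fun B ↦ (hψ B).mdifferentiableAt_section hU hx) v

theorem IsSmoothTuple.tupleDeriv [T2Space M] (hU : IsOpen U) (hψ : IsSmoothTuple n Fm U ψ)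
    {X : (x : M) → TangentSpace (𝓡 n) x} (hX : IsSmoothField U X) :
    IsSmoothTuple n Fm U (fun y ↦ D.tupleDeriv ψ y (X y)) :=
  fun A ↦ D.toCovariantDerivative.contMDiffOn_apply D.smooth hU (hψ A) hX

end

end Tuples

/-! ### The spin connection and parallelism of Clifford multiplication. -/

section SpinConnection

variable {n N : ℕ} {M : Type*} [TopologicalSpace M] [T2Space M]
  [ChartedSpace (EuclideanSpace ℝ (Fin n)) M] [IsManifold (𝓡 n) ∞ M]
  [RiemannianBundle (fun x : M ↦ TangentSpace (𝓡 n) x)]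
  [IsContMDiffRiemannianBundle (𝓡 n) ∞ (EuclideanSpace ℝ (Fin n))
    (fun x : M ↦ TangentSpace (𝓡 n) x)]
  {𝕜 : Type*} [RCLike 𝕜]
  {Fm : Type*} [NormedAddCommGroup Fm] [NormedSpace 𝕜 Fm] [NormedSpace ℝ Fm]
  [IsScalarTower ℝ 𝕜 Fm] [FiniteDimensional ℝ Fm]
  {V : M → Type*} [∀ x, NormedAddCommGroup (V x)] [∀ x, InnerProductSpace 𝕜 (V x)]
  [∀ x, NormedSpace ℝ (V x)] [∀ x, IsScalarTower ℝ 𝕜 (V x)]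
  [TopologicalSpace (TotalSpace Fm V)] [FiberBundle Fm V]
  [VectorBundle 𝕜 Fm V] [VectorBundle ℝ Fm V] [ContMDiffVectorBundle ∞ Fm V (𝓡 n)]

theorem IsOrthonormalFrameOn.mono {e : Fin n → (x : M) → TangentSpace (𝓡 n) x} {U U' : Set M}
    (he : IsOrthonormalFrameOn e U) (h : U' ⊆ U) : IsOrthonormalFrameOn e U' where
  smooth i := (he.smooth i).mono h
  orthonormal x hx := he.orthonormal x (h hx)

variable {L : CovariantDerivative (𝓡 n) (EuclideanSpace ℝ (Fin n))
    (fun x : M ↦ TangentSpace (𝓡 n) x)}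
  {e : Fin n → (x : M) → TangentSpace (𝓡 n) x} {U : Set M}

theorem IsLeviCivita.frame_antisymm (hL : IsLeviCivita L) (hU : IsOpen U)
    (he : IsOrthonormalFrameOn e U) (X : (x : M) → TangentSpace (𝓡 n) x) {x : M} (hx : x ∈ U)
    (j k : Fin n) :
    (inner ℝ (L (e j) x (X x)) (e k x) : ℝ) = -inner ℝ (L (e k) x (X x)) (e j x) := by
  have h := hL.mvfderiv_inner hU (he.smooth j) (he.smooth k) X hx
  rw [mvfderiv_congr_of_isOpen hU (g := fun _ ↦ if j = k then (1 : ℝ) else 0)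
    (fun y hy ↦ orthonormal_iff_ite.1 (he.orthonormal y hy) j k) hx, mvfderiv_const] at h
  rw [real_inner_comm (L (e k) x (X x))] at h
  have h' : (0 : ℝ) = _ := h
  linarith

variable (V) in
/-- The endomorphism `¼ ∑ j k, ⟨∇^L_v e_j, e_k⟩ c(e_j) c(e_k)` of the fibre. -/
def spinEnd (ρ : Cl n →ₐ[ℝ] Matrix (Fin N) (Fin N) 𝕜)
    (L : CovariantDerivative (𝓡 n) (EuclideanSpace ℝ (Fin n)) (fun x : M ↦ TangentSpace (𝓡 n) x))
    (e : Fin n → (x : M) → TangentSpace (𝓡 n) x) (x : M) :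
    TangentSpace (𝓡 n) x →ₗ[ℝ] Module.End ℝ (Fin N → V x) where
  toFun v := (1 / 4 : ℝ) • ∑ j, ∑ k, (inner ℝ (L (e j) x v) (e k x) : ℝ) •
    (cliffEnd V e ρ x (e j x) * cliffEnd V e ρ x (e k x))
  map_add' v w := by
    simp only [map_add, inner_add_left, add_smul, Finset.sum_add_distrib, smul_add]
  map_smul' r v := by
    simp only [map_smul, real_inner_smul_left, mul_smul, ← Finset.smul_sum, RingHom.id_apply]
    rw [smul_comm]

/-- The connection on `S(TM) ⊗ V` at a point, as a linear map in the tangent vector. -/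
def tensorDeriv (ρ : Cl n →ₐ[ℝ] Matrix (Fin N) (Fin N) 𝕜)
    (L : CovariantDerivative (𝓡 n) (EuclideanSpace ℝ (Fin n)) (fun x : M ↦ TangentSpace (𝓡 n) x))
    (D : LinConnection n 𝕜 Fm V) (e : Fin n → (x : M) → TangentSpace (𝓡 n) x)
    (ψ : (x : M) → Fin N → V x) (x : M) : TangentSpace (𝓡 n) x →ₗ[ℝ] (Fin N → V x) :=
  (spinEnd V ρ L e x).flip (ψ x) + D.tupleDeriv ψ x

theorem tensorDeriv_apply (ρ : Cl n →ₐ[ℝ] Matrix (Fin N) (Fin N) 𝕜) (D : LinConnection n 𝕜 Fm V)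
    (ψ : (x : M) → Fin N → V x) (x : M) (v : TangentSpace (𝓡 n) x) :
    tensorDeriv ρ L D e ψ x v = spinEnd V ρ L e x v (ψ x) + D.tupleDeriv ψ x v := rfl

theorem tensorConn_apply (ρ : Cl n →ₐ[ℝ] Matrix (Fin N) (Fin N) 𝕜) (D : LinConnection n 𝕜 Fm V)
    (X : (x : M) → TangentSpace (𝓡 n) x) (ψ : (x : M) → Fin N → V x) (x : M) :
    tensorConn ρ L D e X ψ x = tensorDeriv ρ L D e ψ x (X x) := by
  rw [tensorDeriv_apply]
  refine congrArg₂ (· + ·) ?_ rfl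
  simp only [spinConnTerm, spinEnd, LinearMap.coe_mk, AddHom.coe_mk, LinearMap.smul_apply,
    LinearMap.sum_apply, Module.End.mul_apply, cliffMul_apply]

theorem spinEnd_eq_of_orthonormal (ρ : Cl n →ₐ[ℝ] Matrix (Fin N) (Fin N) 𝕜) {x : M}
    (he : Orthonormal ℝ fun i ↦ e i x) (v : TangentSpace (𝓡 n) x) :
    spinEnd V ρ L e x v = (1 / 4 : ℝ) • ∑ j, ∑ k, (inner ℝ (L (e j) x v) (e k x) : ℝ) •
      (matEnd (V x) (gammaMat ρ j) * matEnd (V x) (gammaMat ρ k)) := by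
  simp only [← cliffEnd_frame (V := V) e he ρ]
  rfl

section Smooth

variable (ρ : Cl n →ₐ[ℝ] Matrix (Fin N) (Fin N) 𝕜) (D : LinConnection n 𝕜 Fm V)
  {ψ φ : (x : M) → Fin N → V x} {X Y : (x : M) → TangentSpace (𝓡 n) x}

theorem IsSmoothTuple.cliffEnd (hψ : IsSmoothTuple n Fm U ψ) (he : IsOrthonormalFrameOn e U)
    (hX : IsSmoothField U X) : IsSmoothTuple n Fm U (fun y ↦ cliffEnd V e ρ y (X y) (ψ y)) := by
  simp only [cliffEnd_eq_sum, LinearMap.sum_apply, LinearMap.smul_apply]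
  exact IsSmoothTuple.sum_smul _ (fun k ↦ contMDiffOn_inner (he.smooth k) hX)
    fun k ↦ hψ.matEnd (gammaMat ρ k)

theorem IsSmoothTuple.tensorDeriv (hψ : IsSmoothTuple n Fm U ψ) (hL : IsLeviCivita L)
    (hU : IsOpen U) (he : IsOrthonormalFrameOn e U) (hX : IsSmoothField U X) :
    IsSmoothTuple n Fm U (fun y ↦ tensorDeriv ρ L D e ψ y (X y)) := by
  refine IsSmoothTuple.add ?_ (hψ.tupleDeriv D hU hX)
  simp only [spinEnd, LinearMap.coe_mk, AddHom.coe_mk, LinearMap.smul_apply,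
    LinearMap.sum_apply, Module.End.mul_apply, LinearMap.flip_apply]
  refine IsSmoothTuple.const_smul _ (IsSmoothTuple.sum _ fun j ↦ IsSmoothTuple.sum_smul _
    (fun k ↦ contMDiffOn_inner (hL.contMDiffOn_apply hU hX (he.smooth j)) (he.smooth k))
    fun k ↦ (hψ.cliffEnd ρ he (he.smooth k)).cliffEnd ρ he (he.smooth j))

theorem tensorDeriv_congr (hU : IsOpen U) (hψ : IsSmoothTuple n Fm U ψ) (h : ∀ y ∈ U, ψ y = φ y)
    {x : M} (hx : x ∈ U) : tensorDeriv ρ L D e ψ x = tensorDeriv ρ L D e φ x := by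
  unfold tensorDeriv
  rw [D.tupleDeriv_congr hU hψ h hx, h x hx]

theorem tensorDeriv_sum_smul (hU : IsOpen U) {ι : Type*} (s : Finset ι) {f : ι → M → ℝ}
    {χ : ι → (x : M) → Fin N → V x} (hf : ∀ i, ContMDiffOn (𝓡 n) 𝓘(ℝ, ℝ) ∞ (f i) U)
    (hχ : ∀ i, IsSmoothTuple n Fm U (χ i)) {x : M} (hx : x ∈ U) (v : TangentSpace (𝓡 n) x) :
    tensorDeriv ρ L D e (fun y ↦ ∑ i ∈ s, f i y • χ i y) x v =
      ∑ i ∈ s, (mvfderiv (𝓡 n) (f i) x v • χ i x + f i x • tensorDeriv ρ L D e (χ i) x v) := by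
  simp only [tensorDeriv_apply, D.tupleDeriv_sum_smul hU s hf hχ hx, map_sum, map_smul, smul_add]
  rw [← Finset.sum_add_distrib]
  exact Finset.sum_congr rfl fun i _ ↦ by abel

theorem tensorDeriv_add (hU : IsOpen U) (hψ : IsSmoothTuple n Fm U ψ)
    (hφ : IsSmoothTuple n Fm U φ) {x : M} (hx : x ∈ U) :
    tensorDeriv ρ L D e (fun y ↦ ψ y + φ y) x =
      tensorDeriv ρ L D e ψ x + tensorDeriv ρ L D e φ x := by
  unfold tensorDeriv
  rw [D.tupleDeriv_add hU hψ hφ hx, map_add]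
  abel

theorem tensorDeriv_const_smul (hU : IsOpen U) (r : ℝ) (hψ : IsSmoothTuple n Fm U ψ)
    {x : M} (hx : x ∈ U) :
    tensorDeriv ρ L D e (fun y ↦ r • ψ y) x = r • tensorDeriv ρ L D e ψ x := by
  refine LinearMap.ext fun v ↦ ?_
  have h := tensorDeriv_sum_smul (L := L) (e := e) ρ D hU (Finset.univ : Finset (Fin 1))
    (f := fun _ _ ↦ r) (χ := fun _ ↦ ψ) (fun _ ↦ contMDiffOn_const) (fun _ ↦ hψ) hx v
  simpa [mvfderiv_const] using h

theorem tensorDeriv_sub (hU : IsOpen U) (hψ : IsSmoothTuple n Fm U ψ)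
    (hφ : IsSmoothTuple n Fm U φ) {x : M} (hx : x ∈ U) :
    tensorDeriv ρ L D e (fun y ↦ ψ y - φ y) x =
      tensorDeriv ρ L D e ψ x - tensorDeriv ρ L D e φ x := by
  have h := tensorDeriv_add (L := L) (e := e) ρ D hU hψ (hφ.const_smul (-1)) hx
  rw [tensorDeriv_const_smul ρ D hU _ hφ hx] at h
  simp only [neg_smul, one_smul, ← sub_eq_add_neg] at h
  rw [h]
  module

theorem tensorDeriv_sum (hU : IsOpen U) {ι : Type*} (s : Finset ι)
    {χ : ι → (x : M) → Fin N → V x} (hχ : ∀ i, IsSmoothTuple n Fm U (χ i)) {x : M} (hx : x ∈ U)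
    (v : TangentSpace (𝓡 n) x) :
    tensorDeriv ρ L D e (fun y ↦ ∑ i ∈ s, χ i y) x v =
      ∑ i ∈ s, tensorDeriv ρ L D e (χ i) x v := by
  simpa [mvfderiv_const] using tensorDeriv_sum_smul (L := L) (e := e) ρ D hU s (f := fun _ _ ↦ 1)
    (fun _ ↦ contMDiffOn_const) hχ hx v

/-- Clifford multiplication is parallel. -/
theorem tensorDeriv_cliffEnd (hL : IsLeviCivita L) (hU : IsOpen U) (he : IsOrthonormalFrameOn e U)
    (hψ : IsSmoothTuple n Fm U ψ) (hY : IsSmoothField U Y) (X : (x : M) → TangentSpace (𝓡 n) x)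
    {x : M} (hx : x ∈ U) :
    tensorDeriv ρ L D e (fun y ↦ cliffEnd V e ρ y (Y y) (ψ y)) x (X x) =
      cliffEnd V e ρ x (L Y x (X x)) (ψ x)
        + cliffEnd V e ρ x (Y x) (tensorDeriv ρ L D e ψ x (X x)) := by
  have hex := he.orthonormal x hx
  have hcomm := (isCliffordFamily_matEnd (V := V) e hex ρ).spin_commutator
    (hL.frame_antisymm hU he X hx)
  rw [tensorDeriv_apply, tensorDeriv_apply, spinEnd_eq_of_orthonormal ρ hex]
  set S := (1 / 4 : ℝ) • ∑ j, ∑ k, (inner ℝ (L (e j) x (X x)) (e k x) : ℝ) •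
      (matEnd (V x) (gammaMat ρ j) * matEnd (V x) (gammaMat ρ k))
  clear_value S
  have hD : D.tupleDeriv (fun y ↦ cliffEnd V e ρ y (Y y) (ψ y)) x (X x) =
      (∑ k, mvfderiv (𝓡 n) (fun y ↦ (inner ℝ (e k y) (Y y) : ℝ)) x (X x) •
        matEnd (V x) (gammaMat ρ k)) (ψ x) + cliffEnd V e ρ x (Y x) (D.tupleDeriv ψ x (X x)) := by
    simp only [cliffEnd_eq_sum, LinearMap.sum_apply, LinearMap.smul_apply]
    rw [D.tupleDeriv_sum_smul hU _ (fun k ↦ contMDiffOn_inner (he.smooth k) hY)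
      (fun k ↦ hψ.matEnd (gammaMat ρ k)) hx, Finset.sum_add_distrib]
    simp only [D.tupleDeriv_matEnd hU hψ _ hx]
  -- Differentiating the components ⟨e_k, Y⟩ gives ⟨∇e_k, Y⟩ + ⟨e_k, ∇Y⟩. The commutator of the spin
  -- term with c(Y) cancels the first part, and the second part is c(∇Y).
  have hS : S * cliffEnd V e ρ x (Y x) + (∑ k,
      mvfderiv (𝓡 n) (fun y ↦ (inner ℝ (e k y) (Y y) : ℝ)) x (X x) • matEnd (V x) (gammaMat ρ k)) =
      cliffEnd V e ρ x (L Y x (X x)) + cliffEnd V e ρ x (Y x) * S := by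
    have h1 : S * cliffEnd V e ρ x (Y x) - cliffEnd V e ρ x (Y x) * S =
        ∑ k, (-inner ℝ (L (e k) x (X x)) (Y x) : ℝ) • matEnd (V x) (gammaMat ρ k) := by
      rw [cliffEnd_eq_sum]
      refine (commutator_sum_smul hcomm fun k ↦ inner ℝ (e k x) (Y x)).trans ?_
      refine Finset.sum_congr rfl fun k _ ↦ ?_
      rw [← hex.sum_inner_mul_inner_tangent (L (e k) x (X x)) (Y x),
        ← Finset.sum_neg_distrib]
      congr 1
      refine Finset.sum_congr rfl fun l _ ↦ ?_
      rw [hL.frame_antisymm hU he X hx, real_inner_comm (e l x)]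
      ring
    rw [sub_eq_iff_eq_add] at h1
    rw [h1, cliffEnd_eq_sum e ρ x (L Y x (X x)), add_right_comm, ← Finset.sum_add_distrib]
    congr 1
    refine Finset.sum_congr rfl fun k _ ↦ ?_
    rw [← add_smul, hL.mvfderiv_inner hU (he.smooth k) hY X hx]
    congr 1
    ring
  have := congrArg (fun T ↦ T (ψ x)) hS
  simp only [LinearMap.add_apply, Module.End.mul_apply] at this
  rw [hD, ← add_assoc, this, map_add]
  abel

end Smooth

end SpinConnection

/-! ### Curvature of the tensor product connection. -/

section SpinCurvature

variable {n N : ℕ} {M : Type*} [TopologicalSpace M] [T2Space M]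
  [ChartedSpace (EuclideanSpace ℝ (Fin n)) M] [IsManifold (𝓡 n) ∞ M]
  [RiemannianBundle (fun x : M ↦ TangentSpace (𝓡 n) x)]
  [IsContMDiffRiemannianBundle (𝓡 n) ∞ (EuclideanSpace ℝ (Fin n))
    (fun x : M ↦ TangentSpace (𝓡 n) x)]
  {𝕜 : Type*} [RCLike 𝕜]
  {Fm : Type*} [NormedAddCommGroup Fm] [NormedSpace 𝕜 Fm] [NormedSpace ℝ Fm]
  [IsScalarTower ℝ 𝕜 Fm] [FiniteDimensional ℝ Fm]
  {V : M → Type*} [∀ x, NormedAddCommGroup (V x)] [∀ x, InnerProductSpace 𝕜 (V x)]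
  [∀ x, NormedSpace ℝ (V x)] [∀ x, IsScalarTower ℝ 𝕜 (V x)]
  [TopologicalSpace (TotalSpace Fm V)] [FiberBundle Fm V]
  [VectorBundle 𝕜 Fm V] [VectorBundle ℝ Fm V] [ContMDiffVectorBundle ∞ Fm V (𝓡 n)]
  {L : CovariantDerivative (𝓡 n) (EuclideanSpace ℝ (Fin n)) (fun x : M ↦ TangentSpace (𝓡 n) x)}
  {e : Fin n → (x : M) → TangentSpace (𝓡 n) x} {U : Set M}
  (ρ : Cl n →ₐ[ℝ] Matrix (Fin N) (Fin N) 𝕜) (D : LinConnection n 𝕜 Fm V)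
  {ψ : (x : M) → Fin N → V x} {X Y : (x : M) → TangentSpace (𝓡 n) x}

variable (V) in
/-- The endomorphism `¼ ∑ j k, ⟨R^L(X, Y) e_j, e_k⟩ c(e_j) c(e_k)` of the fibre. -/
def spinCurvEnd
    (L : CovariantDerivative (𝓡 n) (EuclideanSpace ℝ (Fin n)) (fun x : M ↦ TangentSpace (𝓡 n) x))
    (e : Fin n → (x : M) → TangentSpace (𝓡 n) x) (X Y : (x : M) → TangentSpace (𝓡 n) x) (x : M) :
    Module.End ℝ (Fin N → V x) :=
  (1 / 4 : ℝ) • ∑ j, ∑ k, (inner ℝ (curvatureOp L X Y (e j) x) (e k x) : ℝ) •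
    (matEnd (V x) (gammaMat ρ j) * matEnd (V x) (gammaMat ρ k))

theorem smul_sum_sub_smul {A ι : Type*} [AddCommGroup A] [Module ℝ A] [Fintype ι] (r : ℝ)
    (α β : ι → ι → ℝ) (g : ι → ι → A) :
    r • ∑ j, ∑ k, (α j k - β j k) • g j k =
      r • ∑ j, ∑ k, α j k • g j k - r • ∑ j, ∑ k, β j k • g j k := by
  simp only [sub_smul, Finset.sum_sub_distrib, smul_sub]

/-- Cartan's structure equation dω + ω ∧ ω = Ω in the spin representation. Metric compatibility
expands X⟨∇_Y e_j, e_k⟩ into a second derivative and ⟨∇_Y e_j, ∇_X e_k⟩; the latter products cancel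
against the commutator after expansion in the orthonormal frame. -/
theorem spinEnd_commutator (hL : IsLeviCivita L) (hU : IsOpen U) (he : IsOrthonormalFrameOn e U)
    (hX : IsSmoothField U X) (hY : IsSmoothField U Y) {x : M} (hx : x ∈ U) :
    spinEnd V ρ L e x (X x) * spinEnd V ρ L e x (Y x)
      - spinEnd V ρ L e x (Y x) * spinEnd V ρ L e x (X x)
      + (1 / 4 : ℝ) • ∑ j, ∑ k,
        (mvfderiv (𝓡 n) (fun y ↦ (inner ℝ (L (e j) y (Y y)) (e k y) : ℝ)) x (X x)
        - mvfderiv (𝓡 n) (fun y ↦ (inner ℝ (L (e j) y (X y)) (e k y) : ℝ)) x (Y x)) •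
        (matEnd (V x) (gammaMat ρ j) * matEnd (V x) (gammaMat ρ k))
      - spinEnd V ρ L e x (VectorField.mlieBracket (𝓡 n) X Y x) = spinCurvEnd V ρ L e X Y x := by
  have hex := he.orthonormal x hx
  have hc := (isCliffordFamily_matEnd (V := V) e hex ρ).spin_commutator_spin
    (hL.frame_antisymm hU he X hx) (hL.frame_antisymm hU he Y hx)
  rw [spinEnd_eq_of_orthonormal ρ hex, spinEnd_eq_of_orthonormal ρ hex,
    spinEnd_eq_of_orthonormal ρ hex, spinCurvEnd, hc]
  rw [← smul_add, ← smul_sub]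
  congr 1
  simp only [← Finset.sum_add_distrib, ← Finset.sum_sub_distrib, ← add_smul, ← sub_smul]
  refine Finset.sum_congr rfl fun j _ ↦ Finset.sum_congr rfl fun k _ ↦ ?_
  congr 1
  have hXj := hL.contMDiffOn_apply hU hX (he.smooth j)
  have hYj := hL.contMDiffOn_apply hU hY (he.smooth j)
  rw [hL.mvfderiv_inner hU hYj (he.smooth k) X hx, hL.mvfderiv_inner hU hXj (he.smooth k) Y hx,
    ← hex.sum_inner_mul_inner_tangent (L (e j) x (Y x)),
    ← hex.sum_inner_mul_inner_tangent (L (e j) x (X x))]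
  have hR : (inner ℝ (curvatureOp L X Y (e j) x) (e k x) : ℝ) =
      inner ℝ (L (fun y ↦ L (e j) y (Y y)) x (X x)) (e k x)
        - inner ℝ (L (fun y ↦ L (e j) y (X y)) x (Y x)) (e k x)
        - inner ℝ (L (e j) x (VectorField.mlieBracket (𝓡 n) X Y x)) (e k x) := by
    rw [curvatureOp, inner_sub_left, inner_sub_left]
  rw [hR, Finset.sum_sub_distrib]
  have c1 : ∀ v w : TangentSpace (𝓡 n) x, ∑ l, (inner ℝ v (e l x) : ℝ) * inner ℝ w (e l x) =
      ∑ l, (inner ℝ (e l x) v : ℝ) * inner ℝ (e l x) w := fun v w ↦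
    Finset.sum_congr rfl fun l _ ↦ by rw [real_inner_comm, real_inner_comm w]
  rw [c1, c1]
  ring

/-- The two cross terms between spin part and derivative of components are together symmetric in X
and Y. Antisymmetrising therefore separates the spin curvature from the curvature of `D`. -/
theorem tensorDeriv_tensorDeriv (hL : IsLeviCivita L) (hU : IsOpen U)
    (he : IsOrthonormalFrameOn e U) (hψ : IsSmoothTuple n Fm U ψ)
    (hY : IsSmoothField U Y) (X : (x : M) → TangentSpace (𝓡 n) x) {x : M} (hx : x ∈ U) :
    tensorDeriv ρ L D e (fun y ↦ tensorDeriv ρ L D e ψ y (Y y)) x (X x) =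
      spinEnd V ρ L e x (X x) (spinEnd V ρ L e x (Y x) (ψ x))
      + spinEnd V ρ L e x (X x) (D.tupleDeriv ψ x (Y x))
      + spinEnd V ρ L e x (Y x) (D.tupleDeriv ψ x (X x))
      + ((1 / 4 : ℝ) • ∑ j, ∑ k,
        (mvfderiv (𝓡 n) (fun y ↦ (inner ℝ (L (e j) y (Y y)) (e k y) : ℝ)) x (X x)) •
        (matEnd (V x) (gammaMat ρ j) * matEnd (V x) (gammaMat ρ k))) (ψ x)
      + D.tupleDeriv (fun y ↦ D.tupleDeriv ψ y (Y y)) x (X x) := by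
  have hex := he.orthonormal x hx
  have hf : ∀ p : Fin n × Fin n, ContMDiffOn (𝓡 n) 𝓘(ℝ, ℝ) ∞
      (fun y ↦ (inner ℝ (L (e p.1) y (Y y)) (e p.2 y) : ℝ)) U := fun p ↦
    contMDiffOn_inner (hL.contMDiffOn_apply hU hY (he.smooth p.1)) (he.smooth p.2)
  -- The factor 1/4 and both generators are merged into one constant matrix per index pair, so a
  -- single application of the Leibniz rule covers the double sum.
  have hm := fun p : Fin n × Fin n ↦
    hψ.matEnd ((1 / 4 : ℝ) • (gammaMat ρ p.1 * gammaMat ρ p.2))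
  have hspin : ∀ y ∈ U, tensorDeriv ρ L D e ψ y (Y y) =
      (∑ p : Fin n × Fin n, (inner ℝ (L (e p.1) y (Y y)) (e p.2 y) : ℝ) •
        matEnd (V y) ((1 / 4 : ℝ) • (gammaMat ρ p.1 * gammaMat ρ p.2)) (ψ y))
      + D.tupleDeriv ψ y (Y y) := by
    intro y hy
    rw [tensorDeriv_apply, spinEnd_eq_of_orthonormal ρ (he.orthonormal y hy)]
    congr 1
    simp only [LinearMap.smul_apply, LinearMap.sum_apply, Fintype.sum_prod_type, map_smul, map_mul,
      Finset.smul_sum, Module.End.mul_apply]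
    refine Finset.sum_congr rfl fun j _ ↦ Finset.sum_congr rfl fun k _ ↦ ?_
    rw [smul_comm]
  have hsum := IsSmoothTuple.sum_smul (Finset.univ) hf hm
  have h2 := hψ.tupleDeriv D hU hY
  rw [tensorDeriv_apply,
    D.tupleDeriv_congr hU (hψ.tensorDeriv ρ D hL hU he hY) hspin hx,
    D.tupleDeriv_add hU hsum h2 hx, LinearMap.add_apply, D.tupleDeriv_sum_smul hU _ hf hm hx,
    tensorDeriv_apply, map_add, Finset.sum_add_distrib]
  have e1 : ∑ p : Fin n × Fin n,
      mvfderiv (𝓡 n) (fun y ↦ (inner ℝ (L (e p.1) y (Y y)) (e p.2 y) : ℝ)) x (X x) •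
        matEnd (V x) ((1 / 4 : ℝ) • (gammaMat ρ p.1 * gammaMat ρ p.2)) (ψ x) =
      ((1 / 4 : ℝ) • ∑ j, ∑ k,
        (mvfderiv (𝓡 n) (fun y ↦ (inner ℝ (L (e j) y (Y y)) (e k y) : ℝ)) x (X x)) •
        (matEnd (V x) (gammaMat ρ j) * matEnd (V x) (gammaMat ρ k))) (ψ x) := by
    simp only [LinearMap.smul_apply, LinearMap.sum_apply, Fintype.sum_prod_type, map_smul, map_mul,
      Finset.smul_sum, Module.End.mul_apply]
    refine Finset.sum_congr rfl fun j _ ↦ Finset.sum_congr rfl fun k _ ↦ ?_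
    rw [smul_comm]
  have e2 : ∑ p : Fin n × Fin n, (inner ℝ (L (e p.1) x (Y x)) (e p.2 x) : ℝ) •
      D.tupleDeriv (fun y ↦ matEnd (V y) ((1 / 4 : ℝ) • (gammaMat ρ p.1 * gammaMat ρ p.2)) (ψ y))
        x (X x) = spinEnd V ρ L e x (Y x) (D.tupleDeriv ψ x (X x)) := by
    simp only [D.tupleDeriv_matEnd hU hψ _ hx]
    rw [spinEnd_eq_of_orthonormal ρ hex]
    simp only [LinearMap.smul_apply, LinearMap.sum_apply, Fintype.sum_prod_type, map_smul, map_mul,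
      Finset.smul_sum, Module.End.mul_apply]
    refine Finset.sum_congr rfl fun j _ ↦ Finset.sum_congr rfl fun k _ ↦ ?_
    rw [smul_comm]
  rw [e1, e2]
  abel

/-- The curvature of the connection on `S(TM) ⊗ V`. -/
theorem tensorDeriv_curvature (hL : IsLeviCivita L) (hU : IsOpen U)
    (he : IsOrthonormalFrameOn e U) (hψ : IsSmoothTuple n Fm U ψ)
    (hX : IsSmoothField U X) (hY : IsSmoothField U Y) {x : M} (hx : x ∈ U) :
    tensorDeriv ρ L D e (fun y ↦ tensorDeriv ρ L D e ψ y (Y y)) x (X x)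
      - tensorDeriv ρ L D e (fun y ↦ tensorDeriv ρ L D e ψ y (X y)) x (Y x)
      - tensorDeriv ρ L D e ψ x (VectorField.mlieBracket (𝓡 n) X Y x) =
      spinCurvEnd V ρ L e X Y x (ψ x) + curvatureAct D X Y ψ x := by
  rw [← spinEnd_commutator ρ hL hU he hX hY hx, tensorDeriv_tensorDeriv ρ D hL hU he hψ hY X hx,
    tensorDeriv_tensorDeriv ρ D hL hU he hψ hX Y hx]
  have hR : curvatureAct D X Y ψ x = D.tupleDeriv (fun y ↦ D.tupleDeriv ψ y (Y y)) x (X x)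
      - D.tupleDeriv (fun y ↦ D.tupleDeriv ψ y (X y)) x (Y x)
      - D.tupleDeriv ψ x (VectorField.mlieBracket (𝓡 n) X Y x) := rfl
  rw [hR, tensorDeriv_apply]
  have hs := congrArg (fun T ↦ T (ψ x)) (smul_sum_sub_smul (1 / 4 : ℝ)
    (fun j k ↦ mvfderiv (𝓡 n) (fun y ↦ (inner ℝ (L (e j) y (Y y)) (e k y) : ℝ)) x (X x))
    (fun j k ↦ mvfderiv (𝓡 n) (fun y ↦ (inner ℝ (L (e j) y (X y)) (e k y) : ℝ)) x (Y x))
    (fun j k ↦ matEnd (V x) (gammaMat ρ j) * matEnd (V x) (gammaMat ρ k)))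
  simp only [LinearMap.sub_apply, LinearMap.add_apply, Module.End.mul_apply] at hs ⊢
  rw [hs]
  abel

end SpinCurvature

/-! ### Self-adjointness of Φ. -/

section NonMetricPart

variable {n N : ℕ} {M : Type*} [TopologicalSpace M] [ChartedSpace (EuclideanSpace ℝ (Fin n)) M]
  [IsManifold (𝓡 n) ∞ M]
  {𝕜 : Type*} [RCLike 𝕜]
  {Fm : Type*} [NormedAddCommGroup Fm] [NormedSpace 𝕜 Fm] [NormedSpace ℝ Fm]
  [IsScalarTower ℝ 𝕜 Fm] [FiniteDimensional ℝ Fm]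
  {V : M → Type*} [∀ x, NormedAddCommGroup (V x)] [∀ x, InnerProductSpace 𝕜 (V x)]
  [∀ x, NormedSpace ℝ (V x)] [∀ x, IsScalarTower ℝ 𝕜 (V x)]
  [TopologicalSpace (TotalSpace Fm V)] [FiberBundle Fm V]
  [VectorBundle 𝕜 Fm V] [VectorBundle ℝ Fm V] [ContMDiffVectorBundle ∞ Fm V (𝓡 n)]
  {D D' : LinConnection n 𝕜 Fm V}

theorem mvfderiv_conj {f : M → 𝕜} {x : M} (hf : MDifferentiableAt (𝓡 n) 𝓘(ℝ, 𝕜) f x)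
    (v : TangentSpace (𝓡 n) x) :
    mvfderiv (𝓡 n) (fun y ↦ (starRingEnd 𝕜) (f y)) x v =
      (starRingEnd 𝕜) (mvfderiv (𝓡 n) f x v) := by
  have h1 : HasMFDerivAt 𝓘(ℝ, 𝕜) 𝓘(ℝ, 𝕜) (RCLike.conjCLE (K := 𝕜)) (f x)
      (RCLike.conjCLE (K := 𝕜)).toContinuousLinearMap :=
    ((RCLike.conjCLE (K := 𝕜)).toContinuousLinearMap.hasFDerivAt).hasMFDerivAt
  have h2 := (h1.comp x hf.hasMFDerivAt).mfderiv
  exact congrArg (fun T ↦ T v) h2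

set_option synthInstance.maxHeartbeats 400000 in
theorem halfDifference_apply (D D' : LinConnection n 𝕜 Fm V) {σ : (x : M) → V x} {x : M}
    (hσ : MDifferentiableAt (𝓡 n) ((𝓡 n).prod 𝓘(ℝ, Fm)) (T% σ) x) (v : TangentSpace (𝓡 n) x) :
    halfDifference D D' x v (σ x) = (1 / 2 : ℝ) • (D.toFun σ x v - D'.toFun σ x v) := by
  have e := IsCovariantDerivativeOn.difference_apply D.isCovariantDerivativeOnUniv
    D'.isCovariantDerivativeOnUniv (x := x) trivial hσ
  change (1 / 2 : ℝ) • (D.isCovariantDerivativeOnUniv.difference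
        D'.isCovariantDerivativeOnUniv x (σ x) v) = _
  rw [e]
  rfl

/-- The duality identity for (σ, τ) and the conjugate of the one for (τ, σ) compute the same
derivative of ⟨σ, τ⟩; their difference is the claim for extensions of `u` and `w`. Consequently
c(Φ*) = c(Φ). -/
theorem inner_halfDifference (hg : IsSmoothFibreMetric n 𝕜 Fm V) (hD : IsDualConnection D D')
    (x : M) (v : TangentSpace (𝓡 n) x) (u w : V x) :
    inner 𝕜 (halfDifference D D' x v u) w = inner 𝕜 u (halfDifference D D' x v w) := by
  have hu := FiberBundle.mdifferentiableAt_extend (𝓡 n) Fm u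
  have hw := FiberBundle.mdifferentiableAt_extend (𝓡 n) Fm w
  have e1 := halfDifference_apply D D' hu v
  have e2 := halfDifference_apply D D' hw v
  have h1 := hD _ _ x hu hw v
  have h2 := hD _ _ x hw hu v
  have hd := (hg _ _ x (FiberBundle.contMDiffAt_extend (𝓡 n) Fm w (k := ∞))
    (FiberBundle.contMDiffAt_extend (𝓡 n) Fm u (k := ∞))).mdifferentiableAt (by simp)
  have h3 := mvfderiv_conj hd v
  simp only [inner_conj_symm] at h3
  rw [h1, h2, map_add, inner_conj_symm, inner_conj_symm] at h3
  simp only [FiberBundle.extend_apply_self] at e1 e2 h3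
  rw [e1, e2, ← algebraMap_smul 𝕜 (1 / 2 : ℝ), ← algebraMap_smul 𝕜 (1 / 2 : ℝ) (D.toFun _ x v - _),
    inner_smul_left, inner_smul_right, inner_sub_left, inner_sub_right]
  congr 1
  · simp
  · linear_combination h3

theorem fibreAdjoint_halfDifference (hg : IsSmoothFibreMetric n 𝕜 Fm V)
    (hD : IsDualConnection D D') (x : M) (v : TangentSpace (𝓡 n) x) :
    fibreAdjoint 𝕜 Fm (halfDifference D D' x v) = halfDifference D D' x v := by
  have : FiniteDimensional 𝕜 Fm := FiniteDimensional.right ℝ 𝕜 Fm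
  have : FiniteDimensional 𝕜 (V x) := VectorBundle.finiteDimensional 𝕜 Fm V x
  refine ((LinearMap.eq_adjoint_iff _ _).2 fun u w ↦ ?_).symm
  exact inner_halfDifference hg hD x v u w

theorem midConnection_tupleDeriv (D D' : LinConnection n 𝕜 Fm V) (ψ : (x : M) → Fin N → V x)
    (x : M) (v : TangentSpace (𝓡 n) x) :
    (midConnection D D').tupleDeriv ψ x v =
      (1 / 2 : ℝ) • (D.tupleDeriv ψ x v + D'.tupleDeriv ψ x v) := rfl

theorem tupleEnd_halfDifference (D D' : LinConnection n 𝕜 Fm V) {U : Set M} (hU : IsOpen U)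
    {ψ : (x : M) → Fin N → V x} (hψ : IsSmoothTuple n Fm U ψ) {x : M} (hx : x ∈ U)
    (v : TangentSpace (𝓡 n) x) :
    tupleEnd (halfDifference D D' x v) (ψ x) =
      (1 / 2 : ℝ) • (D.tupleDeriv ψ x v - D'.tupleDeriv ψ x v) :=
  funext fun A ↦ halfDifference_apply D D' ((hψ A).mdifferentiableAt_section hU hx) v

theorem tupleDeriv_eq_mid_add (D D' : LinConnection n 𝕜 Fm V) {U : Set M} (hU : IsOpen U)
    {ψ : (x : M) → Fin N → V x} (hψ : IsSmoothTuple n Fm U ψ) {x : M} (hx : x ∈ U)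
    (v : TangentSpace (𝓡 n) x) :
    D.tupleDeriv ψ x v = (midConnection D D').tupleDeriv ψ x v
      + tupleEnd (halfDifference D D' x v) (ψ x) := by
  rw [tupleEnd_halfDifference D D' hU hψ hx, midConnection_tupleDeriv]
  module

end NonMetricPart

/-! ### The endomorphism c(Φ) and the twisting curvature. -/

section CliffordForm

variable {n N : ℕ} {M : Type*} [TopologicalSpace M] [T2Space M]
  [ChartedSpace (EuclideanSpace ℝ (Fin n)) M] [IsManifold (𝓡 n) ∞ M]
  [RiemannianBundle (fun x : M ↦ TangentSpace (𝓡 n) x)]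
  [IsContMDiffRiemannianBundle (𝓡 n) ∞ (EuclideanSpace ℝ (Fin n))
    (fun x : M ↦ TangentSpace (𝓡 n) x)]
  {𝕜 : Type*} [RCLike 𝕜]
  {Fm : Type*} [NormedAddCommGroup Fm] [NormedSpace 𝕜 Fm] [NormedSpace ℝ Fm]
  [IsScalarTower ℝ 𝕜 Fm] [FiniteDimensional ℝ Fm]
  {V : M → Type*} [∀ x, NormedAddCommGroup (V x)] [∀ x, InnerProductSpace 𝕜 (V x)]
  [∀ x, NormedSpace ℝ (V x)] [∀ x, IsScalarTower ℝ 𝕜 (V x)]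
  [TopologicalSpace (TotalSpace Fm V)] [FiberBundle Fm V]
  [VectorBundle 𝕜 Fm V] [VectorBundle ℝ Fm V] [ContMDiffVectorBundle ∞ Fm V (𝓡 n)]
  {L : CovariantDerivative (𝓡 n) (EuclideanSpace ℝ (Fin n)) (fun x : M ↦ TangentSpace (𝓡 n) x)}
  {e ε : Fin n → (x : M) → TangentSpace (𝓡 n) x} {U : Set M}
  (ρ : Cl n →ₐ[ℝ] Matrix (Fin N) (Fin N) 𝕜) (D D' : LinConnection n 𝕜 Fm V)
  {ψ : (x : M) → Fin N → V x}

/-- The endomorphism `c(Φ)` of the fibre of `S(TM) ⊗ V` at `x`. -/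
def cPhiEnd (e ε : Fin n → (x : M) → TangentSpace (𝓡 n) x) (x : M) :
    Module.End ℝ (Fin N → V x) :=
  ∑ i, cliffEnd V e ρ x (ε i x) * tupleEnd (halfDifference D D' x (ε i x))

theorem cPhi_apply (ψ : (x : M) → Fin N → V x) (x : M) :
    cPhi ρ D D' e ε ψ x = cPhiEnd ρ D D' e ε x (ψ x) := by
  simp only [cPhi, cliffForm, cPhiEnd, LinearMap.sum_apply, Module.End.mul_apply, cliffMul_apply]
  rfl

variable {D D'} in
theorem cPhiStar_apply (hg : IsSmoothFibreMetric n 𝕜 Fm V) (hD : IsDualConnection D D')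
    (ψ : (x : M) → Fin N → V x) (x : M) :
    cPhiStar ρ D D' e ε ψ x = cPhiEnd ρ D D' e ε x (ψ x) := by
  rw [← cPhi_apply, cPhiStar, cPhi]
  simp only [fibreAdjoint_halfDifference hg hD]

/-- Smoothness of Φ as a tensor is bypassed: on a smooth tuple, Φ(v) acts as half the difference of
two smooth covariant derivatives. -/
theorem IsSmoothTuple.cPhiEnd (hψ : IsSmoothTuple n Fm U ψ) (hU : IsOpen U)
    (he : IsOrthonormalFrameOn e U) (hε : IsOrthonormalFrameOn ε U) :
    IsSmoothTuple n Fm U (fun y ↦ cPhiEnd ρ D D' e ε y (ψ y)) := by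
  have h : ∀ i, IsSmoothTuple n Fm U (fun y ↦ _root_.cliffEnd V e ρ y (ε i y)
      ((1 / 2 : ℝ) • (D.tupleDeriv ψ y (ε i y) + (-1 : ℝ) • D'.tupleDeriv ψ y (ε i y)))) := fun i ↦
    (((hψ.tupleDeriv D hU (hε.smooth i)).add
      ((hψ.tupleDeriv D' hU (hε.smooth i)).const_smul (-1))).const_smul (1 / 2)).cliffEnd ρ he
      (hε.smooth i)
  refine (IsSmoothTuple.sum Finset.univ h).congr fun y hy ↦ ?_
  simp only [_root_.cPhiEnd, LinearMap.sum_apply, Module.End.mul_apply,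
    tupleEnd_halfDifference D D' hU hψ hy]
  simp only [neg_smul, one_smul, sub_eq_add_neg]

theorem diracOp_apply (ψ : (x : M) → Fin N → V x) (x : M) :
    diracOp ρ L D e ε ψ x = ∑ i, cliffEnd V e ρ x (ε i x) (tensorDeriv ρ L D e ψ x (ε i x)) := by
  simp only [diracOp, cliffMul_apply, tensorConn_apply]

theorem diracOp_eq_mid_add (hU : IsOpen U) (hψ : IsSmoothTuple n Fm U ψ) {x : M} (hx : x ∈ U) :
    diracOp ρ L D e ε ψ x =
      (∑ i, cliffEnd V e ρ x (ε i x) (tensorDeriv ρ L (midConnection D D') e ψ x (ε i x)))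
        + cPhiEnd ρ D D' e ε x (ψ x) := by
  rw [diracOp_apply, cPhiEnd, LinearMap.sum_apply, ← Finset.sum_add_distrib]
  refine Finset.sum_congr rfl fun i _ ↦ ?_
  rw [Module.End.mul_apply, ← map_add, tensorDeriv_apply, tensorDeriv_apply,
    tupleDeriv_eq_mid_add D D' hU hψ hx, add_assoc]

theorem curvatureAct_eq_tupleDeriv (X Y : (x : M) → TangentSpace (𝓡 n) x)
    (ψ : (x : M) → Fin N → V x) (x : M) :
    curvatureAct D X Y ψ x = D.tupleDeriv (fun y ↦ D.tupleDeriv ψ y (Y y)) x (X x)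
      - D.tupleDeriv (fun y ↦ D.tupleDeriv ψ y (X y)) x (Y x)
      - D.tupleDeriv ψ x (VectorField.mlieBracket (𝓡 n) X Y x) := rfl

theorem curvatureAct_matEnd (hU : IsOpen U) (hψ : IsSmoothTuple n Fm U ψ)
    {X Y : (x : M) → TangentSpace (𝓡 n) x} (hX : IsSmoothField U X) (hY : IsSmoothField U Y)
    (m : Matrix (Fin N) (Fin N) 𝕜) {x : M} (hx : x ∈ U) :
    curvatureAct D X Y (fun y ↦ matEnd (V y) m (ψ y)) x =
      matEnd (V x) m (curvatureAct D X Y ψ x) := by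
  have h : ∀ {Z : (x : M) → TangentSpace (𝓡 n) x}, IsSmoothField U Z →
      D.tupleDeriv (fun y ↦ D.tupleDeriv (fun y ↦ matEnd (V y) m (ψ y)) y (Z y)) x =
      D.tupleDeriv (fun y ↦ matEnd (V y) m (D.tupleDeriv ψ y (Z y))) x := fun hZ ↦
    D.tupleDeriv_congr hU ((hψ.matEnd m).tupleDeriv D hU hZ)
      (fun y hy ↦ D.tupleDeriv_matEnd hU hψ m hy _) hx
  rw [curvatureAct_eq_tupleDeriv, curvatureAct_eq_tupleDeriv, h hX, h hY,
    D.tupleDeriv_matEnd hU (hψ.tupleDeriv D hU hX) m hx,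
    D.tupleDeriv_matEnd hU (hψ.tupleDeriv D hU hY) m hx, D.tupleDeriv_matEnd hU hψ m hx,
    map_sub, map_sub]

/-- Clifford multiplication by Z is a combination of constant matrices with coefficients ⟨e_k, Z⟩.
The coefficients pass through the curvature by tensoriality, the matrices by 𝕜-linearity. -/
theorem curvatureAct_cliffEnd (hU : IsOpen U) (he : IsOrthonormalFrameOn e U)
    (hψ : IsSmoothTuple n Fm U ψ) {X Y Z : (x : M) → TangentSpace (𝓡 n) x}
    (hX : IsSmoothField U X) (hY : IsSmoothField U Y) (hZ : IsSmoothField U Z) {x : M}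
    (hx : x ∈ U) :
    curvatureAct D X Y (fun y ↦ cliffEnd V e ρ y (Z y) (ψ y)) x =
      cliffEnd V e ρ x (Z x) (curvatureAct D X Y ψ x) := by
  simp only [cliffEnd_eq_sum, LinearMap.sum_apply, LinearMap.smul_apply]
  simp only [← curvatureAct_matEnd D hU hψ hX hY _ hx]
  funext A
  have h := curvatureOp_sum_smul D.toCovariantDerivative D.smooth hU hX hY Finset.univ
    (fun k ↦ contMDiffOn_inner (he.smooth k) hZ) (fun k ↦ hψ.matEnd (gammaMat ρ k) A) hx
  simp only [Finset.sum_apply, Pi.smul_apply]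
  refine Eq.trans ?_ h
  simp only [curvatureAct, Finset.sum_apply, Pi.smul_apply]

end CliffordForm

/-! ### Clifford contractions of double sums. -/

section CliffordSums

variable {A ι : Type*} [Ring A] [Algebra ℝ A] [Fintype ι]

theorem sum_bilinear_smul_mul (Q : ι → ι → ℝ) (R : ι → ι → ℝ) (γ : ι → A) :
    ∑ j, ∑ k, (∑ p, ∑ q, Q p j * (Q q k * R p q)) • (γ j * γ k) =
      ∑ p, ∑ q, R p q • ((∑ j, Q p j • γ j) * ∑ k, Q q k • γ k) := by
  simp only [Finset.sum_mul, Finset.mul_sum, Finset.smul_sum, Finset.sum_smul, smul_mul_assoc,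
    mul_smul_comm, smul_smul]
  have h : ∀ j, (∑ k, ∑ p, ∑ q, (Q p j * (Q q k * R p q)) • (γ j * γ k)) =
      ∑ p, ∑ q, ∑ k, (Q p j * (Q q k * R p q)) • (γ j * γ k) := fun j ↦
    Finset.sum_comm.trans (Finset.sum_congr rfl fun p _ ↦ Finset.sum_comm)
  simp only [h]
  refine Finset.sum_comm.trans (Finset.sum_congr rfl fun p _ ↦ ?_)
  refine Finset.sum_comm.trans (Finset.sum_congr rfl fun q _ ↦ ?_)
  rw [Finset.sum_comm]
  refine Finset.sum_congr rfl fun j _ ↦ Finset.sum_congr rfl fun k _ ↦ ?_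
  congr 1
  ring

variable [DecidableEq ι] {E : Type*} [AddCommGroup E] [Module ℝ E]

/-- Exchanging i and k and adding, the Clifford relation leaves only the diagonal; the rest sees
just the antisymmetric part of `H`. For a second covariant derivative that part is curvature, since
the torsion vanishes. -/
theorem IsCliffordFamily.sum_mul_apply {c : ι → Module.End ℝ E} (hc : IsCliffordFamily c)
    (H : ι → ι → E) :
    ∑ i, ∑ k, c i (c k (H i k)) =
      -∑ k, H k k + (1 / 2 : ℝ) • ∑ i, ∑ k, c i (c k (H i k - H k i)) := by
  have h1 : ∀ i k, c i (c k (H i k)) + c k (c i (H i k)) =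
      (if i = k then (-2 : ℝ) else 0) • H i k := fun i k ↦
    congrArg (fun T ↦ T (H i k)) (hc i k)
  have h2 : ∑ i, ∑ k, (c i (c k (H i k)) + c k (c i (H i k))) = (-2 : ℝ) • ∑ k, H k k := by
    simp only [h1, ite_smul, zero_smul, Finset.sum_ite_eq, Finset.mem_univ, if_true,
      Finset.smul_sum]
  have h3 : ∑ i, ∑ k, c k (c i (H i k)) = ∑ i, ∑ k, c i (c k (H k i)) := Finset.sum_comm
  simp only [Finset.sum_add_distrib] at h2
  rw [h3] at h2
  simp only [map_sub, Finset.sum_sub_distrib]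
  set S := ∑ i, ∑ k, c i (c k (H i k))
  set S' := ∑ i, ∑ k, c i (c k (H k i))
  have h4 : S' = (-2 : ℝ) • ∑ k, H k k - S := by rw [← h2]; abel
  rw [h4]
  module

/-- The constant of the scalar curvature term arises here: 1/2 from the antisymmetrisation, 1/4 from
the spin lift and 2 from `curvature_contraction` multiply to 1/4. -/
theorem IsCliffordFamily.half_sum_curvature {c : ι → Module.End ℝ E} (hc : IsCliffordFamily c)
    {R : ι → ι → ι → ι → ℝ}
    (h12 : ∀ i j k l, R i j k l = -R j i k l) (h34 : ∀ i j k l, R i j k l = -R i j l k)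
    (hB : ∀ i j k l, R i j k l + R j k i l + R k i j l = 0) {K : ι → ι → Module.End ℝ E}
    (hK : ∀ i j, K i j = (1 / 4 : ℝ) • ∑ k, ∑ l, R i j k l • (c k * c l)) (u : E) :
    (1 / 2 : ℝ) • ∑ i, ∑ j, c i (c j (K i j u)) = (1 / 4 : ℝ) • (∑ i, ∑ j, R i j j i) • u := by
  have h := congrArg (fun T ↦ T u) (hc.curvature_contraction h12 h34 hB)
  simp only [LinearMap.sum_apply, LinearMap.smul_apply, Module.End.mul_apply,
    Module.End.one_apply] at h
  have h' : ∑ i, ∑ j, c i (c j (K i j u)) =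
      (1 / 4 : ℝ) • ∑ i, ∑ j, ∑ k, ∑ l, R i j k l • c i (c j (c k (c l u))) := by
    simp only [hK, LinearMap.sum_apply, LinearMap.smul_apply, Module.End.mul_apply, map_sum,
      map_smul, Finset.smul_sum]
  rw [h', h]
  module

end CliffordSums

/-! ### The Lichnerowicz formula for a connection on the auxiliary bundle. -/

section Lichnerowicz


variable {n N : ℕ} {M : Type*} [TopologicalSpace M] [T2Space M]
  [ChartedSpace (EuclideanSpace ℝ (Fin n)) M] [IsManifold (𝓡 n) ∞ M]
  [RiemannianBundle (fun x : M ↦ TangentSpace (𝓡 n) x)]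
  [IsContMDiffRiemannianBundle (𝓡 n) ∞ (EuclideanSpace ℝ (Fin n))
    (fun x : M ↦ TangentSpace (𝓡 n) x)]
  {𝕜 : Type*} [RCLike 𝕜]
  {Fm : Type*} [NormedAddCommGroup Fm] [NormedSpace 𝕜 Fm] [NormedSpace ℝ Fm]
  [IsScalarTower ℝ 𝕜 Fm] [FiniteDimensional ℝ Fm]
  {V : M → Type*} [∀ x, NormedAddCommGroup (V x)] [∀ x, InnerProductSpace 𝕜 (V x)]
  [∀ x, NormedSpace ℝ (V x)] [∀ x, IsScalarTower ℝ 𝕜 (V x)]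
  [TopologicalSpace (TotalSpace Fm V)] [FiberBundle Fm V]
  [VectorBundle 𝕜 Fm V] [VectorBundle ℝ Fm V] [ContMDiffVectorBundle ∞ Fm V (𝓡 n)]
  {L : CovariantDerivative (𝓡 n) (EuclideanSpace ℝ (Fin n)) (fun x : M ↦ TangentSpace (𝓡 n) x)}
  {e ε : Fin n → (x : M) → TangentSpace (𝓡 n) x} {U : Set M}
  (ρ : Cl n →ₐ[ℝ] Matrix (Fin N) (Fin N) 𝕜) (D D' : LinConnection n 𝕜 Fm V)
  {ψ : (x : M) → Fin N → V x}


  {X Y : (x : M) → TangentSpace (𝓡 n) x}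

theorem curvatureOp_congr
    (D : CovariantDerivative (𝓡 n) (EuclideanSpace ℝ (Fin n)) (fun x : M ↦ TangentSpace (𝓡 n) x))
    (hD : D.ContMDiffCovariantDerivative ∞) (hU : IsOpen U) (hX : IsSmoothField U X)
    (hY : IsSmoothField U Y) {σ τ : (x : M) → TangentSpace (𝓡 n) x} (hσ : IsSmoothField U σ)
    (h : ∀ y ∈ U, σ y = τ y) {x : M} (hx : x ∈ U) :
    curvatureOp D X Y σ x = curvatureOp D X Y τ x := by
  have h0 : ∀ y ∈ U, D σ y = D τ y := fun y hy ↦ D.congr_of_isOpen hU hσ h hy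
  simp only [curvatureOp]
  rw [h0 x hx, D.congr_of_isOpen hU (D.contMDiffOn_apply hD hU hσ hX)
    (fun y hy ↦ by rw [h0 y hy]) hx, D.congr_of_isOpen hU (D.contMDiffOn_apply hD hU hσ hY)
    (fun y hy ↦ by rw [h0 y hy]) hx]

theorem inner_curvatureOp_expand (hL : IsLeviCivita L) (hU : IsOpen U)
    (he : IsOrthonormalFrameOn e U) (hε : IsOrthonormalFrameOn ε U) (hX : IsSmoothField U X)
    (hY : IsSmoothField U Y) {x : M} (hx : x ∈ U) (j k : Fin n) :
    (inner ℝ (curvatureOp L X Y (e j) x) (e k x) : ℝ) =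
      ∑ p, ∑ q, inner ℝ (e j x) (ε p x) *
        (inner ℝ (e k x) (ε q x) * inner ℝ (curvatureOp L X Y (ε p) x) (ε q x)) := by
  have h1 : curvatureOp L X Y (e j) x =
      ∑ p, (inner ℝ (ε p x) (e j x) : ℝ) • curvatureOp L X Y (ε p) x := by
    have h2 := curvatureOp_sum_smul L hL.smooth hU hX hY Finset.univ
      (fun p ↦ contMDiffOn_inner (hε.smooth p) (he.smooth j)) hε.smooth hx
    rw [← h2]
    exact curvatureOp_congr L hL.smooth hU hX hY (he.smooth j)
      (fun y hy ↦ ((hε.orthonormal y hy).sum_inner_smul (e j y)).symm) hx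
  rw [h1, sum_inner]
  refine Finset.sum_congr rfl fun p _ ↦ ?_
  rw [real_inner_smul_left, ← (hε.orthonormal x hx).sum_inner_mul_inner_tangent _ (e k x),
    ← Finset.mul_sum, real_inner_comm (e j x)]
  congr 1
  refine Finset.sum_congr rfl fun q _ ↦ ?_
  rw [real_inner_comm (e k x), real_inner_comm (curvatureOp L X Y (ε p) x) (ε q x)]
  ring

/-- The spin curvature arises in the gauge frame, but the contraction needs all four indices of the
Riemann tensor in the same frame `ε`. Tensoriality in the differentiated field makes the change of
frame possible. -/
theorem spinCurvEnd_eq (hL : IsLeviCivita L) (hU : IsOpen U)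
    (he : IsOrthonormalFrameOn e U) (hε : IsOrthonormalFrameOn ε U) (hX : IsSmoothField U X)
    (hY : IsSmoothField U Y) {x : M} (hx : x ∈ U) :
    spinCurvEnd V ρ L e X Y x = (1 / 4 : ℝ) • ∑ k, ∑ l,
      (inner ℝ (curvatureOp L X Y (ε k) x) (ε l x) : ℝ) •
        (cliffEnd V e ρ x (ε k x) * cliffEnd V e ρ x (ε l x)) := by
  rw [spinCurvEnd]
  congr 1
  simp only [inner_curvatureOp_expand hL hU he hε hX hY hx, cliffEnd_eq_sum]
  exact sum_bilinear_smul_mul (fun p j ↦ inner ℝ (e j x) (ε p x))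
    (fun p q ↦ inner ℝ (curvatureOp L X Y (ε p) x) (ε q x)) fun j ↦ matEnd (V x) (gammaMat ρ j)

/-- The second covariant derivative `∇_X ∇_Y ψ - ∇_{∇_X Y} ψ`. -/
def tensorHess (e : Fin n → (x : M) → TangentSpace (𝓡 n) x)
    (L : CovariantDerivative (𝓡 n) (EuclideanSpace ℝ (Fin n)) (fun x : M ↦ TangentSpace (𝓡 n) x))
    (X Y : (x : M) → TangentSpace (𝓡 n) x) (ψ : (x : M) → Fin N → V x) (x : M) : Fin N → V x :=
  tensorDeriv ρ L D e (fun y ↦ tensorDeriv ρ L D e ψ y (Y y)) x (X x)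
    - tensorDeriv ρ L D e ψ x (L Y x (X x))

theorem tensorHess_sub (hL : IsLeviCivita L) (hU : IsOpen U)
    (he : IsOrthonormalFrameOn e U) (hψ : IsSmoothTuple n Fm U ψ)
    (hX : IsSmoothField U X) (hY : IsSmoothField U Y) {x : M} (hx : x ∈ U) :
    tensorHess ρ D e L X Y ψ x - tensorHess ρ D e L Y X ψ x =
      spinCurvEnd V ρ L e X Y x (ψ x) + curvatureAct D X Y ψ x := by
  rw [← tensorDeriv_curvature ρ D hL hU he hψ hX hY hx, hL.mlieBracket_eq hU hX hY hx, map_sub]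
  simp only [tensorHess]
  abel

/-- The square of a Dirac operator, in terms of second covariant derivatives. -/
theorem dirac_dirac (hL : IsLeviCivita L) (hU : IsOpen U)
    (he : IsOrthonormalFrameOn e U) (hε : IsOrthonormalFrameOn ε U) (hψ : IsSmoothTuple n Fm U ψ)
    {x : M} (hx : x ∈ U) :
    ∑ i, cliffEnd V e ρ x (ε i x) (tensorDeriv ρ L D e (fun y ↦
      ∑ k, cliffEnd V e ρ y (ε k y) (tensorDeriv ρ L D e ψ y (ε k y))) x (ε i x)) =
      ∑ i, ∑ k, cliffEnd V e ρ x (ε i x) (cliffEnd V e ρ x (ε k x)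
        (tensorHess ρ D e L (ε i) (ε k) ψ x)) := by
  refine Finset.sum_congr rfl fun i _ ↦ ?_
  rw [← map_sum]
  congr 1
  have hεx := hε.orthonormal x hx
  have hk : ∀ k, IsSmoothTuple n Fm U (fun y ↦ tensorDeriv ρ L D e ψ y (ε k y)) := fun k ↦
    hψ.tensorDeriv ρ D hL hU he (hε.smooth k)
  rw [tensorDeriv_sum ρ D hU Finset.univ (fun k ↦ (hk k).cliffEnd ρ he (hε.smooth k)) hx]
  simp only [tensorDeriv_cliffEnd ρ D hL hU he (hk _) (hε.smooth _) (ε i) hx, tensorHess, map_sub,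
    Finset.sum_add_distrib, Finset.sum_sub_distrib]
  rw [add_comm, sub_eq_add_neg]
  congr 1
  -- Differentiating c(ε_k) and correcting the Hessian by ∇_{∇ε_k} give the same double sum with the
  -- indices of the connection coefficient exchanged; antisymmetry of that coefficient supplies the
  -- sign.
  have h1 : ∀ k, cliffEnd V e ρ x (L (ε k) x (ε i x)) (tensorDeriv ρ L D e ψ x (ε k x)) =
      ∑ l, (inner ℝ (ε l x) (L (ε k) x (ε i x)) : ℝ) •
        cliffEnd V e ρ x (ε l x) (tensorDeriv ρ L D e ψ x (ε k x)) := fun k ↦ by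
    conv_lhs => rw [← hεx.sum_inner_smul (L (ε k) x (ε i x))]
    simp only [map_sum, map_smul, LinearMap.sum_apply, LinearMap.smul_apply]
  have h2 : ∀ l, cliffEnd V e ρ x (ε l x) (tensorDeriv ρ L D e ψ x (L (ε l) x (ε i x))) =
      ∑ k, (inner ℝ (ε k x) (L (ε l) x (ε i x)) : ℝ) •
        cliffEnd V e ρ x (ε l x) (tensorDeriv ρ L D e ψ x (ε k x)) := fun l ↦ by
    conv_lhs => rw [← hεx.sum_inner_smul (L (ε l) x (ε i x))]
    simp only [map_sum, map_smul]
  simp only [h1, h2]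
  rw [Finset.sum_comm, ← Finset.sum_neg_distrib]
  refine Finset.sum_congr rfl fun l _ ↦ ?_
  rw [← Finset.sum_neg_distrib]
  refine Finset.sum_congr rfl fun k _ ↦ ?_
  rw [real_inner_comm, hL.frame_antisymm hU hε (ε i) hx, real_inner_comm, neg_smul]

/-- The Lichnerowicz formula for the Dirac operator of a connection on `V`. -/
theorem lichnerowicz (hL : IsLeviCivita L) (hU : IsOpen U)
    (he : IsOrthonormalFrameOn e U) (hε : IsOrthonormalFrameOn ε U) (hψ : IsSmoothTuple n Fm U ψ)
    {x : M} (hx : x ∈ U) :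
    ∑ i, cliffEnd V e ρ x (ε i x) (tensorDeriv ρ L D e (fun y ↦
      ∑ k, cliffEnd V e ρ y (ε k y) (tensorDeriv ρ L D e ψ y (ε k y))) x (ε i x)) =
      -∑ k, tensorHess ρ D e L (ε k) (ε k) ψ x + (1 / 4 : ℝ) • scalarCurvature L ε x • ψ x
        + (1 / 2 : ℝ) • ∑ i, ∑ j, cliffEnd V e ρ x (ε i x) (cliffEnd V e ρ x (ε j x)
            (curvatureAct D (ε i) (ε j) ψ x)) := by
  have hc := isCliffordFamily_cliffEnd (V := V) e (he.orthonormal x hx) ρ (hε.orthonormal x hx)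
  have hs := hε.smooth
  rw [dirac_dirac ρ D hL hU he hε hψ hx, hc.sum_mul_apply]
  simp only [tensorHess_sub ρ D hL hU he hψ (hs _) (hs _) hx, map_add, Finset.sum_add_distrib,
    smul_add]
  rw [← add_assoc]
  congr 2
  refine hc.half_sum_curvature
    (R := fun i j k l ↦ inner ℝ (curvatureOp L (ε i) (ε j) (ε k) x) (ε l x)) ?_ ?_ ?_
    (fun i j ↦ spinCurvEnd_eq ρ hL hU he hε (hs i) (hs j) hx) (ψ x)
  · intro i j k l
    rw [curvatureOp_swap, inner_neg_left]
  · intro i j k l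
    exact hL.inner_curvatureOp hU (hs i) (hs j) (hs k) (hs l) hx
  · intro i j k l
    rw [← inner_add_left, ← inner_add_left, hL.curvatureOp_cyclic hU (hs i) (hs j) (hs k) hx,
      inner_zero_left]

end Lichnerowicz

/-! ### Change from an orthonormal frame to an arbitrary frame. -/

section Frames

/-- With B the matrix of a frame in an orthonormal one, the Gram matrix is B Bᵀ, and Bᵀ (B Bᵀ)⁻¹ B =
1 turns a metric trace into a plain sum over the orthonormal frame. -/
theorem Matrix.sum_inv_mul_transpose_smul {ι E : Type*} [Fintype ι] [DecidableEq ι]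
    [AddCommGroup E] [Module ℝ E] {B : Matrix ι ι ℝ} (hB : IsUnit B) (h : ι → ι → E) :
    ∑ i, ∑ j, (B * B.transpose)⁻¹ i j • ∑ l, B j l • ∑ k, B i k • h k l = ∑ k, h k k := by
  have hBt : IsUnit B.transpose := (Matrix.isUnit_transpose B).2 hB
  have h1 : B.transpose * (B * B.transpose)⁻¹ * B = 1 := by
    rw [Matrix.mul_inv_rev, ← Matrix.mul_assoc,
      Matrix.mul_nonsing_inv _ ((Matrix.isUnit_iff_isUnit_det _).1 hBt), Matrix.one_mul,
      Matrix.nonsing_inv_mul _ ((Matrix.isUnit_iff_isUnit_det _).1 hB)]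
  generalize (B * B.transpose)⁻¹ = G at h1
  have h2 : ∑ i, ∑ j, G i j • ∑ l, B j l • ∑ k, B i k • h k l =
      ∑ k, ∑ l, (B.transpose * G * B) k l • h k l := by
    simp only [Matrix.mul_apply, Matrix.transpose_apply, Finset.sum_mul, Finset.sum_smul,
      Finset.smul_sum, smul_smul]
    calc ∑ i, ∑ j, ∑ l, ∑ k, (G i j * (B j l * B i k)) • h k l
        = ∑ i, ∑ k, ∑ l, ∑ j, (G i j * (B j l * B i k)) • h k l := by
          refine Finset.sum_congr rfl fun i _ ↦ ?_
          rw [Finset.sum_comm]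
          refine (Finset.sum_congr rfl fun l _ ↦ Finset.sum_comm).trans Finset.sum_comm
      _ = ∑ k, ∑ l, ∑ j, ∑ i, (G i j * (B j l * B i k)) • h k l := by
          rw [Finset.sum_comm]
          refine Finset.sum_congr rfl fun k _ ↦ ?_
          rw [Finset.sum_comm]
          exact Finset.sum_congr rfl fun l _ ↦ Finset.sum_comm
      _ = _ := by
          refine Finset.sum_congr rfl fun k _ ↦ Finset.sum_congr rfl fun l _ ↦
            Finset.sum_congr rfl fun j _ ↦ Finset.sum_congr rfl fun i _ ↦ ?_
          congr 1
          ring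
  rw [h2, h1]
  simp [Matrix.one_apply]

variable {n : ℕ} {M : Type*} [TopologicalSpace M] [ChartedSpace (EuclideanSpace ℝ (Fin n)) M]
  [IsManifold (𝓡 n) ∞ M] [RiemannianBundle (fun x : M ↦ TangentSpace (𝓡 n) x)]

theorem Orthonormal.isUnit_matrix_inner {x : M} {v b : Fin n → TangentSpace (𝓡 n) x}
    (hv : Orthonormal ℝ v) (hb : LinearIndependent ℝ b) :
    IsUnit (Matrix.of fun i k ↦ (inner ℝ (v k) (b i) : ℝ)) := by
  rw [← Matrix.linearIndependent_rows_iff_isUnit]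
  have h : Function.Injective fun w : TangentSpace (𝓡 n) x ↦ fun k ↦ (inner ℝ (v k) w : ℝ) := by
    intro w w' hw
    rw [← hv.sum_inner_smul w, ← hv.sum_inner_smul w']
    exact Finset.sum_congr rfl fun k _ ↦ congrArg (fun r ↦ r • v k) (congrFun hw k)
  exact hb.map' (LinearMap.pi fun k ↦ innerₗ (TangentSpace (𝓡 n) x) (v k))
    (LinearMap.ker_eq_bot.2 h)

theorem Orthonormal.matrix_inner_mul_transpose {x : M} {v : Fin n → TangentSpace (𝓡 n) x}
    (hv : Orthonormal ℝ v) (b : Fin n → TangentSpace (𝓡 n) x) :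
    (Matrix.of fun k l ↦ (inner ℝ (b k) (b l) : ℝ)) =
      (Matrix.of fun i k ↦ (inner ℝ (v k) (b i) : ℝ)) *
        (Matrix.of fun i k ↦ (inner ℝ (v k) (b i) : ℝ)).transpose := by
  ext i j
  simp only [Matrix.mul_apply, Matrix.transpose_apply, Matrix.of_apply,
    hv.sum_inner_mul_inner_tangent]

end Frames

/-! ### The modified connection and its second derivatives. -/

section TwistedConnection


variable {n N : ℕ} {M : Type*} [TopologicalSpace M] [T2Space M]
  [ChartedSpace (EuclideanSpace ℝ (Fin n)) M] [IsManifold (𝓡 n) ∞ M]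
  [RiemannianBundle (fun x : M ↦ TangentSpace (𝓡 n) x)]
  [IsContMDiffRiemannianBundle (𝓡 n) ∞ (EuclideanSpace ℝ (Fin n))
    (fun x : M ↦ TangentSpace (𝓡 n) x)]
  {𝕜 : Type*} [RCLike 𝕜]
  {Fm : Type*} [NormedAddCommGroup Fm] [NormedSpace 𝕜 Fm] [NormedSpace ℝ Fm]
  [IsScalarTower ℝ 𝕜 Fm] [FiniteDimensional ℝ Fm]
  {V : M → Type*} [∀ x, NormedAddCommGroup (V x)] [∀ x, InnerProductSpace 𝕜 (V x)]
  [∀ x, NormedSpace ℝ (V x)] [∀ x, IsScalarTower ℝ 𝕜 (V x)]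
  [TopologicalSpace (TotalSpace Fm V)] [FiberBundle Fm V]
  [VectorBundle 𝕜 Fm V] [VectorBundle ℝ Fm V] [ContMDiffVectorBundle ∞ Fm V (𝓡 n)]
  {L : CovariantDerivative (𝓡 n) (EuclideanSpace ℝ (Fin n)) (fun x : M ↦ TangentSpace (𝓡 n) x)}
  {e ε : Fin n → (x : M) → TangentSpace (𝓡 n) x} {U : Set M}
  (ρ : Cl n →ₐ[ℝ] Matrix (Fin N) (Fin N) 𝕜) (D D' : LinConnection n 𝕜 Fm V)
  {ψ : (x : M) → Fin N → V x}


  {b : Fin n → (x : M) → TangentSpace (𝓡 n) x} {X Y : (x : M) → TangentSpace (𝓡 n) x}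

/-- The endomorphism `c(Φ) c(v) - c(v) c(Φ)` of the fibre of `S(TM) ⊗ V` at `x`. -/
def twistEnd (e ε : Fin n → (x : M) → TangentSpace (𝓡 n) x) (x : M) :
    TangentSpace (𝓡 n) x →ₗ[ℝ] Module.End ℝ (Fin N → V x) :=
  LinearMap.mulLeft ℝ (cPhiEnd ρ D D' e ε x) ∘ₗ cliffEnd V e ρ x
    - LinearMap.mulRight ℝ (cPhiEnd ρ D D' e ε x) ∘ₗ cliffEnd V e ρ x

theorem twistEnd_apply (x : M) (v : TangentSpace (𝓡 n) x) (u : Fin N → V x) :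
    twistEnd ρ D D' e ε x v u = cPhiEnd ρ D D' e ε x (cliffEnd V e ρ x v u)
      - cliffEnd V e ρ x v (cPhiEnd ρ D D' e ε x u) := rfl

variable {D D'} in
theorem twistTerm_apply (hg : IsSmoothFibreMetric n 𝕜 Fm V) (hD : IsDualConnection D D')
    (X : (x : M) → TangentSpace (𝓡 n) x) (ψ : (x : M) → Fin N → V x) (x : M) :
    twistTerm ρ D D' e ε X ψ x = twistEnd ρ D D' e ε x (X x) (ψ x) := by
  rw [twistTerm, cPhiStar_apply ρ hg hD, cliffMul_apply, cliffMul_apply, cPhi_apply, twistEnd_apply]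

/-- The modified connection at a point, as a linear map in the tangent vector. -/
def barDeriv (L : CovariantDerivative (𝓡 n) (EuclideanSpace ℝ (Fin n))
      (fun x : M ↦ TangentSpace (𝓡 n) x))
    (e ε : Fin n → (x : M) → TangentSpace (𝓡 n) x) (ψ : (x : M) → Fin N → V x) (x : M) :
    TangentSpace (𝓡 n) x →ₗ[ℝ] (Fin N → V x) :=
  tensorDeriv ρ L (midConnection D D') e ψ x
    + (1 / 2 : ℝ) • (twistEnd ρ D D' e ε x).flip (ψ x)

theorem barDeriv_apply (ψ : (x : M) → Fin N → V x) (x : M) (v : TangentSpace (𝓡 n) x) :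
    barDeriv ρ D D' L e ε ψ x v = tensorDeriv ρ L (midConnection D D') e ψ x v
      + (1 / 2 : ℝ) • twistEnd ρ D D' e ε x v (ψ x) := rfl

variable {D D'} in
theorem barConn_apply (hg : IsSmoothFibreMetric n 𝕜 Fm V) (hD : IsDualConnection D D')
    (X : (x : M) → TangentSpace (𝓡 n) x) (ψ : (x : M) → Fin N → V x) (x : M) :
    barConn ρ L D D' e ε X ψ x = barDeriv ρ D D' L e ε ψ x (X x) := by
  rw [barConn, tensorConn_apply, twistTerm_apply ρ hg hD, barDeriv_apply]

theorem IsSmoothTuple.twistEnd (hψ : IsSmoothTuple n Fm U ψ) (hU : IsOpen U)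
    (he : IsOrthonormalFrameOn e U) (hε : IsOrthonormalFrameOn ε U) (hX : IsSmoothField U X) :
    IsSmoothTuple n Fm U (fun y ↦ twistEnd ρ D D' e ε y (X y) (ψ y)) := by
  refine (((hψ.cliffEnd ρ he hX).cPhiEnd ρ D D' hU he hε).add
    (((hψ.cPhiEnd ρ D D' hU he hε).cliffEnd ρ he hX).const_smul (-1))).congr fun y _ ↦ ?_
  rw [twistEnd_apply, neg_one_smul, sub_eq_add_neg]

theorem IsSmoothTuple.barDeriv (hψ : IsSmoothTuple n Fm U ψ) (hL : IsLeviCivita L) (hU : IsOpen U)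
    (he : IsOrthonormalFrameOn e U) (hε : IsOrthonormalFrameOn ε U) (hX : IsSmoothField U X) :
    IsSmoothTuple n Fm U (fun y ↦ barDeriv ρ D D' L e ε ψ y (X y)) :=
  (hψ.tensorDeriv ρ _ hL hU he hX).add ((hψ.twistEnd ρ D D' hU he hε hX).const_smul (1 / 2))

theorem barDeriv_congr (hU : IsOpen U) {φ : (x : M) → Fin N → V x} (hψ : IsSmoothTuple n Fm U ψ)
    (h : ∀ y ∈ U, ψ y = φ y) {x : M} (hx : x ∈ U) :
    barDeriv ρ D D' L e ε ψ x = barDeriv ρ D D' L e ε φ x := by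
  rw [barDeriv, barDeriv, tensorDeriv_congr ρ _ hU hψ h hx, h x hx]

theorem barDeriv_sum_smul (hU : IsOpen U) {ι : Type*} (s : Finset ι) {f : ι → M → ℝ}
    {χ : ι → (x : M) → Fin N → V x} (hf : ∀ i, ContMDiffOn (𝓡 n) 𝓘(ℝ, ℝ) ∞ (f i) U)
    (hχ : ∀ i, IsSmoothTuple n Fm U (χ i)) {x : M} (hx : x ∈ U) (v : TangentSpace (𝓡 n) x) :
    barDeriv ρ D D' L e ε (fun y ↦ ∑ i ∈ s, f i y • χ i y) x v =
      ∑ i ∈ s, (mvfderiv (𝓡 n) (f i) x v • χ i x + f i x • barDeriv ρ D D' L e ε (χ i) x v) := by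
  simp only [barDeriv_apply, tensorDeriv_sum_smul ρ _ hU s hf hχ hx, map_sum, map_smul,
    Finset.smul_sum, ← Finset.sum_add_distrib]
  refine Finset.sum_congr rfl fun i _ ↦ ?_
  rw [smul_add, smul_comm (1 / 2 : ℝ), add_assoc]

/-- The second covariant derivative `∇̄_v ∇̄_Y ψ - ∇̄_{∇_v Y} ψ` of the modified connection. -/
def barHess (L : CovariantDerivative (𝓡 n) (EuclideanSpace ℝ (Fin n))
      (fun x : M ↦ TangentSpace (𝓡 n) x))
    (e ε : Fin n → (x : M) → TangentSpace (𝓡 n) x) (Y : (x : M) → TangentSpace (𝓡 n) x)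
    (ψ : (x : M) → Fin N → V x) (x : M) : TangentSpace (𝓡 n) x →ₗ[ℝ] (Fin N → V x) :=
  barDeriv ρ D D' L e ε (fun y ↦ barDeriv ρ D D' L e ε ψ y (Y y)) x
    - barDeriv ρ D D' L e ε ψ x ∘ₗ (L Y x).toLinearMap

theorem barHess_apply (Y : (x : M) → TangentSpace (𝓡 n) x) (ψ : (x : M) → Fin N → V x) (x : M)
    (v : TangentSpace (𝓡 n) x) :
    barHess ρ D D' L e ε Y ψ x v =
      barDeriv ρ D D' L e ε (fun y ↦ barDeriv ρ D D' L e ε ψ y (Y y)) x v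
        - barDeriv ρ D D' L e ε ψ x (L Y x v) := rfl

/-- Tensoriality in `Y`: the derivatives of the coefficients ⟨ε_l, Y⟩ occur equally in the iterated
derivative and in the correction along ∇_v Y. Only the Leibniz rule and linearity in the direction
are used, so the zeroth order twist is harmless. -/
theorem barHess_expand (hL : IsLeviCivita L) (hU : IsOpen U) (he : IsOrthonormalFrameOn e U)
    (hε : IsOrthonormalFrameOn ε U) (hψ : IsSmoothTuple n Fm U ψ) (hY : IsSmoothField U Y) {x : M}
    (hx : x ∈ U) (v : TangentSpace (𝓡 n) x) :
    barHess ρ D D' L e ε Y ψ x v =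
      ∑ l, (inner ℝ (ε l x) (Y x) : ℝ) • barHess ρ D D' L e ε (ε l) ψ x v := by
  have hf := fun l ↦ contMDiffOn_inner (hε.smooth l) hY
  have hχ := fun l ↦ hψ.barDeriv ρ D D' hL hU he hε (hε.smooth l)
  have h1 := barDeriv_congr ρ D D' (L := L) (e := e) (ε := ε) hU
    (hψ.barDeriv ρ D D' hL hU he hε hY)
    (φ := fun y ↦ ∑ l, (inner ℝ (ε l y) (Y y) : ℝ) • barDeriv ρ D D' L e ε ψ y (ε l y))
    (fun y hy ↦ by
      conv_lhs => rw [← (hε.orthonormal y hy).sum_inner_smul (Y y)]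
      simp only [map_sum, map_smul]) hx
  have h2 := L.congr_of_isOpen hU hY
    (fun y hy ↦ ((hε.orthonormal y hy).sum_inner_smul (Y y)).symm) hx
  have h3 := L.sum_smul_apply Finset.univ
    (fun l ↦ ((hf l x hx).contMDiffAt (hU.mem_nhds hx)).mdifferentiableAt (by simp))
    (fun l ↦ (hε.smooth l).mdifferentiableAt_section hU hx) v
  simp only [barHess_apply]
  rw [h1, barDeriv_sum_smul ρ D D' hU _ hf hχ hx, h2, h3]
  simp only [map_sum, map_add, map_smul]
  rw [← Finset.sum_sub_distrib]
  refine Finset.sum_congr rfl fun l _ ↦ ?_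
  rw [smul_sub, add_sub_add_left_eq_sub]

/-- The modified connection Laplacian does not depend on the frame. -/
theorem barLaplacian_eq_sum_barHess (hg : IsSmoothFibreMetric n 𝕜 Fm V)
    (hD : IsDualConnection D D') (hL : IsLeviCivita L) (hU : IsOpen U)
    (he : IsOrthonormalFrameOn e U) (hε : IsOrthonormalFrameOn ε U)
    (hb : IsLocalFrameOn (𝓡 n) (EuclideanSpace ℝ (Fin n)) ∞ b U) (hψ : IsSmoothTuple n Fm U ψ)
    {x : M} (hx : x ∈ U) :
    barLaplacian ρ L D D' e ε b ψ x = ∑ k, barHess ρ D D' L e ε (ε k) ψ x (ε k x) := by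
  have hεx := hε.orthonormal x hx
  have hfun : ∀ j, barConn ρ L D D' e ε (b j) ψ = fun y ↦ barDeriv ρ D D' L e ε ψ y (b j y) :=
    fun j ↦ funext fun y ↦ barConn_apply ρ hg hD (b j) ψ y
  have hexp : ∀ i j, barConn ρ L D D' e ε (b i) (barConn ρ L D D' e ε (b j) ψ) x
      - barConn ρ L D D' e ε (fun y ↦ L (b j) y (b i y)) ψ x =
      ∑ l, (inner ℝ (ε l x) (b j x) : ℝ) • ∑ k, (inner ℝ (ε k x) (b i x) : ℝ) •
        barHess ρ D D' L e ε (ε l) ψ x (ε k x) := by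
    intro i j
    rw [barConn_apply ρ hg hD, barConn_apply ρ hg hD, hfun, ← barHess_apply,
      barHess_expand ρ D D' hL hU he hε hψ (hb.contMDiffOn j) hx]
    refine Finset.sum_congr rfl fun l _ ↦ ?_
    conv_lhs => rw [← hεx.sum_inner_smul (b i x)]
    simp only [map_sum, map_smul]
  rw [barLaplacian, hεx.matrix_inner_mul_transpose fun i ↦ b i x]
  simp only [hexp]
  exact Matrix.sum_inv_mul_transpose_smul
    (hεx.isUnit_matrix_inner (b := fun i ↦ b i x) (hb.linearIndependent hx))
    fun k l ↦ barHess ρ D D' L e ε (ε l) ψ x (ε k x)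

/-- The second covariant derivatives of the modified connection along a frame field. -/
theorem barHess_self (hL : IsLeviCivita L) (hU : IsOpen U) (he : IsOrthonormalFrameOn e U)
    (hε : IsOrthonormalFrameOn ε U) (hψ : IsSmoothTuple n Fm U ψ) (hX : IsSmoothField U X) {x : M}
    (hx : x ∈ U) :
    barHess ρ D D' L e ε X ψ x (X x) = tensorHess ρ (midConnection D D') e L X X ψ x
      + (1 / 2 : ℝ) • (tensorDeriv ρ L (midConnection D D') e
          (fun y ↦ cPhiEnd ρ D D' e ε y (cliffEnd V e ρ y (X y) (ψ y))) x (X x)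
        - (cliffEnd V e ρ x (L X x (X x)) (cPhiEnd ρ D D' e ε x (ψ x))
          + cliffEnd V e ρ x (X x) (tensorDeriv ρ L (midConnection D D') e
            (fun y ↦ cPhiEnd ρ D D' e ε y (ψ y)) x (X x)))
        + twistEnd ρ D D' e ε x (X x) (tensorDeriv ρ L (midConnection D D') e ψ x (X x))
        - twistEnd ρ D D' e ε x (L X x (X x)) (ψ x))
      + (1 / 4 : ℝ) • twistEnd ρ D D' e ε x (X x) (twistEnd ρ D D' e ε x (X x) (ψ x)) := by
  have h1 := hψ.tensorDeriv ρ (midConnection D D') hL hU he hX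
  have h2 := (hψ.cliffEnd ρ he hX).cPhiEnd ρ D D' hU he hε
  have h3 := hψ.cPhiEnd ρ D D' hU he hε
  have h4 := h3.cliffEnd ρ he hX
  have h5 := hψ.twistEnd ρ D D' hU he hε hX
  -- The derivative of C c(X)ψ stays unexpanded, since it also occurs in (∇_X C) c(X)ψ; that of
  -- c(X)Cψ is expanded below by parallelism.
  have hd : tensorDeriv ρ L (midConnection D D') e
      (fun y ↦ barDeriv ρ D D' L e ε ψ y (X y)) x =
      tensorDeriv ρ L (midConnection D D') e
        (fun y ↦ tensorDeriv ρ L (midConnection D D') e ψ y (X y)) x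
      + (1 / 2 : ℝ) • (tensorDeriv ρ L (midConnection D D') e
          (fun y ↦ cPhiEnd ρ D D' e ε y (cliffEnd V e ρ y (X y) (ψ y))) x
        - tensorDeriv ρ L (midConnection D D') e
          (fun y ↦ cliffEnd V e ρ y (X y) (cPhiEnd ρ D D' e ε y (ψ y))) x) := by
    rw [← tensorDeriv_sub ρ _ hU h2 h4 hx]
    exact (tensorDeriv_add ρ _ hU h1 (h5.const_smul (1 / 2)) hx).trans
      (by rw [tensorDeriv_const_smul ρ _ hU _ h5 hx]; rfl)
  rw [barHess_apply, barDeriv_apply, hd, barDeriv_apply, barDeriv_apply, tensorHess]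
  simp only [LinearMap.add_apply, LinearMap.smul_apply, LinearMap.sub_apply,
    tensorDeriv_cliffEnd ρ _ hL hU he h3 hX X hx, map_add, map_smul]
  module

end TwistedConnection

/-! ### Completing the square and assembling the formula. -/

section Weitzenboeck


variable {n N : ℕ} {M : Type*} [TopologicalSpace M] [T2Space M]
  [ChartedSpace (EuclideanSpace ℝ (Fin n)) M] [IsManifold (𝓡 n) ∞ M]
  [RiemannianBundle (fun x : M ↦ TangentSpace (𝓡 n) x)]
  [IsContMDiffRiemannianBundle (𝓡 n) ∞ (EuclideanSpace ℝ (Fin n))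
    (fun x : M ↦ TangentSpace (𝓡 n) x)]
  {𝕜 : Type*} [RCLike 𝕜]
  {Fm : Type*} [NormedAddCommGroup Fm] [NormedSpace 𝕜 Fm] [NormedSpace ℝ Fm]
  [IsScalarTower ℝ 𝕜 Fm] [FiniteDimensional ℝ Fm]
  {V : M → Type*} [∀ x, NormedAddCommGroup (V x)] [∀ x, InnerProductSpace 𝕜 (V x)]
  [∀ x, NormedSpace ℝ (V x)] [∀ x, IsScalarTower ℝ 𝕜 (V x)]
  [TopologicalSpace (TotalSpace Fm V)] [FiberBundle Fm V]
  [VectorBundle 𝕜 Fm V] [VectorBundle ℝ Fm V] [ContMDiffVectorBundle ∞ Fm V (𝓡 n)]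
  {L : CovariantDerivative (𝓡 n) (EuclideanSpace ℝ (Fin n)) (fun x : M ↦ TangentSpace (𝓡 n) x)}
  {e ε : Fin n → (x : M) → TangentSpace (𝓡 n) x} {U : Set M}
  (ρ : Cl n →ₐ[ℝ] Matrix (Fin N) (Fin N) 𝕜) (D D' : LinConnection n 𝕜 Fm V)
  {ψ : (x : M) → Fin N → V x}


  {b : Fin n → (x : M) → TangentSpace (𝓡 n) x} {X Y : (x : M) → TangentSpace (𝓡 n) x}

theorem curvatureAct_self (X : (x : M) → TangentSpace (𝓡 n) x) (ψ : (x : M) → Fin N → V x)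
    (x : M) : curvatureAct D X X ψ x = 0 := by
  rw [curvatureAct_eq_tupleDeriv, sub_self, VectorField.mlieBracket_self, zero_sub]
  simp

/-- R^F commutes with both Clifford factors, and its diagonal vanishes, so the restriction i ≠ j
costs nothing. -/
theorem sum_curvatureAct_cliffMul (hU : IsOpen U) (he : IsOrthonormalFrameOn e U)
    (hε : IsOrthonormalFrameOn ε U) (hψ : IsSmoothTuple n Fm U ψ) {x : M} (hx : x ∈ U) :
    ∑ i, ∑ j ∈ Finset.univ.filter (fun j ↦ i ≠ j),
        curvatureAct D (ε i) (ε j) (cliffMul ρ e (ε i) (cliffMul ρ e (ε j) ψ)) x =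
      ∑ i, ∑ j, cliffEnd V e ρ x (ε i x) (cliffEnd V e ρ x (ε j x)
        (curvatureAct D (ε i) (ε j) ψ x)) := by
  refine Finset.sum_congr rfl fun i _ ↦ ?_
  have hs := hε.smooth
  have h : ∀ j, curvatureAct D (ε i) (ε j) (cliffMul ρ e (ε i) (cliffMul ρ e (ε j) ψ)) x =
      cliffEnd V e ρ x (ε i x) (cliffEnd V e ρ x (ε j x) (curvatureAct D (ε i) (ε j) ψ x)) :=
    fun j ↦ (curvatureAct_cliffEnd ρ D hU he (hψ.cliffEnd ρ he (hs j)) (hs i) (hs j) (hs i)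
      hx).trans (by rw [curvatureAct_cliffEnd ρ D hU he hψ (hs i) (hs j) (hs j) hx])
  simp only [h]
  refine Finset.sum_subset (Finset.filter_subset _ _) fun j _ hj ↦ ?_
  obtain rfl : i = j := by simpa using hj
  rw [curvatureAct_self, map_zero, map_zero]

theorem covDerivEnd_of_apply {T : ((x : M) → Fin N → V x) → (x : M) → Fin N → V x}
    {S : (x : M) → Module.End ℝ (Fin N → V x)} (hT : ∀ ψ x, T ψ x = S x (ψ x))
    (X : (x : M) → TangentSpace (𝓡 n) x) (ψ : (x : M) → Fin N → V x) (x : M) :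
    covDerivEnd ρ L D e X T ψ x = tensorDeriv ρ L D e (fun y ↦ S y (ψ y)) x (X x)
      - S x (tensorDeriv ρ L D e ψ x (X x)) := by
  have h : T ψ = fun y ↦ S y (ψ y) := funext (hT ψ)
  rw [covDerivEnd, hT, tensorConn_apply, tensorConn_apply, h]

/-- Completing the square in the modified connection, along one frame field. -/
theorem neg_barHess_self_add_covDeriv (hL : IsLeviCivita L) (hU : IsOpen U)
    (he : IsOrthonormalFrameOn e U) (hε : IsOrthonormalFrameOn ε U) (hψ : IsSmoothTuple n Fm U ψ)
    (hX : IsSmoothField U X) {x : M} (hx : x ∈ U) :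
    -barHess ρ D D' L e ε X ψ x (X x)
      + (1 / 2 : ℝ) • (tensorDeriv ρ L (midConnection D D') e
          (fun y ↦ cPhiEnd ρ D D' e ε y (cliffEnd V e ρ y (X y) (ψ y))) x (X x)
        - cPhiEnd ρ D D' e ε x (tensorDeriv ρ L (midConnection D D') e
          (fun y ↦ cliffEnd V e ρ y (X y) (ψ y)) x (X x)))
      + (1 / 2 : ℝ) • cliffEnd V e ρ x (X x) (tensorDeriv ρ L (midConnection D D') e
          (fun y ↦ cPhiEnd ρ D D' e ε y (ψ y)) x (X x)
        - cPhiEnd ρ D D' e ε x (tensorDeriv ρ L (midConnection D D') e ψ x (X x)))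
      + (1 / 4 : ℝ) • twistEnd ρ D D' e ε x (X x) (twistEnd ρ D D' e ε x (X x) (ψ x)) =
    -tensorHess ρ (midConnection D D') e L X X ψ x
      + cliffEnd V e ρ x (X x) (tensorDeriv ρ L (midConnection D D') e
          (fun y ↦ cPhiEnd ρ D D' e ε y (ψ y)) x (X x))
      - cPhiEnd ρ D D' e ε x (cliffEnd V e ρ x (X x)
          (tensorDeriv ρ L (midConnection D D') e ψ x (X x))) := by
  rw [barHess_self ρ D D' hL hU he hε hψ hX hx, tensorDeriv_cliffEnd ρ _ hL hU he hψ hX X hx]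
  -- The quadratic term enters once through the modified Hessian and once explicitly, with opposite
  -- signs, so it is kept opaque. The terms in ∇_X X that remain cancel as well.
  generalize twistEnd ρ D D' e ε x (X x) (twistEnd ρ D D' e ε x (X x) (ψ x)) = t
  simp only [twistEnd_apply, map_add, map_sub]
  module

variable {D D'} in
/-- The Lichnerowicz formula for the twisted Dirac operator, in one spin gauge. -/
theorem diracAdjOp_diracOp (hg : IsSmoothFibreMetric n 𝕜 Fm V) (hD : IsDualConnection D D')
    (hL : IsLeviCivita L) (hU : IsOpen U) (he : IsOrthonormalFrameOn e U)
    (hε : IsOrthonormalFrameOn ε U)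
    (hb : IsLocalFrameOn (𝓡 n) (EuclideanSpace ℝ (Fin n)) ∞ b U) (hψ : IsSmoothTuple n Fm U ψ)
    {x : M} (hx : x ∈ U) :
    diracAdjOp ρ L D D' e ε (diracOp ρ L D e ε ψ) x =
      - barLaplacian ρ L D D' e ε b ψ x
      + (1 / 4 : ℝ) • scalarCurvature L ε x • ψ x
      + (1 / 2 : ℝ) • ∑ i, ∑ j ∈ Finset.univ.filter (fun j ↦ i ≠ j),
          curvatureAct (midConnection D D') (ε i) (ε j)
            (cliffMul ρ e (ε i) (cliffMul ρ e (ε j) ψ)) x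
      - cPhiStar ρ D D' e ε (cPhi ρ D D' e ε ψ) x
      + (1 / 2 : ℝ) • ∑ j, covDerivEnd ρ L (midConnection D D') e (ε j)
            (cPhiStar ρ D D' e ε) (cliffMul ρ e (ε j) ψ) x
      + (1 / 2 : ℝ) • ∑ j, cliffMul ρ e (ε j)
            (covDerivEnd ρ L (midConnection D D') e (ε j) (cPhi ρ D D' e ε) ψ) x
      + (1 / 4 : ℝ) • ∑ i, twistTerm ρ D D' e ε (ε i) (twistTerm ρ D D' e ε (ε i) ψ) x := by
  have hs := hε.smooth
  have hC := hψ.cPhiEnd ρ D D' hU he hε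
  have hχ := IsSmoothTuple.sum Finset.univ fun k ↦
    (hψ.tensorDeriv ρ (midConnection D D') hL hU he (hs k)).cliffEnd ρ he (hs k)
  have hdirac := fun y (hy : y ∈ U) ↦
    (diracOp_eq_mid_add (L := L) (e := e) (ε := ε) ρ D D' hU hψ hy).symm
  -- Expansion of (D_F − C)(D_F + C)ψ, with the Lichnerowicz formula inserted for D_F².
  have hLHS : diracAdjOp ρ L D D' e ε (diracOp ρ L D e ε ψ) x =
      -∑ k, tensorHess ρ (midConnection D D') e L (ε k) (ε k) ψ x
      + (1 / 4 : ℝ) • scalarCurvature L ε x • ψ x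
      + (1 / 2 : ℝ) • ∑ i, ∑ j, cliffEnd V e ρ x (ε i x) (cliffEnd V e ρ x (ε j x)
          (curvatureAct (midConnection D D') (ε i) (ε j) ψ x))
      + ∑ k, cliffEnd V e ρ x (ε k x) (tensorDeriv ρ L (midConnection D D') e
          (fun y ↦ cPhiEnd ρ D D' e ε y (ψ y)) x (ε k x))
      - ∑ k, cPhiEnd ρ D D' e ε x (cliffEnd V e ρ x (ε k x)
          (tensorDeriv ρ L (midConnection D D') e ψ x (ε k x)))
      - cPhiEnd ρ D D' e ε x (cPhiEnd ρ D D' e ε x (ψ x)) := by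
    rw [diracAdjOp, cPhiStar_apply ρ hg hD, ← hdirac x hx, diracOp_apply,
      ← tensorDeriv_congr ρ (midConnection D D') hU (hχ.add hC) hdirac hx,
      tensorDeriv_add ρ _ hU hχ hC hx]
    simp only [LinearMap.add_apply, map_add, Finset.sum_add_distrib]
    rw [lichnerowicz ρ _ hL hU he hε hψ hx, map_sum]
    abel
  have hstar : ∀ φ : (x : M) → Fin N → V x, ∀ y,
      cPhiStar ρ D D' e ε φ y = cPhiEnd ρ D D' e ε y (φ y) := cPhiStar_apply ρ hg hD
  have htwist : ∀ i, twistTerm ρ D D' e ε (ε i) (twistTerm ρ D D' e ε (ε i) ψ) x =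
      twistEnd ρ D D' e ε x (ε i x) (twistEnd ρ D D' e ε x (ε i x) (ψ x)) := fun i ↦ by
    rw [twistTerm_apply ρ hg hD, twistTerm_apply ρ hg hD]
  have hcliff : ∀ j, cliffMul ρ e (ε j) ψ = fun y ↦ cliffEnd V e ρ y (ε j y) (ψ y) := fun j ↦ rfl
  rw [hLHS, barLaplacian_eq_sum_barHess ρ D D' hg hD hL hU he hε hb hψ hx,
    sum_curvatureAct_cliffMul ρ _ hU he hε hψ hx, hstar, cPhi_apply]
  simp only [htwist, covDerivEnd_of_apply ρ (midConnection D D') hstar, cliffMul_apply,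
    covDerivEnd_of_apply ρ (midConnection D D') (cPhi_apply ρ D D'), hcliff]
  have hsum := Finset.sum_congr (rfl : (Finset.univ : Finset (Fin n)) = _) fun k _ ↦
    neg_barHess_self_add_covDeriv ρ D D' hL hU he hε hψ (hs k) hx
  simp only [Finset.sum_add_distrib, Finset.sum_sub_distrib, Finset.sum_neg_distrib,
    ← Finset.smul_sum] at hsum ⊢
  linear_combination (norm := module) (-1 : ℝ) • hsum

end Weitzenboeck

theorem theorem2p2 {n N : ℕ} {M : Type*} [TopologicalSpace M] [T2Space M]
    [ChartedSpace (EuclideanSpace ℝ (Fin n)) M] [IsManifold (𝓡 n) ∞ M]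
    [RiemannianBundle (fun x : M ↦ TangentSpace (𝓡 n) x)]
    [IsContMDiffRiemannianBundle (𝓡 n) ∞ (EuclideanSpace ℝ (Fin n))
      (fun x : M ↦ TangentSpace (𝓡 n) x)]
    -- the spin structure and the spin representation
    {ι : Type*} (P : SpinStructure n M ι)
    {𝕜 : Type*} [RCLike 𝕜] (ρ : Cl n →ₐ[ℝ] Matrix (Fin N) (Fin N) 𝕜)
    -- the vector bundle `V` (the bundle `F`) with its fibre metric
    {Fm : Type*} [NormedAddCommGroup Fm] [NormedSpace 𝕜 Fm] [NormedSpace ℝ Fm]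
    [IsScalarTower ℝ 𝕜 Fm] [FiniteDimensional ℝ Fm]
    {V : M → Type*} [∀ x, NormedAddCommGroup (V x)] [∀ x, InnerProductSpace 𝕜 (V x)]
    [∀ x, NormedSpace ℝ (V x)] [∀ x, IsScalarTower ℝ 𝕜 (V x)]
    [TopologicalSpace (TotalSpace Fm V)] [FiberBundle Fm V]
    [VectorBundle 𝕜 Fm V] [VectorBundle ℝ Fm V] [ContMDiffVectorBundle ∞ Fm V (𝓡 n)]
    (_hg : IsSmoothFibreMetric n 𝕜 Fm V)
    -- the Levi-Civita connection, the given connection `D` on `V` and its dual `D'`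
    (L : CovariantDerivative (𝓡 n) (EuclideanSpace ℝ (Fin n)) (fun x : M ↦ TangentSpace (𝓡 n) x))
    (_hL : IsLeviCivita L)
    (D D' : LinConnection n 𝕜 Fm V) (_hD : IsDualConnection D D')
    -- a local orthonormal frame `ε` and a local frame `b` of `TM`
    (W : Set M) (_hW : IsOpen W)
    (ε : Fin n → (x : M) → TangentSpace (𝓡 n) x) (_hε : IsOrthonormalFrameOn ε W)
    (b : Fin n → (x : M) → TangentSpace (𝓡 n) x)
    (_hb : IsLocalFrameOn (𝓡 n) (EuclideanSpace ℝ (Fin n)) ∞ b W)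
    -- a smooth section of `S(TM) ⊗ V`
    (ψ : SpinorField Fm V P ρ) (a : ι) (x : M) (_hxa : x ∈ P.U a) (_hxW : x ∈ W) :
    diracAdjOp ρ L D D' (P.frame a) ε (diracOp ρ L D (P.frame a) ε (ψ.rep a)) x =
      - barLaplacian ρ L D D' (P.frame a) ε b (ψ.rep a) x
      + (1 / 4 : ℝ) • scalarCurvature L ε x • ψ.rep a x
      + (1 / 2 : ℝ) • ∑ i, ∑ j ∈ Finset.univ.filter (fun j ↦ i ≠ j),
          curvatureAct (midConnection D D') (ε i) (ε j)
            (cliffMul ρ (P.frame a) (ε i) (cliffMul ρ (P.frame a) (ε j) (ψ.rep a))) x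
      - cPhiStar ρ D D' (P.frame a) ε (cPhi ρ D D' (P.frame a) ε (ψ.rep a)) x
      + (1 / 2 : ℝ) • ∑ j,
          covDerivEnd ρ L (midConnection D D') (P.frame a) (ε j)
            (cPhiStar ρ D D' (P.frame a) ε) (cliffMul ρ (P.frame a) (ε j) (ψ.rep a)) x
      + (1 / 2 : ℝ) • ∑ j,
          cliffMul ρ (P.frame a) (ε j)
            (covDerivEnd ρ L (midConnection D D') (P.frame a) (ε j)
              (cPhi ρ D D' (P.frame a) ε) (ψ.rep a)) x
      + (1 / 4 : ℝ) • ∑ i,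
          twistTerm ρ D D' (P.frame a) ε (ε i)
            (twistTerm ρ D D' (P.frame a) ε (ε i) (ψ.rep a)) x := by
  -- The identity is local, so it suffices to work where the gauge and both given frames are all
  -- defined.
  have hU : IsOpen (P.U a ∩ W) := (P.isOpen_U a).inter _hW
  have he := (P.isFrame a).mono (Set.inter_subset_left (t := W))
  have hε := _hε.mono (Set.inter_subset_right (s := P.U a))
  have hb := _hb.mono (Set.inter_subset_right (s := P.U a))
  have hψ : IsSmoothTuple n Fm (P.U a ∩ W) (ψ.rep a) := fun A ↦
    (ψ.smooth a A).mono Set.inter_subset_left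
  exact diracAdjOp_diracOp ρ _hg _hD _hL hU he hε hb hψ ⟨_hxa, _hxW⟩
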